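/- Let $k$ be a field of characteristic zero, $R=k[[u,t]]$, $\mathcal M=(u,t)$, $T=\operatorname{Spec}R$, $T_1=\operatorname{Spec}R/(t)\subset T$, and let $O$ be the closed point of $T$. A geometric datum of rank $r$ is a triple $(X,j,\mathcal F)$, where $X$ is an integral projective surface over $k$, $j:T\to X$ is a dominant $k$-morphism and $\mathcal F\subset j_*\mathcal O_T$ is a quasi-coherent subsheaf of $\mathcal O_X$-modules, such that: 1. the closed subscheme $C\subset X$ defined by the ideal $\ker(\mathcal O_X\to j_*\mathcal O_T\to j_*\mathcal O_{T_1})$ is a curve, and $P=j(O)$ is a regular point of $C$ and of $X$; 2. $T_1\times_X\{P\}=\{O\}$ and $T\times_XC=rT_1$ (that is, the subscheme of $T$ defined by $t^r$); 3. there are an integer $d>0$ and an effective, very ample Cartier divisor $C'$ on $X$ with cycle $dC$ such that for all $n\ge 0$ the map $$H^0(X,\mathcal F(nC'))\to H^0(X,j_*\mathcal O_T(nC'))=Rt^{-ndr}\to Rt^{-ndr}/\mathcal M^{ndr+1}t^{-ndr}$$ induced by $\mathcal F\subset j_*\mathcal O_T$ is an isomorphism. For $n=0$ condition 3 gives an isomorphism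 $H^0(X,\mathcal F)\cong R/\mathcal M=k$. Hence there is exactly one morphism $e:\mathcal O_X\to\mathcal F$ for which $1\in H^0(X,\mathcal O_X)$ is mapped to an element of $H^0(X,\mathcal F)\subset R$ with constant term $1$; it is a monomorphism, called the canonical embedding. **Proposition.** Let $(X,j,\mathcal F)$ be a geometric datum of rank $r$ over $k$, and let $e:\mathcal O_X\to\mathcal F$ be its canonical embedding (which exists, is unique and is a monomorphism). (i) If $e_P:\mathcal O_{X,P}\to\mathcal F_P$ is an isomorphism, then $r=1$. (ii) $\mathcal O_X=\mathcal F$ (that is, $e$ is an isomorphism) if and only if $r=1$ and there is an isomorphism $X\cong\mathbb P^2_k$ over $k$ which carries $C$ to a line. In particular, if $e_P$ is an isomorphism, then $\mathcal O_X=\mathcal F$ if and only if $X=\mathbb P^2$ and $C$ is a line. -/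

import Mathlib

open CategoryTheory AlgebraicGeometry

universe u

noncomputable section

attribute [local instance] MvPolynomial.gradedAlgebra

/-! ### Projective space over a field -/

/-- Projective `N`-space `ℙᴺ = Proj k[x₀, …, x_N]` over `k`. -/
abbrev PSpace (k : Type u) [Field k] (N : ℕ) : Scheme.{u} :=
  Proj (MvPolynomial.homogeneousSubmodule (Fin (N + 1)) k)

/-- The structure morphism `ℙᴺ → Spec k`. -/
def PSpace.toSpec (k : Type u) [Field k] (N : ℕ) : PSpace k N ⟶ Spec (.of k) :=
  Proj.toSpecZero (MvPolynomial.homogeneousSubmodule (Fin (N + 1)) k) ≫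
    Spec.map (CommRingCat.ofHom
      (algebraMap k (MvPolynomial.homogeneousSubmodule (Fin (N + 1)) k 0)))

/-- The ideal sheaf of the reduced closed subscheme `{ℓ = 0}` of `ℙᴺ`. When `ℓ` is a nonzero linear
form this is the hyperplane `ℓ = 0` (a line, if `N = 2`), since then `k[x₀, …, x_N]/(ℓ)` is a
domain. -/
def PSpace.hyperplane {k : Type u} [Field k] {N : ℕ} (l : MvPolynomial (Fin (N + 1)) k) :
    (PSpace k N).IdealSheafData :=
  Scheme.IdealSheafData.vanishingIdeal
    ⟨ProjectiveSpectrum.zeroLocus (MvPolynomial.homogeneousSubmodule (Fin (N + 1)) k) {l},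
      ProjectiveSpectrum.isClosed_zeroLocus _ _⟩

/-- A `k`-scheme is projective if it has a closed immersion over `k` into some `ℙᴺ`. -/
def IsProjectiveOver (k : Type u) [Field k] {X : Scheme.{u}} (s : X ⟶ Spec (.of k)) : Prop :=
  ∃ (N : ℕ) (i : X ⟶ PSpace k N), IsClosedImmersion i ∧ i ≫ PSpace.toSpec k N = s

/-! ### Effective Cartier divisors, given by their ideal sheaves -/

/-- A closed subscheme is an effective Cartier divisor if its ideal sheaf is locally generated by
one nonzerodivisor. -/
def IsEffectiveCartier {X : Scheme.{u}} (D : X.IdealSheafData) : Prop :=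
  ∀ x : X, ∃ (U : X.affineOpens) (f : Γ(X, U)), x ∈ (U : X.Opens) ∧
    f ∈ nonZeroDivisors Γ(X, U) ∧ D.ideal U = Ideal.span {f}

/-- An effective divisor on a `k`-scheme is very ample if it is the (scheme-theoretic) hyperplane
section `X ∩ H` for some closed immersion over `k` of `X` into a projective space. -/
def IsVeryAmpleDivisor (k : Type u) [Field k] {X : Scheme.{u}} (s : X ⟶ Spec (.of k))
    (D : X.IdealSheafData) : Prop :=
  ∃ (N : ℕ) (i : X ⟶ PSpace k N) (l : MvPolynomial (Fin (N + 1)) k),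
    IsClosedImmersion i ∧ i ≫ PSpace.toSpec k N = s ∧ l.IsHomogeneous 1 ∧ l ≠ 0 ∧
      D = (PSpace.hyperplane l).comap i

/-- The cycle of the effective Cartier divisor `D` is `d • C`, where `C` is an integral closed
subscheme of codimension one (given by its ideal sheaf): for every point `z` of codimension one,
the length of `𝒪_{X,z} / 𝒪_X(-D)_z` is `d` if `z` is the generic point of `C` and `0`
otherwise. -/
def HasCycle {X : Scheme.{u}} (D C : X.IdealSheafData) (d : ℕ) : Prop :=
  ∀ (U : X.affineOpens) (z : X) (hz : z ∈ (U : X.Opens)), Order.coheight z = 1 →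
    (closure {z} = (C.support : Set X) →
      Module.length (X.presheaf.stalk z)
        (X.presheaf.stalk z ⧸ (D.ideal U).map (X.presheaf.germ U z hz).hom) = d) ∧
    (closure {z} ≠ (C.support : Set X) →
      Module.length (X.presheaf.stalk z)
        (X.presheaf.stalk z ⧸ (D.ideal U).map (X.presheaf.germ U z hz).hom) = 0)

/-! ### The formal surface germ `T = Spec k[[u, t]]` -/

/-- The ring `R = k[[u, t]]`. -/
abbrev PS2 (k : Type u) [Field k] : Type u := MvPowerSeries (Fin 2) k

/-- The variable `u` of `R = k[[u, t]]`. -/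
def PS2.u (k : Type u) [Field k] : PS2 k := MvPowerSeries.X 0

/-- The variable `t` of `R = k[[u, t]]`. -/
def PS2.t (k : Type u) [Field k] : PS2 k := MvPowerSeries.X 1

/-- The maximal ideal `ℳ = (u, t)` of `R`. -/
def PS2.maxIdeal (k : Type u) [Field k] : Ideal (PS2 k) := Ideal.span {PS2.u k, PS2.t k}

/-- `T = Spec R`. -/
abbrev FormalT (k : Type u) [Field k] : Scheme.{u} := Spec (.of (PS2 k))

/-- The closed immersion `Spec (R / I) → T`. -/
def FormalT.sub {k : Type u} [Field k] (I : Ideal (PS2 k)) :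
    Spec (.of (PS2 k ⧸ I)) ⟶ FormalT k :=
  Spec.map (CommRingCat.ofHom (Ideal.Quotient.mk I))

/-- The ideal sheaf of the closed subscheme `Spec (R / I)` of `T`. -/
def FormalT.idealSheaf {k : Type u} [Field k] (I : Ideal (PS2 k)) : (FormalT k).IdealSheafData :=
  (FormalT.sub I).ker

/-- The restriction of `a ∈ R = Γ(T, 𝒪_T)` to an open subset of `T`. -/
def FormalT.res {k : Type u} [Field k] (V : (FormalT k).Opens) (a : PS2 k) : Γ(FormalT k, V) :=
  ((FormalT k).presheaf.map (homOfLE le_top).op).hom ((Scheme.ΓSpecIso (.of (PS2 k))).inv.hom a)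

/-! ### Sheaves of modules -/

/-- The structure sheaf `𝒪_X` as an `𝒪_X`-module. -/
abbrev OMod (X : Scheme.{u}) : X.Modules := SheafOfModules.unit X.ringCatSheaf

/-- The `𝒪_X`-module `j_* 𝒪_T`. -/
abbrev pushO {T X : Scheme.{u}} (j : T ⟶ X) : X.Modules :=
  (Scheme.Modules.pushforward j).obj (OMod T)

/-- Sections of `𝒪_X` over `U`, seen as sections of the module `𝒪_X`. -/
def OMod.ofSection {X : Scheme.{u}} {U : X.Opens} (a : Γ(X, U)) :
    (OMod X).presheaf.obj (.op U) := a

/-- Sections of `j_* 𝒪_T` over `U` are the elements of `Γ(j⁻¹ U, 𝒪_T)`. -/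
def pushO.toSection {T X : Scheme.{u}} {j : T ⟶ X} {U : X.Opens}
    (m : (pushO j).presheaf.obj (.op U)) : Γ(T, j ⁻¹ᵁ U) := m

/-- Let `ι : F → j_* 𝒪_T` be the inclusion of a subsheaf and `D` an effective Cartier divisor on
`X`. For local equations `f` of `D`, one has `F(nD) = f⁻ⁿ F` inside `f⁻ⁿ j_* 𝒪_T`. This is the set
of all `a ∈ R` such that the element `a t⁻ᴺ` of `R t⁻ᴺ` belongs to `H⁰(X, F(nD))`, i.e. such that
`fⁿ a t⁻ᴺ`, restricted to `j⁻¹ U`, is a section of `F` whenever `f` is an equation of `D` on the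
affine open set `U`. -/
def twistedSections {k : Type u} [Field k] {X : Scheme.{u}} {j : FormalT k ⟶ X} {F : X.Modules}
    (i : F ⟶ pushO j) (D : X.IdealSheafData) (n N : ℕ) : Set (PS2 k) :=
  {a | ∀ (U : X.affineOpens) (f : Γ(X, U)), D.ideal U = Ideal.span {f} →
    ∃ m : F.presheaf.obj (.op (U : X.Opens)),
      FormalT.res (j ⁻¹ᵁ (U : X.Opens)) (PS2.t k) ^ N *
          pushO.toSection ((Scheme.Modules.Hom.app i (U : X.Opens)).hom m) =
        (j.app (U : X.Opens)).hom f ^ n * FormalT.res (j ⁻¹ᵁ (U : X.Opens)) a}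

/-! ### Geometric data -/

/-- The curve `C = j_* T₁ ⊆ X`: the ideal sheaf `ker (𝒪_X → j_* 𝒪_T → j_* 𝒪_{T₁})`, where
`T₁ = Spec R / (t)`. -/
def curveIdeal {k : Type u} [Field k] {X : Scheme.{u}} (j : FormalT k ⟶ X) : X.IdealSheafData :=
  (FormalT.sub (Ideal.span {PS2.t k}) ≫ j).ker

/-- The point `P = j(O)`, where `O` is the closed point of `T`. -/
def basePoint {k : Type u} [Field k] {X : Scheme.{u}} (j : FormalT k ⟶ X) : X :=
  j (IsLocalRing.closedPoint (PS2 k))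

/-- A geometric datum `(X, j, F)` over `k`, together with its rank. -/
structure GeometricDatum (k : Type u) [Field k] where
  /-- the surface -/
  X : Scheme.{u}
  /-- its structure morphism -/
  str : X ⟶ Spec (.of k)
  /-- the morphism `j : T → X` -/
  j : FormalT k ⟶ X
  /-- the sheaf `F` -/
  F : X.Modules
  /-- the inclusion `F ⊆ j_* 𝒪_T` -/
  incl : F ⟶ pushO j
  /-- the rank `r` -/
  rank : ℕ
  isIntegral : IsIntegral X
  projective : IsProjectiveOver k str
  dim_eq_two : topologicalKrullDim X = 2
  j_over : j ≫ str = Spec.map (CommRingCat.ofHom (algebraMap k (PS2 k)))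
  j_dominant : IsDominant j
  quasicoherent : F.IsQuasicoherent
  incl_mono : Mono incl
  /-- `C` is a curve -/
  dim_curve : topologicalKrullDim (curveIdeal j).subscheme = 1
  /-- `P` is a regular point of `X` -/
  regular_X : IsRegularLocalRing (X.presheaf.stalk (basePoint j))
  /-- `P` is a regular point of `C` -/
  regular_C : ∀ c : (curveIdeal j).subscheme, (curveIdeal j).subschemeι c = basePoint j →
    IsRegularLocalRing ((curveIdeal j).subscheme.presheaf.stalk c)
  /-- `T₁ ×_X {P} = {O}` as closed subschemes of `T` -/
  fiber_P : (Scheme.IdealSheafData.vanishingIdeal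
      (TopologicalSpace.Closeds.closure {basePoint j})).comap j ⊔
    FormalT.idealSheaf (Ideal.span {PS2.t k}) = FormalT.idealSheaf (PS2.maxIdeal k)
  /-- `T ×_X C = r T₁` as closed subschemes of `T` -/
  fiber_C : (curveIdeal j).comap j = FormalT.idealSheaf (Ideal.span {PS2.t k ^ rank})
  /-- There is a very ample effective Cartier divisor `C'` with cycle `d C` such that for all `n`
  the map `H⁰(X, F(nC')) → R t^{-ndr} / ℳ^{ndr+1} t^{-ndr}` is an isomorphism. -/
  sections_iso : ∃ (C' : X.IdealSheafData) (d : ℕ), 0 < d ∧ IsEffectiveCartier C' ∧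
    IsVeryAmpleDivisor k str C' ∧ HasCycle C' (curveIdeal j) d ∧
    ∀ n : ℕ, Set.BijOn (Ideal.Quotient.mk (PS2.maxIdeal k ^ (n * d * rank + 1)))
      (twistedSections incl C' n (n * d * rank)) Set.univ

namespace GeometricDatum

variable {k : Type u} [Field k]

/-- The curve `C` of the datum (as an ideal sheaf on `X`). -/
def C (G : GeometricDatum k) : G.X.IdealSheafData := curveIdeal G.j

/-- The point `P` of the datum. -/
def P (G : GeometricDatum k) : G.X := basePoint G.j

/-- The element of `R = Γ(T, 𝒪_T) = H⁰(X, j_* 𝒪_T)` given by the image of `1 ∈ H⁰(X, 𝒪_X)` under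
`𝒪_X → F ⊆ j_* 𝒪_T`. -/
def valueAtOne (G : GeometricDatum k) (e : OMod G.X ⟶ G.F) : PS2 k :=
  (Scheme.ΓSpecIso (.of (PS2 k))).hom.hom
    (pushO.toSection ((Scheme.Modules.Hom.app (e ≫ G.incl) ⊤).hom
      (OMod.ofSection (1 : Γ(G.X, ⊤)))))

/-- The canonical embedding `𝒪_X → F`: it sends `1` to the global section of `F` which corresponds
to `1` under the isomorphism `H⁰(X, F) → R / ℳ = k`. -/
def IsCanonicalEmbedding (G : GeometricDatum k) (e : OMod G.X ⟶ G.F) : Prop :=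
  MvPowerSeries.constantCoeff (G.valueAtOne e) = 1

/-- The map `𝒪_{X,P} → F_P` induced by a morphism `𝒪_X → F`. -/
def stalkMap (G : GeometricDatum k) (e : OMod G.X ⟶ G.F) :
    (OMod G.X).presheaf.stalk G.P ⟶ G.F.presheaf.stalk G.P :=
  (TopCat.Presheaf.stalkFunctor Ab G.P).map (Scheme.Modules.Hom.mapPresheaf e)

/-- `X = ℙ²` and `C` is a line: there is an isomorphism `X ≅ ℙ²` over `k` that identifies `C` with
the line defined by some nonzero linear form. -/
def IsPlaneWithLine (G : GeometricDatum k) : Prop :=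
  ∃ (φ : G.X ≅ PSpace k 2) (l : MvPolynomial (Fin 3) k),
    φ.hom ≫ PSpace.toSpec k 2 = G.str ∧ l.IsHomogeneous 1 ∧ l ≠ 0 ∧
      G.C = (PSpace.hyperplane l).comap φ.hom

end GeometricDatum

end

noncomputable section

attribute [local instance] MvPolynomial.gradedAlgebra

section

/-! All sheaves are compared inside the function field `FunT k` of T. A section of O_X or of F over
a nonempty open set is a rational function on T (`OL`, `FL`), and e becomes multiplication by a
power series a with constant term 1 (`valueAtOne`). Existence and uniqueness of e are the case n = 0
of condition 3, and e is injective because a is a unit.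

Rank one (`rank_eq_one`). The maximal ideal of the local ring at P has the form (g, h), where g is a
local equation of C and pulls back to a unit times t^r (`exists_generators`, `exists_toPS2_eq`). If
e_P is an isomorphism, condition 3 for n = 1, after removing unit factors, makes the map from the
local ring to R/M^2 surjective. For r ≥ 2 the image of g lies in M^2, so u and t would both be
multiples of the image of h modulo M^2, although M/M^2 has dimension two.

From the plane to O_X = F (`isIso_of_isPlaneWithLine`). Forms of degree nd, multiplied by a, lie in
H^0(F(nC')). They have the same dimension as the jets of order nd, so by condition 3 they exhaust
H^0(F(nC')). By quasi-coherence each section of F on a chart becomes such a global section after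
multiplication by a power of a coordinate. Hence F = a O_X.

From O_X = F to the plane (`isPlaneWithLine_of_isIso`). Let W_M be the space of all f in R for which
f t^(-M) is a section of some O_X(nC'). These spaces form a filtered algebra in which t has degree
1. An element of W_M is determined by its jet of order M, and condition 3 provides all jets when d
divides M. The main point is to remove this divisibility (`FilteredSections.exists_sub_mem`). The
difference dim W_(M+1) - dim W_M is the dimension of the reduction of W_(M+1) modulo t, hence the
number of orders in u that occur there. Suppose that some order exceeded the degree. Some f₀ in
W_(q+1) has w f₀ in W_q for a unit w, because the equation of C at P pulls back to w t. Together
with powers of the offending element, it would make all later differences too large for the bound by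
the number of jets (`order_le`). So each difference is at most M + 2, and since the dimension is
maximal for d | M it is maximal for every M.

Then x and y in W_1 with 1-jets u and 1 exist, and W_M is the space of forms of degree M in x, y, t
(`FilteredSections.exists_coordinates`). Consequently X and the plane have the same affine charts
inside `FunT k`, which yields the isomorphism (`exists_iso_of_OL_eq`), and the coordinate with value
t cuts out C. -/

instance PS2.isDomain (k : Type u) [Field k] : IsDomain (PS2 k) := NoZeroDivisors.to_isDomain _

/-! ### Powers of the maximal ideal of k[[u,t]], and orders modulo t. -/

namespace PS2

variable {k : Type u} [Field k]

open MvPowerSeries Finsupp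

/-- The monomials divisible by u contribute to g₁ and the pure powers of t to g₂, so each monomial
is used once and each part loses exactly one degree. -/
lemma exists_eq_u_mul_add_t_mul {f : PS2 k} {N : ℕ} (h : ∀ m : Fin 2 →₀ ℕ, m.degree < N + 1 → coeff m f = 0) :
    ∃ g₁ g₂ : PS2 k, f = u k * g₁ + t k * g₂ ∧ (∀ m : Fin 2 →₀ ℕ, m.degree < N → coeff m g₁ = 0) ∧
      ∀ m : Fin 2 →₀ ℕ, m.degree < N → coeff m g₂ = 0 := by
  classical
  let g₁ : PS2 k := fun m => coeff (m + single 0 1) f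
  let g₂ : PS2 k := fun m => if m 0 = 0 then coeff (m + single 1 1) f else 0
  have c₁ (m) : coeff m g₁ = coeff (m + single 0 1) f := rfl
  have c₂ (m) : coeff m g₂ = if m 0 = 0 then coeff (m + single 1 1) f else 0 := rfl
  refine ⟨g₁, g₂, ?_, fun m hm => ?_, fun m hm => ?_⟩
  · ext m
    rw [map_add, u, t, X_def, X_def, coeff_monomial_mul, coeff_monomial_mul, one_mul, one_mul, c₁, c₂]
    by_cases h0 : m 0 = 0
    · have h1 : ¬ (single (0 : Fin 2) 1 ≤ m) := by
        intro h2; have := h2 0; simp [h0] at this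
      rw [if_neg h1, zero_add]
      by_cases h3 : m 1 = 0
      · have h2 : ¬ (single (1 : Fin 2) 1 ≤ m) := by
          intro h2; have := h2 1; simp [h3] at this
        rw [if_neg h2]
        apply h
        have : m = 0 := by ext i; fin_cases i <;> simp [h0, h3]
        simp [this]
      · have h2 : (single (1 : Fin 2) 1 ≤ m) := by
          rw [Finsupp.single_le_iff]; omega
        rw [if_pos h2, if_pos (by simp [h0]), tsub_add_cancel_of_le h2]
    · have h1 : single (0 : Fin 2) 1 ≤ m := by
        rw [Finsupp.single_le_iff]; omega
      rw [if_pos h1, tsub_add_cancel_of_le h1]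
      have : (if single (1 : Fin 2) 1 ≤ m then
        if (m - single (1 : Fin 2) 1 : Fin 2 →₀ ℕ) 0 = 0 then coeff (m - single (1 : Fin 2) 1 + single (1 : Fin 2) 1) f else 0 else 0) = 0 := by
        split_ifs with h2 h3
        · simp at h3; omega
        · rfl
        · rfl
      rw [this, add_zero]
  · rw [c₁]
    apply h
    simp [hm]
  · rw [c₂]
    split_ifs
    · apply h
      simp [hm]
    · rfl

lemma mem_maxIdeal_iff {a : PS2 k} : a ∈ maxIdeal k ↔ constantCoeff a = 0 := by
  constructor
  · intro h
    have h1 : maxIdeal k ≤ RingHom.ker (constantCoeff (σ := Fin 2) (R := k)) := by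
      rw [maxIdeal, Ideal.span_le]
      rintro x (rfl | rfl) <;> simp [u, t]
    exact h1 h
  · intro h
    obtain ⟨g₁, g₂, rfl, -, -⟩ := exists_eq_u_mul_add_t_mul (f := a) (N := 0) (fun m hm => by
      have hm0 : m = 0 := by simpa [Finsupp.degree_eq_zero_iff] using hm
      rw [hm0]; exact h)
    exact Ideal.add_mem _ (Ideal.mul_mem_right _ _ (Ideal.subset_span (by simp)))
        (Ideal.mul_mem_right _ _ (Ideal.subset_span (by simp)))

/-- One direction is superadditivity of the order of power series under multiplication; the other
splits off u and t repeatedly. -/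
lemma mem_maxIdeal_pow_iff {f : PS2 k} {N : ℕ} :
    f ∈ maxIdeal k ^ N ↔ ∀ m : Fin 2 →₀ ℕ, m.degree < N → coeff m f = 0 := by
  constructor
  · intro h m hm
    have key : ∀ N : ℕ, ∀ f ∈ maxIdeal k ^ N, (N : ℕ∞) ≤ f.order := by
      intro N
      induction N with
      | zero => simp
      | succ N ih =>
        intro f hf
        rw [pow_succ] at hf
        refine Submodule.mul_induction_on hf (fun a ha b hb => ?_) (fun a b ha hb => ?_)
        · refine le_trans ?_ le_order_mul
          push_cast
          exact add_le_add (ih a ha) (one_le_order_iff_constCoeff_eq_zero.mpr (mem_maxIdeal_iff.mp hb))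
        · exact (le_min ha hb).trans min_order_le_add
    apply coeff_of_lt_order
    exact lt_of_lt_of_le (by exact_mod_cast hm) (key N f h)
  · induction N generalizing f with
    | zero => simp
    | succ N ih =>
      intro h
      obtain ⟨g₁, g₂, rfl, h1, h2⟩ := exists_eq_u_mul_add_t_mul h
      rw [pow_succ']
      exact Ideal.add_mem _ (Ideal.mul_mem_mul (Ideal.subset_span (by simp)) (ih h1))
        (Ideal.mul_mem_mul (Ideal.subset_span (by simp)) (ih h2))

/-- `f` modulo `t` has order `e` in `u`. -/
def HasOrder (f : PS2 k) (e : ℕ) : Prop :=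
  ∃ a b : PS2 k, f = u k ^ e * a + t k * b ∧ constantCoeff a ≠ 0

lemma HasOrder.mul {f g : PS2 k} {e e' : ℕ} (hf : HasOrder f e) (hg : HasOrder g e') :
    HasOrder (f * g) (e + e') := by
  obtain ⟨a, b, rfl, ha⟩ := hf
  obtain ⟨a', b', rfl, ha'⟩ := hg
  exact ⟨a * a', u k ^ e * a * b' + b * (u k ^ e' * a') + b * (t k * b'), by ring, by simp [ha, ha']⟩

lemma HasOrder.one : HasOrder (1 : PS2 k) 0 := ⟨1, 0, by simp, by simp⟩

lemma HasOrder.pow {f : PS2 k} {e : ℕ} (hf : HasOrder f e) (n : ℕ) : HasOrder (f ^ n) (n * e) := by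
  induction n with
  | zero => simpa using HasOrder.one
  | succ n ih => rw [pow_succ, add_mul, one_mul]; exact ih.mul hf

lemma HasOrder.coeff_eq_zero {f : PS2 k} {e i : ℕ} (hf : HasOrder f e) (hi : i < e) :
    coeff (single 0 i) f = 0 := by
  classical
  obtain ⟨a, b, rfl, ha⟩ := hf
  rw [map_add, u, t, X_pow_eq, X_def, coeff_monomial_mul, coeff_monomial_mul, if_neg, if_neg, add_zero]
  · intro h; have := h 1; simp at this
  · intro h; have := h 0; simp at this; omega

lemma HasOrder.coeff_ne_zero {f : PS2 k} {e : ℕ} (hf : HasOrder f e) :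
    coeff (single 0 e) f ≠ 0 := by
  classical
  obtain ⟨a, b, rfl, ha⟩ := hf
  rw [map_add, u, t, X_pow_eq, X_def, coeff_monomial_mul, coeff_monomial_mul, if_pos le_rfl, if_neg, add_zero]
  · simpa using ha
  · intro h; have := h 1; simp at this

lemma t_dvd_iff {f : PS2 k} : t k ∣ f ↔ ∀ i, coeff (single 0 i) f = 0 := by
  rw [t, X_dvd_iff]
  constructor
  · intro h i; exact h _ (by simp)
  · intro h m hm
    have h1 : m = single 0 (m 0) := by ext i; fin_cases i <;> simp [hm]
    rw [h1]
    exact h _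

lemma hasOrder_of_coeff {f : PS2 k} {e : ℕ} (h0 : ∀ i < e, coeff (single 0 i) f = 0)
    (h1 : coeff (single 0 e) f ≠ 0) : HasOrder f e := by
  classical
  let a : PS2 k := fun m => coeff (m + single 0 e) f
  have ca (m) : coeff m a = coeff (m + single 0 e) f := rfl
  have h2 : t k ∣ f - u k ^ e * a := by
    rw [t_dvd_iff]
    intro i
    rw [map_sub, u, X_pow_eq, coeff_monomial_mul, ca]
    split_ifs with h
    · rw [tsub_add_cancel_of_le h, one_mul, sub_self]
    · rw [sub_zero]
      apply h0
      by_contra h3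
      exact h (by rw [Finsupp.single_le_iff]; simpa using h3)
  obtain ⟨b, hb⟩ := h2
  refine ⟨a, b, by rw [← hb]; ring, ?_⟩
  rw [← coeff_zero_eq_constantCoeff_apply, ca]
  simpa using h1

lemma exists_hasOrder {f : PS2 k} (h : ¬ t k ∣ f) : ∃ e, HasOrder f e := by
  classical
  rw [t_dvd_iff] at h
  push Not at h
  exact ⟨Nat.find h, hasOrder_of_coeff (fun i hi => by simpa using Nat.find_min h hi) (Nat.find_spec h)⟩

lemma t_ne_zero : t k ≠ 0 := by
  classical
  intro h
  have := congrArg (coeff (single 1 1)) h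
  rw [t, coeff_index_single_self_X] at this
  simp at this

end PS2

end

/-! ### Jets, ternary forms and their dimensions. -/

section

namespace PS2

variable {k : Type u} [Field k]

open MvPowerSeries Finsupp

/-- Exponents of the monomials of degree at most `N` in two variables. -/
def Idx (N : ℕ) : Type := {m : Fin 2 →₀ ℕ // m.degree ≤ N}

instance (N : ℕ) : Finite (Idx N) := (Finsupp.finite_of_degree_le N).to_subtype

instance (N : ℕ) : Fintype (Idx N) := Fintype.ofFinite _

/-- The new exponents are (i, N + 1 - i) for 0 ≤ i ≤ N + 1. All dimension counts use this recursion
instead of a closed formula. -/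
lemma card_idx_succ (N : ℕ) : Fintype.card (Idx (N + 1)) = Fintype.card (Idx N) + (N + 2) := by
  rw [← Fintype.card_fin (N + 2), ← Fintype.card_sum]
  symm
  apply Fintype.card_of_bijective (f := Sum.elim (fun m => ⟨m.1, m.2.trans (Nat.le_succ _)⟩)
    (fun i : Fin (N + 2) => ⟨single 0 i.1 + single 1 (N + 1 - i.1), by
      have := i.2
      simp [-Finsupp.single_tsub]; omega⟩))
  constructor
  · rintro (⟨m, hm⟩ | i) (⟨m', hm'⟩ | i') h
    · have h1 : m = m' := congrArg (fun x : Idx (N+1) => x.1) h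
      subst h1
      rfl
    · have h1 := i'.2
      have : m.degree = (single 0 i'.1 + single 1 (N + 1 - i'.1) : Fin 2 →₀ ℕ).degree :=
        congrArg (fun x : Idx (N+1) => x.1.degree) h
      simp [-Finsupp.single_tsub] at this
      omega
    · have h1 := i.2
      have : (single 0 i.1 + single 1 (N + 1 - i.1) : Fin 2 →₀ ℕ).degree = m'.degree :=
        congrArg (fun x : Idx (N+1) => x.1.degree) h
      simp [-Finsupp.single_tsub] at this
      omega
    · have : (single 0 i.1 + single 1 (N + 1 - i.1) : Fin 2 →₀ ℕ) 0 =
          (single 0 i'.1 + single 1 (N + 1 - i'.1) : Fin 2 →₀ ℕ) 0 :=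
        congrArg (fun x : Idx (N+1) => x.1 0) h
      simp [-Finsupp.single_tsub] at this
      simp [Fin.ext_iff, this]
  · rintro ⟨m, hm⟩
    by_cases h : m.degree ≤ N
    · exact ⟨Sum.inl ⟨m, h⟩, rfl⟩
    · have h1 : m 0 + m 1 = m.degree := by simp [Finsupp.degree_eq_sum]
      refine ⟨Sum.inr ⟨m 0, by omega⟩, Subtype.ext ?_⟩
      change single 0 (m 0) + single 1 (N + 1 - m 0) = m
      ext i
      fin_cases i
      · simp [-Finsupp.single_tsub]
      · simp [-Finsupp.single_tsub]; omega

/-- The coefficients of degree at most `N`. -/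
def jet (N : ℕ) : PS2 k →ₗ[k] (Idx N → k) := LinearMap.pi fun m => coeff m.1

lemma jet_eq_zero_iff {N : ℕ} {f : PS2 k} : jet N f = 0 ↔ f ∈ maxIdeal k ^ (N + 1) := by
  rw [mem_maxIdeal_pow_iff, funext_iff]
  exact ⟨fun h m hm => h ⟨m, Nat.lt_succ_iff.mp hm⟩, fun h m => h m.1 (Nat.lt_succ_iff.mpr m.2)⟩

lemma jet_surjective (N : ℕ) : Function.Surjective (jet (k := k) N) := by
  classical
  intro c
  refine ⟨fun m => if h : m.degree ≤ N then c ⟨m, h⟩ else 0, ?_⟩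
  ext m
  exact dif_pos m.2

/-- Forms of degree `N` in three variables. -/
abbrev Forms (k : Type u) [Field k] (N : ℕ) : Submodule k (MvPolynomial (Fin 3) k) :=
  MvPolynomial.homogeneousSubmodule (Fin 3) k N

/-- Dehomogenization: the exponent of the third variable is recovered from the total degree. -/
lemma finrank_forms_aux (N : ℕ) : Nonempty ({m : Fin 3 →₀ ℕ // m.degree = N} ≃ Idx N) := by
  refine ⟨Equiv.ofBijective (fun m => ⟨single 0 (m.1 0) + single 1 (m.1 1), ?_⟩) ⟨?_, ?_⟩⟩
  · have := m.2
    simp [Finsupp.degree_eq_sum, Fin.sum_univ_three] at this ⊢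
    omega
  · rintro ⟨m, hm⟩ ⟨m', hm'⟩ h
    have h0 := congrArg (fun x : Idx N => x.1 0) h
    have h1 := congrArg (fun x : Idx N => x.1 1) h
    simp at h0 h1
    simp [Finsupp.degree_eq_sum, Fin.sum_univ_three] at hm hm'
    apply Subtype.ext
    ext i
    fin_cases i <;> simp <;> omega
  · rintro ⟨m, hm⟩
    have hm' : m 0 + m 1 ≤ N := by simpa [Finsupp.degree_eq_sum] using hm
    refine ⟨⟨single 0 (m 0) + single 1 (m 1) + single 2 (N - (m 0 + m 1)), by
      simp [-Finsupp.single_tsub]; omega⟩, Subtype.ext ?_⟩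
    ext i
    fin_cases i <;> simp [-Finsupp.single_tsub]

instance forms_finite (N : ℕ) : Module.Finite k (Forms k N) := by
  rw [Forms, MvPolynomial.homogeneousSubmodule_eq_finsupp_supported]
  obtain ⟨e⟩ := finrank_forms_aux N
  have : Finite ↑{m : Fin 3 →₀ ℕ | m.degree = N} := Finite.of_equiv _ e.symm
  exact Module.Finite.equiv (AddMonoidAlgebra.supportedEquivFinsupp {m : Fin 3 →₀ ℕ | m.degree = N}).symm

lemma finrank_forms (N : ℕ) : Module.finrank k (Forms k N) = Fintype.card (Idx N) := by
  rw [Forms, MvPolynomial.homogeneousSubmodule_eq_finsupp_supported]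
  obtain ⟨e⟩ := finrank_forms_aux N
  have : Finite {m : Fin 3 →₀ ℕ // m.degree = N} := Finite.of_equiv _ e.symm
  have : Fintype {m : Fin 3 →₀ ℕ // m.degree = N} := Fintype.ofFinite _
  rw [(AddMonoidAlgebra.supportedEquivFinsupp {m : Fin 3 →₀ ℕ | m.degree = N}).finrank_eq]
  refine (Module.finrank_finsupp_self (R := k) (ι := {m : Fin 3 →₀ ℕ // m.degree = N})).trans ?_
  exact Fintype.card_congr e

end PS2

end

/-! ### Filtered algebras in k[[u,t]]: growth of dimensions and surjectivity onto jets. -/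

section

namespace PS2

variable {k : Type u} [Field k]

open MvPowerSeries Finsupp

/-- A graded algebra of subspaces `W N ⊆ R`, to be thought of as the space of `t ^ N * b` where `b`
runs through the elements of a filtered algebra `B ⊆ R[1/t]` with pole of order at most `N`. -/
structure FilteredSections (W : ℕ → Submodule k (PS2 k)) : Prop where
  one_mem : 1 ∈ W 0
  mul_mem : ∀ {N M : ℕ} {f g : PS2 k}, f ∈ W N → g ∈ W M → f * g ∈ W (N + M)
  t_mem : t k ∈ W 1
  of_t_mul_mem : ∀ {N : ℕ} {f : PS2 k}, t k * f ∈ W (N + 1) → f ∈ W N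
  eq_zero : ∀ {N : ℕ} {f : PS2 k}, f ∈ W N → f ∈ maxIdeal k ^ (N + 1) → f = 0

namespace FilteredSections

variable {W : ℕ → Submodule k (PS2 k)} (hW : FilteredSections W)

include hW

lemma pow_mem {N : ℕ} {f : PS2 k} (hf : f ∈ W N) (n : ℕ) : f ^ n ∈ W (n * N) := by
  induction n with
  | zero => simpa using hW.one_mem
  | succ n ih => rw [pow_succ, add_mul, one_mul]; exact hW.mul_mem ih hf

lemma jet_injective (N : ℕ) : Function.Injective ((jet N).domRestrict (W N)) := by
  rw [← LinearMap.ker_eq_bot, LinearMap.ker_eq_bot']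
  rintro ⟨f, hf⟩ h
  exact Subtype.ext (hW.eq_zero hf (jet_eq_zero_iff.mp h))

lemma finite (N : ℕ) : Module.Finite k (W N) := Module.Finite.of_injective _ (hW.jet_injective N)

lemma finrank_le (N : ℕ) : Module.finrank k (W N) ≤ Fintype.card (Idx N) := by
  rw [← Module.finrank_fintype_fun_eq_card k]
  exact LinearMap.finrank_le_finrank_of_injective (hW.jet_injective N)

omit hW in
/-- The coefficients of `f` modulo `t`. -/
def coeffs (k : Type u) [Field k] : PS2 k →ₗ[k] (ℕ → k) := LinearMap.pi fun i => coeff (single 0 i)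

/-- This is rank-nullity for reduction modulo t, whose kernel on `W (N + 1)` is t times `W N` by
`t_mem` and `of_t_mul_mem`. -/
lemma finrank_succ (N : ℕ) : Module.finrank k (W (N + 1)) =
    Module.finrank k (W N) + Module.finrank k (LinearMap.range ((coeffs k).domRestrict (W (N + 1)))) := by
  have := hW.finite (N + 1)
  have ht : ∀ f ∈ W N, LinearMap.mulLeft k (t k) f ∈ W (N + 1) := fun f hf => by
    rw [add_comm]; exact hW.mul_mem hW.t_mem hf
  let τ : W N →ₗ[k] W (N + 1) := (LinearMap.mulLeft k (t k)).restrict ht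
  have hτ : Function.Injective τ := by
    intro f g h
    have h1 : t k * f.1 = t k * g.1 := congrArg Subtype.val h
    exact Subtype.ext (mul_left_cancel₀ t_ne_zero h1)
  have hr : LinearMap.range τ = LinearMap.ker ((coeffs k).domRestrict (W (N + 1))) := by
    ext ⟨f, hf⟩
    rw [LinearMap.mem_range, LinearMap.mem_ker]
    have h2 : (coeffs k).domRestrict (W (N + 1)) ⟨f, hf⟩ = 0 ↔ t k ∣ f := by
      rw [t_dvd_iff, funext_iff]; rfl
    rw [h2]
    constructor
    · rintro ⟨g, hg⟩
      exact ⟨g.1, (congrArg Subtype.val hg).symm⟩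
    · rintro ⟨g, rfl⟩
      exact ⟨⟨g, hW.of_t_mul_mem hf⟩, rfl⟩
  rw [← LinearMap.finrank_range_add_finrank_ker ((coeffs k).domRestrict (W (N + 1))), ← hr,
    LinearMap.finrank_range_of_inj hτ, add_comm]

/-- Series with distinct orders have a triangular coefficient matrix with nonzero diagonal, hence
are independent modulo t. -/
lemma le_finrank_range {N e m : ℕ} (h : ∀ s < m, ∃ f ∈ W N, HasOrder f (e + s)) :
    m ≤ Module.finrank k (LinearMap.range ((coeffs k).domRestrict (W N))) := by
  have := hW.finite N
  choose! f hf hfo using h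
  let v : Fin m → LinearMap.range ((coeffs k).domRestrict (W N)) := fun s =>
    ⟨_, LinearMap.mem_range_self _ ⟨f s, hf s s.2⟩⟩
  have hv (s : Fin m) (i : ℕ) : (v s).1 i = coeff (single 0 i) (f s) := rfl
  have hli : LinearIndependent k v := by
    rw [Fintype.linearIndependent_iff]
    intro g hg
    have key : ∀ n : ℕ, ∀ s : Fin m, s.1 = n → g s = 0 := by
      intro n
      induction n using Nat.strong_induction_on with
      | _ n ih =>
        intro s hs
        have h1 : (∑ i, g i • v i).1 (e + n) = 0 := by rw [hg]; rfl
        rw [Submodule.coe_sum, Finset.sum_apply, Finset.sum_eq_single s] at h1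
        · have h2 : g s * (v s).1 (e + n) = 0 := h1
          rw [hv] at h2
          have h3 := (hfo s s.2).coeff_ne_zero
          rw [hs] at h3
          exact (mul_eq_zero.mp h2).resolve_right (by rw [hs]; exact h3)
        · intro i _ hi
          change g i * (v i).1 (e + n) = 0
          rcases lt_or_gt_of_ne (fun h => hi (Fin.ext h) : i.1 ≠ s.1) with h | h
          · rw [ih i.1 (hs ▸ h) i rfl, zero_mul]
          · rw [hv, (hfo i i.2).coeff_eq_zero (by omega), mul_zero]
        · simp
    exact fun s => key s.1 s rfl
  simpa using hli.fintype_card_le_finrank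

omit hW in
-- A reduction modulo t whose coefficients of index 0 to N all vanish must be zero, since otherwise
-- its order would exceed N.
lemma finrank_range_le {N : ℕ} (h : ∀ f ∈ W N, ∀ e, HasOrder f e → e ≤ N) :
    Module.finrank k (LinearMap.range ((coeffs k).domRestrict (W N))) ≤ N + 1 := by
  let r : (ℕ → k) →ₗ[k] (Fin (N + 1) → k) := LinearMap.funLeft k k Fin.val
  have hr : Function.Injective (r.domRestrict (LinearMap.range ((coeffs k).domRestrict (W N)))) := by
    rw [← LinearMap.ker_eq_bot, LinearMap.ker_eq_bot']
    rintro ⟨_, ⟨f, hf⟩, rfl⟩ h0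
    apply Subtype.ext
    have h1 : ∀ i : Fin (N + 1), coeff (single 0 i.1) f = 0 := fun i => congrFun h0 i
    have h2 : t k ∣ f := by
      by_contra h3
      obtain ⟨e, he⟩ := exists_hasOrder h3
      exact he.coeff_ne_zero (h1 ⟨e, Nat.lt_succ_iff.mpr (h f hf e he)⟩)
    rw [t_dvd_iff] at h2
    funext i
    exact h2 i
  simpa using LinearMap.finrank_le_finrank_of_injective hr

omit hW in
lemma hasOrder_of_sub_mem {f : PS2 k} {N i : ℕ} (hi : i ≤ N)
    (h : f - u k ^ i ∈ maxIdeal k ^ (N + 1)) : HasOrder f i := by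
  classical
  rw [mem_maxIdeal_pow_iff] at h
  have h1 (j : ℕ) (hj : j ≤ N) : coeff (single 0 j) f = if j = i then 1 else 0 := by
    have h2 := h (single 0 j) (by simpa using Nat.lt_succ_iff.mpr hj)
    rw [map_sub, sub_eq_zero] at h2
    rw [h2, u, coeff_X_pow]
    by_cases hji : j = i
    · rw [hji, if_pos rfl, if_pos rfl]
    · rw [if_neg hji, if_neg]
      intro h3
      exact hji (by simpa using congrArg (· 0) h3)
  refine hasOrder_of_coeff (fun j hj => ?_) ?_
  · rw [h1 j (by omega), if_neg (by omega)]
  · rw [h1 i hi, if_pos rfl]; exact one_ne_zero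

/-- If `W N` contains an element of order more than `N` modulo `t`, then for large `M` the orders
modulo `t` of the elements of `W M` fill more than `M + 1` values. -/
lemma exists_orders {d N e c : ℕ}
    (hsurj : ∀ n (a : PS2 k), ∃ f ∈ W (n * d), f - a ∈ maxIdeal k ^ (n * d + 1))
    (hdN : d ∣ N) {f : PS2 k} (hf : f ∈ W N) (hfe : HasOrder f e) (heN : N < e) (n : ℕ)
    (hn : c * e ≤ n) (hN : 0 < N) (i : ℕ) (hi : i ≤ n * N + c) : ∃ g ∈ W (n * N), HasOrder g i := by
  obtain ⟨q, rfl⟩ := hdN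
  have hs (n i : ℕ) (hi : i ≤ n * (d * q)) : ∃ g ∈ W (n * (d * q)), HasOrder g i := by
    have : n * (d * q) = (n * q) * d := by ring
    rw [this] at hi ⊢
    obtain ⟨g, hg, hgi⟩ := hsurj (n * q) (u k ^ i)
    exact ⟨g, hg, hasOrder_of_sub_mem hi hgi⟩
  by_cases h : i ≤ n * (d * q)
  · exact hs n i h
  · set M := d * q
    obtain ⟨s, rfl⟩ : ∃ s, i = n * M + s := ⟨i - n * M, by omega⟩
    have hsc : s ≤ c := by omega
    have h1 : s * e ≤ n := (Nat.mul_le_mul_right e hsc).trans hn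
    have h2 : s ≤ s * e := Nat.le_mul_of_pos_right s (by omega)
    have h3 : n ≤ n * M := Nat.le_mul_of_pos_right n hN
    have h4 : s * (M + 1) ≤ s * e := Nat.mul_le_mul_left s heN
    obtain ⟨n', rfl⟩ : ∃ n', n = n' + s := ⟨n - s, by omega⟩
    have h5 : s * (M + 1) = s * M + s := by ring
    have h6 : (n' + s) * M = n' * M + s * M := by ring
    -- Each factor f contributes degree M and order e ≥ M + 1, so s such factors gain at least s
    -- orders over the degree. The bound c e ≤ n keeps the order left for g nonnegative.
    obtain ⟨g, hg, hgo⟩ := hs n' ((n' + s) * M + s - s * e) (by omega)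
    refine ⟨g * f ^ s, ?_, ?_⟩
    · rw [h6]; exact hW.mul_mem hg (hW.pow_mem hf s)
    · have := hgo.mul (hfe.pow s)
      rwa [Nat.sub_add_cancel (by omega)] at this

omit hW in
lemma HasOrder.unit_mul {f w : PS2 k} {e : ℕ} (hf : HasOrder f e) (hw : IsUnit w) : HasOrder (w * f) e := by
  obtain ⟨a, b, rfl, ha⟩ := hf
  refine ⟨w * a, w * b, by ring, ?_⟩
  rw [map_mul]
  exact mul_ne_zero (hw.map _).ne_zero ha

/-- A common factor t can be cancelled from both memberships, lowering q by one. The descent stops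
at q = 0 at the latest, since a multiple of t in `W 0` is zero. -/
lemma exists_not_dvd {q : ℕ} {f w : PS2 k} (hw : IsUnit w) (hf0 : f ≠ 0) (hf : f ∈ W (q + 1)) (hwf : w * f ∈ W q) :
    ∃ (q : ℕ) (f : PS2 k), ¬ t k ∣ f ∧ f ∈ W (q + 1) ∧ w * f ∈ W q := by
  induction q generalizing f with
  | zero =>
    refine ⟨0, f, ?_, hf, hwf⟩
    rintro ⟨g, rfl⟩
    have h1 : w * (t k * g) = 0 := by
      apply hW.eq_zero hwf
      rw [zero_add, pow_one, mem_maxIdeal_iff]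
      simp [t]
    exact (mul_ne_zero hw.ne_zero hf0) h1
  | succ q ih =>
    by_cases h : t k ∣ f
    · obtain ⟨g, rfl⟩ := h
      refine ih (f := g) ?_ (hW.of_t_mul_mem hf) (hW.of_t_mul_mem ?_)
      · rintro rfl; simp at hf0
      · rw [mul_left_comm] at hwf; exact hwf
    · exact ⟨_, f, h, hf, hwf⟩

/-- An element whose order exceeds its degree makes the number of orders in `W (m + 1)` at least m +
3 for all large m, whereas the number of jets grows only by m + 2 at each step. The pair f₀, w f₀
transports the excess from multiples of one degree to all large degrees. -/
lemma order_le {d : ℕ} (hd : 0 < d)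
    (hsurj : ∀ n (a : PS2 k), ∃ f ∈ W (n * d), f - a ∈ maxIdeal k ^ (n * d + 1))
    {q : ℕ} {f₀ w : PS2 k} (hw : IsUnit w) (hf0 : f₀ ≠ 0) (hf : f₀ ∈ W (q + 1)) (hwf : w * f₀ ∈ W q)
    {N : ℕ} {f : PS2 k} (hfN : f ∈ W (N + 1)) {e : ℕ} (hfe : HasOrder f e) : e ≤ N + 1 := by
  by_contra! hlt
  obtain ⟨q, f₀, hdvd, hf₀, hwf₀⟩ := hW.exists_not_dvd hw hf0 hf hwf
  obtain ⟨e₀, he₀⟩ := exists_hasOrder hdvd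
  have hwe₀ := HasOrder.unit_mul he₀ hw
  -- The degree is made a multiple of d, so that jets in degrees nM are available from `hsurj`.
  set M := d * (N + 1)
  have hM : 0 < M := by positivity
  have hfM : f ^ d ∈ W M := hW.pow_mem hfN d
  have hfMe : HasOrder (f ^ d) (d * e) := hfe.pow d
  have hlt' : M < d * e := Nat.mul_lt_mul_of_pos_left hlt hd
  -- Degree m + 1 will be reached as nM + (qM + i) with i < M, and the orders 0, …, m + 2 are wanted
  -- in degree nM; this c covers the excess.
  set c := q * M + M + 1
  set n₀ := c * (d * e)
  have hgrow (m : ℕ) (hm : q * M + n₀ * M ≤ m) :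
      Module.finrank k (W m) + (m + 3) ≤ Module.finrank k (W (m + 1)) := by
    rw [hW.finrank_succ m]
    apply Nat.add_le_add_left
    apply hW.le_finrank_range (e := M * e₀)
    intro s hs
    set i := (m + 1 - q * M) % M
    set n := (m + 1 - q * M) / M
    have hi : i < M := Nat.mod_lt _ hM
    have hm1 : m + 1 = (q * M + i) + n * M := by
      have := Nat.mod_add_div' (m + 1 - q * M) M
      change i + n * M = _ at this
      omega
    have hn : n₀ ≤ n := (Nat.le_div_iff_mul_le hM).mpr (by omega)
    obtain ⟨g, hg, hgo⟩ := hW.exists_orders hsurj (dvd_mul_right d (N + 1)) hfM hfMe hlt' n hn hM s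
      (by change s ≤ n * M + c; omega)
    -- The product of f₀'s and w f₀'s has degree qM + i, which hits every residue class modulo M,
    -- while its order is M e₀ for every i. It shifts all orders of g by the same amount.
    refine ⟨(f₀ ^ i * (w * f₀) ^ (M - i)) * g, ?_, ?_⟩
    · have h1 := hW.mul_mem (hW.mul_mem (hW.pow_mem hf₀ i) (hW.pow_mem hwf₀ (M - i))) hg
      have h2 : i * (q + 1) + (M - i) * q + n * M = m + 1 := by
        obtain ⟨l, hl⟩ : ∃ l, M = i + l := ⟨M - i, by omega⟩
        have h3 : M - i = l := by omega
        rw [hm1, h3]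
        have : q * M = q * (i + l) := by rw [← hl]
        rw [this]; ring
      rwa [h2] at h1
    · have h1 := ((he₀.pow i).mul (hwe₀.pow (M - i))).mul hgo
      rwa [← add_mul, Nat.add_sub_cancel' hi.le] at h1
  have hlow (s : ℕ) : Fintype.card (Idx (q * M + n₀ * M + s)) + s ≤
      Module.finrank k (W (q * M + n₀ * M + s)) + Fintype.card (Idx (q * M + n₀ * M)) := by
    induction s with
    | zero => simp
    | succ s ih =>
      have h1 := hgrow (q * M + n₀ * M + s) (by omega)
      have h2 := card_idx_succ (q * M + n₀ * M + s)
      have h3 : q * M + n₀ * M + (s + 1) = q * M + n₀ * M + s + 1 := rfl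
      rw [h3]
      omega
  -- Each step adds a surplus of one, so one step more than the number of jets at the start exceeds
  -- the upper bound `finrank_le`.
  have h1 := hlow (Fintype.card (Idx (q * M + n₀ * M)) + 1)
  have h2 := hW.finrank_le (q * M + n₀ * M + (Fintype.card (Idx (q * M + n₀ * M)) + 1))
  omega

/-- The jets of order `N` of the elements of `W N` are arbitrary. -/
theorem exists_sub_mem {d : ℕ} (hd : 0 < d)
    (hsurj : ∀ n (a : PS2 k), ∃ f ∈ W (n * d), f - a ∈ maxIdeal k ^ (n * d + 1))
    {q : ℕ} {f₀ w : PS2 k} (hw : IsUnit w) (hf0 : f₀ ≠ 0) (hf : f₀ ∈ W (q + 1)) (hwf : w * f₀ ∈ W q)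
    (N : ℕ) (a : PS2 k) : ∃ f ∈ W N, f - a ∈ maxIdeal k ^ (N + 1) := by
  -- Orders at most m + 1 leave at most m + 2 values for the growth, which is the growth of the
  -- number of jets. Hence a deficit at N would persist up to N d, where the dimension is full.
  have hle (m : ℕ) : Module.finrank k (W (m + 1)) ≤ Module.finrank k (W m) + (m + 2) := by
    rw [hW.finrank_succ m]
    exact Nat.add_le_add_left (finrank_range_le fun f hfm e he =>
      hW.order_le hd hsurj hw hf0 hf hwf hfm he) _
  have hs (s : ℕ) : Module.finrank k (W (N + s)) + Fintype.card (Idx N) ≤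
      Module.finrank k (W N) + Fintype.card (Idx (N + s)) := by
    induction s with
    | zero => simp
    | succ s ih =>
      have h1 := hle (N + s)
      have h2 := card_idx_succ (N + s)
      rw [← add_assoc]
      omega
  have htop : Fintype.card (Idx (N * d)) ≤ Module.finrank k (W (N * d)) := by
    have := hW.finite (N * d)
    rw [← Module.finrank_fintype_fun_eq_card k]
    apply LinearMap.finrank_le_finrank_of_surjective (f := (jet (N * d)).domRestrict (W (N * d)))
    intro c
    obtain ⟨b, rfl⟩ := jet_surjective _ c
    obtain ⟨f, hfm, hfb⟩ := hsurj N b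
    refine ⟨⟨f, hfm⟩, ?_⟩
    rw [← sub_eq_zero]
    exact (map_sub (jet (N * d)) f b).symm.trans (jet_eq_zero_iff.mpr hfb)
  have hN : N ≤ N * d := Nat.le_mul_of_pos_right N hd
  have h1 := hs (N * d - N)
  rw [Nat.add_sub_cancel' hN] at h1
  have h2 : Module.finrank k (W N) = Module.finrank k (Idx N → k) := by
    rw [Module.finrank_fintype_fun_eq_card]
    have := hW.finrank_le N
    omega
  have := hW.finite N
  obtain ⟨⟨f, hfm⟩, hfa⟩ := (LinearMap.injective_iff_surjective_of_finrank_eq_finrank h2).mp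
    (hW.jet_injective N) (jet N a)
  refine ⟨f, hfm, ?_⟩
  rw [← jet_eq_zero_iff, map_sub, sub_eq_zero]
  exact hfa

end FilteredSections

end PS2

end

/-! ### The filtered algebra as a polynomial ring filtered by degree. -/

section

namespace PS2

variable {k : Type u} [Field k]

/-- Evaluation of polynomials in three variables at `(x, y, t)`. -/
def evalAt (x y : PS2 k) : MvPolynomial (Fin 3) k →ₐ[k] PS2 k := MvPolynomial.aeval ![x, y, t k]

/-- Leading terms are matched by forms in the first and third variables: x and u agree to second
order, so replacing u by x changes an element of order i + 1 only in higher order. The second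
coordinate plays no role. -/
lemma exists_form_sub_mem {x y : PS2 k} (hx : x - u k ∈ maxIdeal k ^ 2) (i : ℕ) {r : PS2 k}
    (hr : r ∈ maxIdeal k ^ i) : ∃ Q ∈ Forms k i, evalAt x y Q - r ∈ maxIdeal k ^ (i + 1) := by
  induction i generalizing r with
  | zero =>
    refine ⟨MvPolynomial.C (MvPowerSeries.constantCoeff r), MvPolynomial.isHomogeneous_C _ _, ?_⟩
    rw [zero_add, pow_one, mem_maxIdeal_iff, map_sub, evalAt, MvPolynomial.aeval_C]
    rw [sub_eq_zero]
    exact MvPowerSeries.constantCoeff_C _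
  | succ i ih =>
    obtain ⟨g₁, g₂, rfl, h1, h2⟩ := exists_eq_u_mul_add_t_mul (mem_maxIdeal_pow_iff.mp hr)
    have h1' := mem_maxIdeal_pow_iff.mpr h1
    obtain ⟨Q₁, hQ₁, e₁⟩ := ih h1'
    obtain ⟨Q₂, hQ₂, e₂⟩ := ih (mem_maxIdeal_pow_iff.mpr h2)
    refine ⟨MvPolynomial.X 0 * Q₁ + MvPolynomial.X 2 * Q₂, ?_, ?_⟩
    · apply Submodule.add_mem
      · rw [add_comm i]; exact (MvPolynomial.isHomogeneous_X _ _).mul hQ₁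
      · rw [add_comm i]; exact (MvPolynomial.isHomogeneous_X _ _).mul hQ₂
    · have h3 : evalAt x y (MvPolynomial.X 0 * Q₁ + MvPolynomial.X 2 * Q₂) =
          x * evalAt x y Q₁ + t k * evalAt x y Q₂ := by
        simp [evalAt]
      have h4 : evalAt x y Q₁ ∈ maxIdeal k ^ i := by
        have := Ideal.add_mem _ (Ideal.pow_le_pow_right (Nat.le_succ i) e₁) h1'
        rwa [sub_add_cancel] at this
      have h5 : x * evalAt x y Q₁ + t k * evalAt x y Q₂ - (u k * g₁ + t k * g₂) =
          (x - u k) * evalAt x y Q₁ + (u k * (evalAt x y Q₁ - g₁) + t k * (evalAt x y Q₂ - g₂)) := by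
        ring
      rw [h3, h5]
      refine Ideal.add_mem _ ?_ (Ideal.add_mem _ ?_ ?_)
      · have := Ideal.mul_mem_mul hx h4
        rwa [← pow_add, add_comm] at this
      · rw [pow_succ']
        exact Ideal.mul_mem_mul (Ideal.subset_span (by simp)) e₁
      · rw [pow_succ']
        exact Ideal.mul_mem_mul (Ideal.subset_span (by simp)) e₂

/-- Successive approximation: the error of order i is removed by a form of degree i, raised to
degree N by a power of the second variable. This does no harm because y is 1 modulo the maximal
ideal. -/
lemma exists_form_sub_mem' {x y : PS2 k} (hx : x - u k ∈ maxIdeal k ^ 2)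
    (hy : y - 1 ∈ maxIdeal k ^ 2) (N : ℕ) (a : PS2 k) (i : ℕ) (hi : i ≤ N + 1) :
    ∃ Q ∈ Forms k N, evalAt x y Q - a ∈ maxIdeal k ^ i := by
  induction i with
  | zero => exact ⟨0, Submodule.zero_mem _, by simp⟩
  | succ i ih =>
    obtain ⟨Q, hQ, hQa⟩ := ih (by omega)
    obtain ⟨Q', hQ', e⟩ := exists_form_sub_mem (y := y) hx i hQa
    refine ⟨Q - MvPolynomial.X 1 ^ (N - i) * Q', ?_, ?_⟩
    · refine Submodule.sub_mem _ hQ ?_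
      have := ((MvPolynomial.isHomogeneous_X k (1 : Fin 3)).pow (N - i)).mul hQ'
      have h2 : 1 * (N - i) + i = N := by omega
      rwa [h2] at this
    · have h3 : evalAt x y (Q - MvPolynomial.X 1 ^ (N - i) * Q') = evalAt x y Q - y ^ (N - i) * evalAt x y Q' := by
        simp [evalAt]
      have h4 : evalAt x y Q' ∈ maxIdeal k ^ i := by
        have := Ideal.add_mem _ (Ideal.pow_le_pow_right (Nat.le_succ i) e) hQa
        rwa [sub_add_cancel] at this
      have h5 : evalAt x y Q - y ^ (N - i) * evalAt x y Q' - a =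
        -((y ^ (N - i) - 1) * evalAt x y Q') - (evalAt x y Q' - (evalAt x y Q - a)) := by ring
      rw [h3, h5]
      refine Ideal.sub_mem _ (neg_mem ?_) e
      rw [pow_succ']
      refine Ideal.mul_mem_mul ?_ h4
      have h6 : y - 1 ∣ y ^ (N - i) - 1 := sub_one_dvd_pow_sub_one ..
      exact Ideal.mem_of_dvd _ h6 (Ideal.pow_le_self two_ne_zero hy)

/-- A form of degree `N` is determined by the jet of order `N` of its value at `(x, y, t)`. -/
lemma forms_bijective {x y : PS2 k} (hx : x - u k ∈ maxIdeal k ^ 2) (hy : y - 1 ∈ maxIdeal k ^ 2)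
    (N : ℕ) : Function.Bijective ((jet N ∘ₗ (evalAt x y).toLinearMap).domRestrict (Forms k N)) := by
  have h1 : Function.Surjective ((jet N ∘ₗ (evalAt x y).toLinearMap).domRestrict (Forms k N)) := by
    intro c
    obtain ⟨a, rfl⟩ := jet_surjective _ c
    obtain ⟨Q, hQ, hQa⟩ := exists_form_sub_mem' hx hy N a (N + 1) le_rfl
    refine ⟨⟨Q, hQ⟩, ?_⟩
    rw [← jet_eq_zero_iff, map_sub, sub_eq_zero] at hQa
    exact hQa
  -- Ternary forms of degree N and jets of order N have equal dimension, so surjectivity suffices.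
  refine ⟨(LinearMap.injective_iff_surjective_of_finrank_eq_finrank ?_).mpr h1, h1⟩
  rw [finrank_forms, Module.finrank_fintype_fun_eq_card]

namespace FilteredSections

variable {W : ℕ → Submodule k (PS2 k)} (hW : FilteredSections W)

include hW

lemma evalAt_mem {x y : PS2 k} (hx : x ∈ W 1) (hy : y ∈ W 1) {N : ℕ} {Q : MvPolynomial (Fin 3) k}
    (hQ : Q ∈ Forms k N) : evalAt x y Q ∈ W N := by
  rw [evalAt, MvPolynomial.aeval_def, MvPolynomial.eval₂_eq']
  refine Submodule.sum_mem _ fun m hm => ?_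
  rw [← Algebra.smul_def]
  refine Submodule.smul_mem _ _ ?_
  have h1 : m.degree = N := by
    have := hQ (MvPolynomial.mem_support_iff.mp hm)
    rw [Finsupp.degree_eq_weight_one]
    exact this
  rw [Finsupp.degree_eq_sum, Fin.sum_univ_three] at h1
  rw [Fin.prod_univ_three, ← h1]
  have h2 {f : PS2 k} (hf : f ∈ W 1) (n : ℕ) : f ^ n ∈ W n := by simpa using hW.pow_mem hf n
  exact hW.mul_mem (hW.mul_mem (h2 hx _) (h2 hy _)) (h2 hW.t_mem _)

/-- The filtered algebra is a polynomial ring in two variables filtered by degree. -/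
theorem exists_coordinates {d : ℕ} (hd : 0 < d)
    (hsurj : ∀ n (a : PS2 k), ∃ f ∈ W (n * d), f - a ∈ maxIdeal k ^ (n * d + 1))
    {q : ℕ} {f₀ w : PS2 k} (hw : IsUnit w) (hf0 : f₀ ≠ 0) (hf : f₀ ∈ W (q + 1)) (hwf : w * f₀ ∈ W q) :
    ∃ x y : PS2 k, x - u k ∈ maxIdeal k ^ 2 ∧ y - 1 ∈ maxIdeal k ^ 2 ∧
      ∀ N f, f ∈ W N ↔ ∃ Q ∈ Forms k N, evalAt x y Q = f := by
  obtain ⟨x, hx, hxu⟩ := hW.exists_sub_mem hd hsurj hw hf0 hf hwf 1 (u k)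
  obtain ⟨y, hy, hyu⟩ := hW.exists_sub_mem hd hsurj hw hf0 hf hwf 1 1
  refine ⟨x, y, hxu, hyu, fun N f => ⟨fun hfN => ?_, ?_⟩⟩
  · obtain ⟨⟨Q, hQ⟩, hQf⟩ := (forms_bijective hxu hyu N).2 (jet N f)
    refine ⟨Q, hQ, ?_⟩
    rw [← sub_eq_zero]
    refine hW.eq_zero (Submodule.sub_mem _ (hW.evalAt_mem hx hy hQ) hfN) ?_
    rw [← jet_eq_zero_iff, map_sub, sub_eq_zero]
    exact hQf
  · rintro ⟨Q, hQ, rfl⟩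
    exact hW.evalAt_mem hx hy hQ

end FilteredSections

lemma evalAt_injective {x y : PS2 k} (hx : x - u k ∈ maxIdeal k ^ 2) (hy : y - 1 ∈ maxIdeal k ^ 2)
    {N : ℕ} {Q : MvPolynomial (Fin 3) k} (hQ : Q ∈ Forms k N) (h : evalAt x y Q = 0) : Q = 0 := by
  have := (forms_bijective hx hy N).1 (a₁ := ⟨Q, hQ⟩) (a₂ := 0) (by
    rw [map_zero]
    change jet N (evalAt x y Q) = 0
    rw [h, map_zero])
  exact congrArg Subtype.val this

end PS2

end

/-! ### Sections of O_X and of F as rational functions on T. -/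

section

instance FormalT.isIntegral (k : Type u) [Field k] : IsIntegral (FormalT k) :=
  inferInstanceAs (IsIntegral (Spec (.of (PS2 k))))

/-- The field of rational functions on `T`. -/
abbrev FunT (k : Type u) [Field k] : Type u := (FormalT k).functionField

variable {k : Type u} [Field k]

instance : Algebra (PS2 k) (FunT k) :=
  instAlgebraCarrierFunctionFieldSpec (.of (PS2 k))

instance : IsFractionRing (PS2 k) (FunT k) :=
  functionField_isFractionRing_of_affine (.of (PS2 k))

/-- The image of the generic point of `T`. -/
def genPt {X : Scheme.{u}} (j : FormalT k ⟶ X) : X := j (genericPoint (FormalT k))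

/-- The dense image of T meets every nonempty open set, and open sets are stable under generization.
-/
lemma genPt_mem {X : Scheme.{u}} [IrreducibleSpace X] (j : FormalT k ⟶ X) [IsDominant j] {U : X.Opens} {x : X}
    (hx : x ∈ U) : genPt j ∈ U := by
  have h1 : Dense (Set.range j) := IsDominant.denseRange
  obtain ⟨y, hy, t, rfl⟩ := h1.inter_open_nonempty U U.2 ⟨x, hx⟩
  exact ((genericPoint_specializes t).map j.continuous).mem_open U.2 hy

/-- Sections of `𝒪_T` as rational functions. -/
def germT {V : (FormalT k).Opens} (h : genericPoint (FormalT k) ∈ V) : Γ(FormalT k, V) →+* FunT k :=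
  ((FormalT k).presheaf.germ V _ h).hom

lemma germT_injective {V : (FormalT k).Opens} (h : genericPoint (FormalT k) ∈ V) :
    Function.Injective (germT h) :=
  germ_injective_of_isIntegral _ _ _

lemma germT_map {V W : (FormalT k).Opens} (h : genericPoint (FormalT k) ∈ V) (i : V ⟶ W)
    (a : Γ(FormalT k, W)) :
    germT h ((FormalT k).presheaf.map i.op a) = germT (i.le h) a :=
  TopCat.Presheaf.germ_res_apply _ i _ h a

lemma germT_res {V : (FormalT k).Opens} (h : genericPoint (FormalT k) ∈ V) (a : PS2 k) :
    germT h (FormalT.res V a) = algebraMap (PS2 k) (FunT k) a := by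
  refine (germT_map h (homOfLE le_top) _).trans ?_
  rfl

section embed

variable {X : Scheme.{u}} (j : FormalT k ⟶ X)

/-- Sections of `𝒪_X`, pulled back to `T`, as rational functions on `T`. -/
def pullL {U : X.Opens} (h : genPt j ∈ U) : Γ(X, U) →+* FunT k :=
  (germT (V := j ⁻¹ᵁ U) h).comp (j.app U).hom

lemma pullL_map {U V : X.Opens} (h : genPt j ∈ U) (i : U ⟶ V) (b : Γ(X, V)) :
    pullL j h (X.presheaf.map i.op b) = pullL j (i.le h) b := by
  have h1 : (j.app U).hom (X.presheaf.map i.op b) =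
      (FormalT k).presheaf.map ((TopologicalSpace.Opens.map j.base).map i).op ((j.app V).hom b) :=
    congr($(j.naturality i.op) b)
  exact (congrArg (germT (V := j ⁻¹ᵁ U) h) h1).trans (germT_map (V := j ⁻¹ᵁ U) h _ _)

variable {j} {F : X.Modules} (ι : F ⟶ pushO j)

/-- Sections of a subsheaf of `j_* 𝒪_T` as rational functions on `T`. -/
def modL {U : X.Opens} (h : genPt j ∈ U) : F.presheaf.obj (.op U) →+ FunT k :=
  ((germT (V := j ⁻¹ᵁ U) h).toAddMonoidHom).comp
    ((Scheme.Modules.Hom.app ι U).hom : F.presheaf.obj (.op U) →+ (pushO j).presheaf.obj (.op U))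

lemma modL_apply {U : X.Opens} (h : genPt j ∈ U) (m : F.presheaf.obj (.op U)) :
   modL ι h m = germT (V := j ⁻¹ᵁ U) h (pushO.toSection ((Scheme.Modules.Hom.app ι U).hom m)) := rfl

lemma modL_map {U V : X.Opens} (h : genPt j ∈ U) (i : U ⟶ V) (m : F.presheaf.obj (.op V)) :
    modL ι h (F.presheaf.map i.op m) = modL ι (i.le h) m := by
  have h1 : (Scheme.Modules.Hom.app ι U).hom (F.presheaf.map i.op m) =
      (FormalT k).presheaf.map ((TopologicalSpace.Opens.map j.base).map i).op
        (pushO.toSection ((Scheme.Modules.Hom.app ι V).hom m)) :=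
    congr($((Scheme.Modules.Hom.mapPresheaf ι).naturality i.op) m)
  exact (congrArg (germT (V := j ⁻¹ᵁ U) h) h1).trans (germT_map (V := j ⁻¹ᵁ U) h _ _)

lemma modL_smul {U : X.Opens} (h : genPt j ∈ U) (b : Γ(X, U)) (m : F.presheaf.obj (.op U)) :
    modL ι h (b • m) = pullL j h b * modL ι h m := by
  have h1 : pushO.toSection ((Scheme.Modules.Hom.app ι U).hom (b • m)) =
      (j.app U).hom b * pushO.toSection ((Scheme.Modules.Hom.app ι U).hom m) :=
    Scheme.Modules.Hom.app_smul ι b m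
  rw [modL_apply, modL_apply, h1, map_mul]
  rfl

lemma modL_injective [Mono ι] {U : X.Opens} (h : genPt j ∈ U) : Function.Injective (modL ι h) := by
  have h1 : Mono ((Scheme.Modules.toPresheaf X).map ι) := inferInstance
  have h2 : Mono (Scheme.Modules.Hom.app ι U) :=
    (NatTrans.mono_iff_mono_app ((Scheme.Modules.toPresheaf X).map ι)).mp h1 (.op U)
  have h3 := (AddCommGrpCat.mono_iff_injective _).mp h2
  exact (germT_injective (V := j ⁻¹ᵁ U) h).comp h3

/-- Sections of `𝒪_X` over `U`, as rational functions on `T`. -/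
def OL (j : FormalT k ⟶ X) {U : X.Opens} (h : genPt j ∈ U) : Subring (FunT k) := (pullL j h).range

/-- Sections of a subsheaf of `j_* 𝒪_T` over `U`, as rational functions on `T`. -/
def FL {U : X.Opens} (h : genPt j ∈ U) : AddSubgroup (FunT k) := (modL ι h).range

lemma mem_OL {U : X.Opens} {h : genPt j ∈ U} {z : FunT k} :
    z ∈ OL j h ↔ ∃ b, pullL j h b = z := Iff.rfl

lemma OL_mono {U V : X.Opens} (h : genPt j ∈ U) (i : U ≤ V) : OL j (i h) ≤ OL j h := by
  rintro _ ⟨b, rfl⟩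
  exact ⟨_, pullL_map j h (homOfLE i) b⟩

lemma FL_mono {U V : X.Opens} (h : genPt j ∈ U) (i : U ≤ V) : FL ι (i h) ≤ FL ι h := by
  rintro _ ⟨b, rfl⟩
  exact ⟨_, modL_map ι h (homOfLE i) b⟩

lemma FL_mul_mem {U : X.Opens} {h : genPt j ∈ U} {b z : FunT k} (hb : b ∈ OL j h)
    (hz : z ∈ FL ι h) : b * z ∈ FL ι h := by
  obtain ⟨b, rfl⟩ := hb
  obtain ⟨m, rfl⟩ := hz
  exact ⟨b • m, modL_smul ι h b m⟩

/-- Local sections with the same rational function agree on overlaps by injectivity of `modL`, so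
the sheaf property glues them. -/
lemma FL_of_local [Mono ι] {U : X.Opens} (h : genPt j ∈ U) {z : FunT k}
    (H : ∀ x ∈ U, ∃ (W : X.Opens) (_ : x ∈ W) (_ : W ≤ U) (hW : genPt j ∈ W), z ∈ FL ι hW) :
    z ∈ FL ι h := by
  choose W hxW hWU hW m hm using fun x : U => H x.1 x.2
  obtain ⟨s, hs, -⟩ := TopCat.Sheaf.existsUnique_gluing' ⟨F.presheaf, F.isSheaf⟩ W U
    (fun x => homOfLE (hWU x)) (fun x hx => TopologicalSpace.Opens.mem_iSup.mpr ⟨⟨x, hx⟩, hxW _⟩) m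
    (fun x y => modL_injective ι (U := W x ⊓ W y) ⟨hW x, hW y⟩
      ((modL_map ι (U := W x ⊓ W y) ⟨hW x, hW y⟩ _ _).trans
        (((hm x).trans (hm y).symm).trans
          (modL_map ι (U := W x ⊓ W y) ⟨hW x, hW y⟩ _ _).symm)))
  refine ⟨s, ?_⟩
  have h1 := congrArg (modL ι (hW ⟨_, h⟩)) (hs ⟨_, h⟩)
  exact ((modL_map ι (hW ⟨_, h⟩) _ s).symm.trans h1).trans (hm _)

/-- The nonvanishing locus of a nonzero section is nonempty, hence contains the image of the generic
point of T, where the section becomes a unit. -/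
lemma pullL_injective [IsIntegral X] [IsDominant j] {U : X.Opens} (h : genPt j ∈ U) :
    Function.Injective (pullL j h) := by
  rw [injective_iff_map_eq_zero]
  intro b hb
  by_contra hb0
  have h1 : X.basicOpen b ≠ ⊥ := fun e => hb0 ((basicOpen_eq_bot_iff b).mp e)
  obtain ⟨x, hx⟩ := (TopologicalSpace.Opens.ne_bot_iff_nonempty _).mp h1
  have h2 : genPt j ∈ X.basicOpen b := genPt_mem j hx
  have h3 : genericPoint (FormalT k) ∈ (FormalT k).basicOpen ((j.app U).hom b) := by
    have := Scheme.preimage_basicOpen j b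
    exact this.le h2
  have h4 : IsUnit (pullL j h b) := ((FormalT k).mem_basicOpen _ _ h).mp h3
  exact h4.ne_zero hb

lemma OL_of_local [IsIntegral X] [IsDominant j] {U : X.Opens} (h : genPt j ∈ U) {z : FunT k}
    (H : ∀ x ∈ U, ∃ (W : X.Opens) (_ : x ∈ W) (_ : W ≤ U) (hW : genPt j ∈ W), z ∈ OL j hW) :
    z ∈ OL j h := by
  choose W hxW hWU hW m hm using fun x : U => H x.1 x.2
  obtain ⟨s, hs, -⟩ := TopCat.Sheaf.existsUnique_gluing' X.sheaf W U
    (fun x => homOfLE (hWU x)) (fun x hx => TopologicalSpace.Opens.mem_iSup.mpr ⟨⟨x, hx⟩, hxW _⟩) m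
    (fun x y => pullL_injective (j := j) (U := W x ⊓ W y) ⟨hW x, hW y⟩
      ((pullL_map j (U := W x ⊓ W y) ⟨hW x, hW y⟩ _ _).trans
        (((hm x).trans (hm y).symm).trans
          (pullL_map j (U := W x ⊓ W y) ⟨hW x, hW y⟩ _ _).symm)))
  refine ⟨s, ?_⟩
  have h1 := congrArg (pullL j (hW ⟨_, h⟩)) (hs ⟨_, h⟩)
  exact ((pullL_map j (hW ⟨_, h⟩) _ s).symm.trans h1).trans (hm _)

/-- The element `t` of the field of rational functions on `T`. -/
def tL (k : Type u) [Field k] : FunT k := algebraMap (PS2 k) (FunT k) (PS2.t k)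

lemma tL_ne_zero : tL k ≠ 0 := by
  simpa [tL] using PS2.t_ne_zero

lemma ideal_eq_span_restrict {X : Scheme.{u}} (D : X.IdealSheafData) {U W : X.affineOpens}
    (hWU : W.1 ≤ U.1) {f : Γ(X, U)} (hD : D.ideal U = Ideal.span {f}) :
    D.ideal W = Ideal.span {X.presheaf.map (homOfLE hWU).op f} := by
  have e1 := D.map_ideal (U := W) (V := U) hWU
  rw [hD, Ideal.map_span, Set.image_singleton] at e1
  exact e1.symm

lemma exists_pullL_eq_mul (D : X.IdealSheafData) {U V W : X.affineOpens}
    (hWU : W.1 ≤ U.1) (hWV : W.1 ≤ V.1) (hW : genPt j ∈ W.1) {f : Γ(X, U)} {g : Γ(X, V)}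
    (hD : D.ideal U = Ideal.span {f}) (hg : D.ideal V = Ideal.span {g}) :
    ∃ v, pullL j (hWU hW) f = pullL j hW v * pullL j (hWV hW) g := by
  have h3 : X.presheaf.map (homOfLE hWU).op f ∈ Ideal.span {X.presheaf.map (homOfLE hWV).op g} := by
    rw [← ideal_eq_span_restrict D hWV hg, ideal_eq_span_restrict D hWU hD]
    exact Ideal.mem_span_singleton_self _
  obtain ⟨v, hv⟩ := Ideal.mem_span_singleton'.mp h3
  refine ⟨v, ?_⟩
  have h4 := congrArg (pullL j hW) hv
  rw [map_mul, pullL_map, pullL_map] at h4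
  exact h4.symm

lemma mem_twistedSections_iff [IsIntegral X] [IsDominant j] (D : X.IdealSheafData) (n N : ℕ) (a : PS2 k) :
    a ∈ twistedSections ι D n N ↔ ∀ (U : X.affineOpens) (f : Γ(X, U)) (h : genPt j ∈ U.1),
      D.ideal U = Ideal.span {f} → pullL j h f ^ n * algebraMap _ _ a / tL k ^ N ∈ FL ι h := by
  have key (U : X.affineOpens) (f : Γ(X, U)) (h : genPt j ∈ U.1) (m : F.presheaf.obj (.op U.1)) :
      (FormalT.res (j ⁻¹ᵁ (U : X.Opens)) (PS2.t k) ^ N *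
          pushO.toSection ((Scheme.Modules.Hom.app ι (U : X.Opens)).hom m) =
        (j.app (U : X.Opens)).hom f ^ n * FormalT.res (j ⁻¹ᵁ (U : X.Opens)) a) ↔
      modL ι h m = pullL j h f ^ n * algebraMap _ _ a / tL k ^ N := by
    have h' : genericPoint (FormalT k) ∈ j ⁻¹ᵁ U.1 := h
    rw [← (germT_injective h').eq_iff, eq_div_iff (pow_ne_zero _ tL_ne_zero)]
    simp only [map_mul, map_pow]
    rw [germT_res, germT_res, mul_comm]
    rfl
  constructor
  · intro H U f h hD
    obtain ⟨m, hm⟩ := H U f hD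
    exact ⟨m, (key U f h m).mp hm⟩
  · intro H U f hD
    by_cases h : genPt j ∈ U.1
    · obtain ⟨m, hm⟩ := H U f h hD
      exact ⟨m, (key U f h m).mpr hm⟩
    · have h1 : (j ⁻¹ᵁ U.1) = ⊥ := by
        rw [eq_bot_iff]
        intro x hx
        exact absurd (genPt_mem j (x := j x) hx) h
      have : Subsingleton Γ(FormalT k, j ⁻¹ᵁ U.1) := by
        rw [h1]; infer_instance
      exact ⟨0, Subsingleton.elim _ _⟩

/-- On a common affine open set an equation f of D is a multiple v g of any other equation g, so the
condition passes from g to f; then the sheaf property of F applies. -/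
lemma mem_twistedSections_of_local [IsIntegral X] [IsDominant j] [Mono ι] (D : X.IdealSheafData) (n N : ℕ) (a : PS2 k)
    (H : ∀ x : X, ∃ (U : X.affineOpens) (f : Γ(X, U)) (h : genPt j ∈ U.1), x ∈ U.1 ∧
      D.ideal U = Ideal.span {f} ∧ pullL j h f ^ n * algebraMap _ _ a / tL k ^ N ∈ FL ι h) :
    a ∈ twistedSections ι D n N := by
  rw [mem_twistedSections_iff]
  intro U f h hD
  refine FL_of_local ι h fun x hx => ?_
  obtain ⟨V, g, hV, hxV, hg, hmem⟩ := H x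
  obtain ⟨f', g', hfg, hxf⟩ := exists_basicOpen_le_affine_inter U.2 V.2 x ⟨hx, hxV⟩
  have hWU : X.basicOpen f' ≤ U.1 := X.basicOpen_le _
  have hWV : X.basicOpen f' ≤ V.1 := hfg.trans_le (X.basicOpen_le _)
  have hW := genPt_mem j hxf
  refine ⟨_, hxf, hWU, hW, ?_⟩
  let W : X.affineOpens := X.affineBasicOpen f'
  obtain ⟨v, hv⟩ := exists_pullL_eq_mul (j := j) (W := W) D hWU hWV hW hD hg
  have h4 : pullL j h f = pullL j (U := W.1) hW v * pullL j hV g := hv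
  have h5 : pullL j h f ^ n * algebraMap _ _ a / tL k ^ N =
    pullL j (U := W.1) hW v ^ n * (pullL j hV g ^ n * algebraMap _ _ a / tL k ^ N) := by
    rw [h4]; ring
  rw [h5]
  have hvm : pullL j (U := W.1) hW v ∈ OL j (U := W.1) hW := ⟨v, rfl⟩
  exact FL_mul_mem ι (pow_mem hvm n) (FL_mono ι hW hWV hmem)

end embed

end

/-! ### Morphisms out of O_X and the canonical embedding. -/

section

lemma exists_hom_of_section {X : Scheme.{u}} (F : X.Modules) (m : F.presheaf.obj (.op ⊤)) :
    ∃ e : OMod X ⟶ F, (Scheme.Modules.Hom.app e ⊤).hom (OMod.ofSection (1 : Γ(X, ⊤))) = m := by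
  let s : SheafOfModules.sections F := PresheafOfModules.sectionsMk
    (fun U => F.val.map (homOfLE (le_top : U.unop ≤ ⊤)).op m) (fun U V f => by
      have := congr($(F.presheaf.map_comp (homOfLE (le_top : U.unop ≤ ⊤)).op f) m)
      exact this.symm)
  refine ⟨(SheafOfModules.unitHomEquiv F).symm s, ?_⟩
  have h1 := SheafOfModules.unitHomEquiv_apply_coe F ((SheafOfModules.unitHomEquiv F).symm s) (.op ⊤)
  rw [Equiv.apply_symm_apply] at h1
  refine h1.symm.trans ?_
  exact congr($(F.presheaf.map_id _) m)

section

variable {X : Scheme.{u}} {F : X.Modules}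

lemma hom_app_one_eq (e : OMod X ⟶ F) (U : X.Opens) :
    (Scheme.Modules.Hom.app e U).hom (OMod.ofSection (1 : Γ(X, U))) =
      F.presheaf.map (homOfLE (le_top : U ≤ ⊤)).op
        ((Scheme.Modules.Hom.app e ⊤).hom (OMod.ofSection (1 : Γ(X, ⊤)))) := by
  have h1 := congr($((Scheme.Modules.Hom.mapPresheaf e).naturality (homOfLE (le_top : U ≤ ⊤)).op)
    (OMod.ofSection (1 : Γ(X, ⊤))))
  have h2 : (OMod X).presheaf.map (homOfLE (le_top : U ≤ ⊤)).op (OMod.ofSection (1 : Γ(X, ⊤))) =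
    OMod.ofSection (1 : Γ(X, U)) := map_one (X.presheaf.map (homOfLE (le_top : U ≤ ⊤)).op).hom
  refine Eq.trans ?_ h1
  exact congrArg _ h2.symm

lemma hom_app_eq (e : OMod X ⟶ F) {U : X.Opens} (b : Γ(X, U)) :
    (Scheme.Modules.Hom.app e U).hom (OMod.ofSection b) = b • F.presheaf.map (homOfLE (le_top : U ≤ ⊤)).op
        ((Scheme.Modules.Hom.app e ⊤).hom (OMod.ofSection (1 : Γ(X, ⊤)))) := by
  rw [← hom_app_one_eq]
  refine Eq.trans ?_ (Scheme.Modules.Hom.app_smul e b (OMod.ofSection (1 : Γ(X, U))))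
  congr 1
  exact (mul_one b).symm

lemma OMod_hom_ext {e e' : OMod X ⟶ F}
    (h : (Scheme.Modules.Hom.app e ⊤).hom (OMod.ofSection (1 : Γ(X, ⊤))) =
      (Scheme.Modules.Hom.app e' ⊤).hom (OMod.ofSection (1 : Γ(X, ⊤)))) : e = e' := by
  ext U b
  refine (hom_app_eq e b).trans ?_
  rw [h]
  exact (hom_app_eq e' b).symm

end

namespace GeometricDatum

variable {k : Type u} [Field k] (G : GeometricDatum k)

instance : IsIntegral G.X := G.isIntegral
instance : IsDominant G.j := G.j_dominant
instance : Mono G.incl := G.incl_mono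
instance : G.F.IsQuasicoherent := G.quasicoherent

lemma genPt_mem_top : genPt G.j ∈ (⊤ : G.X.Opens) := trivial

lemma valueAtOne_eq (e : OMod G.X ⟶ G.F) : algebraMap (PS2 k) (FunT k) (G.valueAtOne e) =
    modL G.incl G.genPt_mem_top ((Scheme.Modules.Hom.app e ⊤).hom (OMod.ofSection (1 : Γ(G.X, ⊤)))) := by
  rw [← germT_res (V := ⊤) trivial]
  unfold FormalT.res valueAtOne
  have h1 : (FormalT k).presheaf.map (homOfLE (le_top : (⊤ : (FormalT k).Opens) ≤ ⊤)).op = 𝟙 _ :=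
    (FormalT k).presheaf.map_id _
  rw [h1]
  have h2 (z : Γ(FormalT k, ⊤)) : (Scheme.ΓSpecIso (.of (PS2 k))).inv.hom
      ((Scheme.ΓSpecIso (.of (PS2 k))).hom.hom z) = z :=
    Iso.hom_inv_id_apply (Scheme.ΓSpecIso (.of (PS2 k))) z
  exact congrArg (germT (V := ⊤) trivial) (h2 _)

lemma modL_app (e : OMod G.X ⟶ G.F) {U : G.X.Opens} (h : genPt G.j ∈ U) (b : Γ(G.X, U)) :
    modL G.incl h ((Scheme.Modules.Hom.app e U).hom (OMod.ofSection b)) =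
      pullL G.j h b * algebraMap _ _ (G.valueAtOne e) := by
  rw [hom_app_eq, modL_smul, modL_map, valueAtOne_eq]

lemma mem_twistedSections_zero {D : G.X.IdealSheafData} (hD : IsEffectiveCartier D) {N : ℕ}
    (hN : N = 0) (a : PS2 k) :
    a ∈ twistedSections G.incl D 0 N ↔ algebraMap _ _ a ∈ FL G.incl G.genPt_mem_top := by
  subst hN
  constructor
  · intro h
    rw [mem_twistedSections_iff] at h
    refine FL_of_local G.incl _ fun x _ => ?_
    obtain ⟨U, f, hx, -, hf⟩ := hD x
    have hU := genPt_mem G.j hx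
    exact ⟨U, hx, le_top, hU, by simpa using h U f hU hf⟩
  · intro h
    refine mem_twistedSections_of_local G.incl _ _ _ _ fun x => ?_
    obtain ⟨U, f, hx, -, hf⟩ := hD x
    have hU := genPt_mem G.j hx
    refine ⟨U, f, hU, hx, hf, ?_⟩
    simpa using FL_mono G.incl hU le_top h

/-- For n = 0 the twisted sections are the global sections of F and the power of the maximal ideal
is its first power. A morphism from O_X is determined by the image of 1. -/
lemma existsUnique_canonicalEmbedding : ∃! e : OMod G.X ⟶ G.F, G.IsCanonicalEmbedding e := by
  obtain ⟨D, d, hd, hD, -, -, hbij⟩ := G.sections_iso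
  have h0 := hbij 0
  obtain ⟨a, ha, ha1⟩ := h0.surjOn (Set.mem_univ (Ideal.Quotient.mk _ 1))
  have hp : PS2.maxIdeal k ^ (0 * d * G.rank + 1) = PS2.maxIdeal k := by simp
  rw [mem_twistedSections_zero G hD (by simp)] at ha
  obtain ⟨m, hm⟩ := ha
  obtain ⟨e, he⟩ := exists_hom_of_section G.F m
  have hea : G.valueAtOne e = a := by
    apply IsFractionRing.injective (PS2 k) (FunT k)
    rw [valueAtOne_eq, he, hm]
  have hcan (e' : OMod G.X ⟶ G.F) : G.IsCanonicalEmbedding e' ↔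
      Ideal.Quotient.mk (PS2.maxIdeal k ^ (0 * d * G.rank + 1)) (G.valueAtOne e') =
        Ideal.Quotient.mk _ 1 := by
    rw [Ideal.Quotient.mk_eq_mk_iff_sub_mem, hp, PS2.mem_maxIdeal_iff, map_sub, sub_eq_zero, map_one]
    rfl
  refine ⟨e, ?_, fun e' he' => ?_⟩
  · exact (hcan e).mpr (by rw [hea, ha1])
  · have h1 : G.valueAtOne e' = a := by
      refine h0.injOn ?_ ?_ (((hcan e').mp he').trans ha1.symm)
      · rw [mem_twistedSections_zero G hD (by simp), valueAtOne_eq]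
        exact ⟨_, rfl⟩
      · rw [mem_twistedSections_zero G hD (by simp)]
        exact ⟨_, hm⟩
    apply OMod_hom_ext
    apply modL_injective G.incl G.genPt_mem_top
    rw [← valueAtOne_eq, ← valueAtOne_eq, h1, hea]

lemma IsCanonicalEmbedding.isUnit {G : GeometricDatum k} {e : OMod G.X ⟶ G.F}
    (he : G.IsCanonicalEmbedding e) : IsUnit (G.valueAtOne e) := by
  rw [MvPowerSeries.isUnit_iff_constantCoeff, he]
  exact isUnit_one

/-- In the function field of T the morphism is multiplication by a unit of R. -/
lemma IsCanonicalEmbedding.app_injective {G : GeometricDatum k} {e : OMod G.X ⟶ G.F}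
    (he : G.IsCanonicalEmbedding e) (U : G.X.Opens) :
    Function.Injective (Scheme.Modules.Hom.app e U).hom := by
  by_cases h : genPt G.j ∈ U
  · intro b b' hb
    have h1 := congrArg (modL G.incl h) hb
    have h2 := (modL_app G e h b).symm.trans (h1.trans (modL_app G e h b'))
    exact pullL_injective (j := G.j) h (mul_right_cancel₀ (he.isUnit.map (algebraMap (PS2 k) (FunT k))).ne_zero h2)
  · have h1 : U = ⊥ := by
      rw [eq_bot_iff]
      intro x hx
      exact absurd (genPt_mem G.j hx) h
    have : Subsingleton Γ(G.X, U) := by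
      rw [h1]; infer_instance
    intro b b' _
    exact this.elim b b'

lemma IsCanonicalEmbedding.mono {G : GeometricDatum k} {e : OMod G.X ⟶ G.F}
    (he : G.IsCanonicalEmbedding e) : Mono e := by
  have h2 : Mono ((Scheme.Modules.toPresheaf G.X).map e) := by
    rw [NatTrans.mono_iff_mono_app]
    intro U
    exact (AddCommGrpCat.mono_iff_injective _).mpr (he.app_injective U.unop)
  exact (Scheme.Modules.toPresheaf G.X).mono_of_mono_map h2

end GeometricDatum

end

/-! ### Inverse images of ideal sheaves on affine open sets. -/

section

open Scheme in
lemma IsAffineOpen.specMap_fromSpec_app_eq_zero {X : Scheme.{u}} {U : X.Opens} (hU : IsAffineOpen U)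
    {S : CommRingCat.{u}} (φ : Γ(X, U) ⟶ S) {x : Γ(X, U)}
    (hx : (Spec.map φ ≫ hU.fromSpec).app U x = 0) : φ x = 0 := by
  rw [Scheme.Hom.comp_app, hU.fromSpec_app_self] at hx
  have h1 : (Spec.map φ).app _ ((Spec Γ(X, U)).presheaf.map (eqToHom hU.fromSpec_preimage_self).op
      ((Scheme.ΓSpecIso Γ(X, U)).inv x)) = 0 := hx
  have h2 := congr($((Spec.map φ).naturality (eqToHom hU.fromSpec_preimage_self).op)
    ((Scheme.ΓSpecIso Γ(X, U)).inv x))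
  have h3 := congr($(Scheme.ΓSpecIso_inv_naturality φ) x)
  have h4 : (Spec S).presheaf.map ((TopologicalSpace.Opens.map (Spec.map φ).base).map
    (eqToHom hU.fromSpec_preimage_self)).op ((Scheme.ΓSpecIso S).inv (φ x)) = 0 := by
    refine Eq.trans ?_ (h2.symm.trans h1)
    exact congrArg _ h3
  have h5 := (CategoryTheory.ConcreteCategory.injective_of_mono_of_preservesPullback _) (h4.trans (map_zero _).symm)
  have h6 := (CategoryTheory.ConcreteCategory.injective_of_mono_of_preservesPullback _) (h5.trans (map_zero _).symm)
  exact h6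

/-- The closed subscheme defined by the extended ideal K maps to the subscheme of I, hence factors
through the fibre product. So a function vanishing on the fibre product lies in K. The other
inclusion is commutativity of the fibre square. -/
lemma Scheme.IdealSheafData.ideal_comap {X Y : Scheme.{u}} (I : Y.IdealSheafData) (f : X ⟶ Y)
    (V : Y.affineOpens) (H : IsAffineOpen (f ⁻¹ᵁ V.1)) :
    (I.comap f).ideal ⟨f ⁻¹ᵁ V.1, H⟩ = (I.ideal V).map (f.app V.1).hom := by
  have hfst : Limits.pullback.fst f I.subschemeι ≫ f = Limits.pullback.snd f I.subschemeι ≫ I.subschemeι :=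
    Limits.pullback.condition
  apply le_antisymm
  · intro x hx
    let K := (I.ideal V).map (f.app V.1).hom
    let w := Spec.map (CommRingCat.ofHom (Ideal.Quotient.mk K)) ≫ H.fromSpec
    have hK : I.ideal V ≤ K.comap (f.app V.1).hom := Ideal.le_comap_map
    let b := Spec.map (CommRingCat.ofHom (Ideal.quotientMap K (f.app V.1).hom hK))
    have e1 : w ≫ f = (b ≫ I.subschemeCover.f V) ≫ I.subschemeι := by
      have h2 := I.subschemeCover_map_subschemeι V
      rw [I.glueDataObjι_ι V] at h2
      rw [Category.assoc]
      refine Eq.trans ?_ (congrArg (b ≫ ·) h2.symm)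
      have h3 := IsAffineOpen.SpecMap_appLE_fromSpec f V.2 H le_rfl
      rw [Scheme.Hom.appLE_eq_app] at h3
      simp only [b]
      rw [← h3, ← Spec.map_comp_assoc, ← Spec.map_comp_assoc]
      rfl
    have e2 : Limits.pullback.lift w (b ≫ I.subschemeCover.f V) e1 ≫
      Limits.pullback.fst f I.subschemeι = w := Limits.pullback.lift_fst _ _ _
    have h3 : (I.comap f) ≤ w.ker := by
      rw [← e2]
      exact Scheme.Hom.le_ker_comp _ _
    have h4 := Scheme.Hom.ideal_ker_le w _ (h3 _ hx)
    have h5 := IsAffineOpen.specMap_fromSpec_app_eq_zero H _ h4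
    exact Ideal.Quotient.eq_zero_iff_mem.mp h5
  · rw [Ideal.map_le_iff_le_comap]
    intro b hb
    rw [← I.ker_subschemeι, Scheme.Hom.ker_apply] at hb
    rw [Ideal.mem_comap, Scheme.IdealSheafData.comap, Scheme.Hom.ker_apply]
    have h1 := Scheme.Hom.congr_app hfst V.1
    have h2 := congr($h1 b)
    rw [Scheme.Hom.comp_app, Scheme.Hom.comp_app] at h2
    have h3 : I.subschemeι.app V.1 b = 0 := hb
    refine h2.trans ?_
    change (Limits.pullback f I.subschemeι).presheaf.map _
      ((Limits.pullback.snd f I.subschemeι).app _ (I.subschemeι.app V.1 b)) = 0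
    rw [h3, map_zero, map_zero]

end

/-! ### Degree-zero fractions on projective space, pulled back to T. -/

section

variable {k : Type u} [Field k]

instance : Algebra k (FunT k) := ((algebraMap (PS2 k) (FunT k)).comp (algebraMap k (PS2 k))).toAlgebra

instance : IsScalarTower k (PS2 k) (FunT k) := .of_algebraMap_eq fun _ => rfl

lemma pullL_top_toSpec {X : Scheme.{u}} (j : FormalT k ⟶ X) (s : X ⟶ Spec (.of k))
    (hs : j ≫ s = Spec.map (CommRingCat.ofHom (algebraMap k (PS2 k)))) (h : genPt j ∈ (⊤ : X.Opens)) (c : k) :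
    pullL j h (s.appTop ((Scheme.ΓSpecIso (.of k)).inv c)) = algebraMap k (FunT k) c := by
  have h1 := congr($(congrArg Scheme.Hom.appTop hs) ((Scheme.ΓSpecIso (.of k)).inv c))
  have h2 := congr($(Scheme.ΓSpecIso_inv_naturality (CommRingCat.ofHom (algebraMap k (PS2 k)))) c)
  have h4 : j.appTop (s.appTop ((Scheme.ΓSpecIso (.of k)).inv c)) =
      (Scheme.ΓSpecIso (.of (PS2 k))).inv (algebraMap k (PS2 k) c) := by
    rw [Scheme.Hom.comp_appTop] at h1
    exact h1.trans h2.symm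
  exact congrArg (germT (V := ⊤) trivial) h4

lemma MvPolynomial.aeval_mul_of_isHomogeneous {σ R S : Type*} [CommRing R] [CommRing S] [Algebra R S] (c : S) (y : σ → S)
    {n : ℕ} {Q : MvPolynomial σ R} (hQ : Q.IsHomogeneous n) :
    aeval (fun i => c * y i) Q = c ^ n * aeval y Q := by
  rw [aeval_def, aeval_def, eval₂_eq, eval₂_eq, Finset.mul_sum]
  refine Finset.sum_congr rfl fun m hm => ?_
  have h1 : m.degree = n := by
    have := hQ (mem_support_iff.mp hm)
    rw [Finsupp.degree_eq_weight_one]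
    exact this
  rw [← h1, Finsupp.degree_apply, ← Finset.prod_pow_eq_pow_sum]
  simp_rw [mul_pow, Finset.prod_mul_distrib]
  ring

namespace PSpace
variable {N : ℕ}
open MvPolynomial

lemma restrict_toSpec {f : MvPolynomial (Fin (N + 1)) k} {d : ℕ}
    (hf : f ∈ homogeneousSubmodule (Fin (N + 1)) k d) (hd : 0 < d) (c : k) :
    (PSpace k N).presheaf.map (homOfLE (le_top : Proj.basicOpen (homogeneousSubmodule (Fin (N + 1)) k) f ≤ ⊤)).op
      ((PSpace.toSpec k N).appTop ((Scheme.ΓSpecIso (.of k)).inv c)) =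
    Proj.awayToSection _ f (HomogeneousLocalization.fromZeroRingHom _ _ (algebraMap k (homogeneousSubmodule (Fin (N + 1)) k 0) c)) := by
  have e1 := Proj.awayι_toSpecZero (homogeneousSubmodule (Fin (N + 1)) k) f hf hd
  rw [Proj.awayι, Category.assoc, Iso.inv_comp_eq, Proj.basicOpenIsoSpec_hom] at e1
  have e2 : (Proj.basicOpen (homogeneousSubmodule (Fin (N + 1)) k) f).ι ≫ PSpace.toSpec k N =
    Proj.basicOpenToSpec _ f ≫ Spec.map (CommRingCat.ofHom (HomogeneousLocalization.fromZeroRingHom _ _) ) ≫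
     Spec.map (CommRingCat.ofHom (algebraMap k (homogeneousSubmodule (Fin (N + 1)) k 0))) := by
    rw [PSpace.toSpec, reassoc_of% e1]
  rw [← Spec.map_comp] at e2
  have e3 := congr($(congrArg Scheme.Hom.appTop e2) ((Scheme.ΓSpecIso (.of k)).inv c))
  rw [Scheme.Hom.comp_appTop, Scheme.Hom.comp_appTop, ← CommRingCat.ofHom_comp] at e3
  have e4 := congr($(Scheme.ΓSpecIso_inv_naturality (CommRingCat.ofHom ((HomogeneousLocalization.fromZeroRingHom
    (homogeneousSubmodule (Fin (N + 1)) k) (.powers f)).comp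
      (algebraMap k (homogeneousSubmodule (Fin (N + 1)) k 0))))) c)
  have e5 := congr($(Proj.basicOpenToSpec_app_top (homogeneousSubmodule (Fin (N + 1)) k) f)
     ((Scheme.ΓSpecIso _).inv (HomogeneousLocalization.fromZeroRingHom _ _ (algebraMap k (homogeneousSubmodule (Fin (N + 1)) k 0) c))))
  have e6 : (Proj.basicOpen (homogeneousSubmodule (Fin (N + 1)) k) f).ι.appTop
     ((PSpace.toSpec k N).appTop ((Scheme.ΓSpecIso (.of k)).inv c)) =
     (Proj.basicOpen (homogeneousSubmodule (Fin (N + 1)) k) f).topIso.inv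
      (Proj.awayToSection _ f (HomogeneousLocalization.fromZeroRingHom _ _ (algebraMap k (homogeneousSubmodule (Fin (N + 1)) k 0) c))) := by
    refine e3.trans ?_
    refine Eq.trans (congrArg (Proj.basicOpenToSpec (homogeneousSubmodule (Fin (N + 1)) k) f).appTop e4.symm) ?_
    refine e5.trans ?_
    simp
    rfl
  have e7 := congrArg (Proj.basicOpen (homogeneousSubmodule (Fin (N + 1)) k) f).topIso.hom e6
  rw [Iso.inv_hom_id_apply] at e7
  refine Eq.trans ?_ e7
  rw [Scheme.Opens.ι_appTop, Scheme.Opens.topIso_hom]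
  exact congrArg (fun φ : Γ(PSpace k N, ⊤) ⟶ Γ(PSpace k N, Proj.basicOpen (homogeneousSubmodule (Fin (N + 1)) k) f) =>
    φ.hom ((PSpace.toSpec k N).appTop ((Scheme.ΓSpecIso (.of k)).inv c))) ((PSpace k N).presheaf.map_comp _ _)

section coordinates

variable {j : FormalT k ⟶ PSpace k N}

/-- Degree zero fractions as rational functions on `T`. -/
def fracL (j : FormalT k ⟶ PSpace k N) {f : MvPolynomial (Fin (N + 1)) k}
    (h : genPt j ∈ Proj.basicOpen (homogeneousSubmodule (Fin (N + 1)) k) f) :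
    HomogeneousLocalization.Away (homogeneousSubmodule (Fin (N + 1)) k) f →+* FunT k :=
  (pullL j h).comp (Proj.awayToSection (homogeneousSubmodule (Fin (N + 1)) k) f).hom

variable {f g : MvPolynomial (Fin (N + 1)) k}

lemma fracL_awayMap {e : ℕ} (hg : g ∈ homogeneousSubmodule (Fin (N + 1)) k e)
    (h : genPt j ∈ Proj.basicOpen (homogeneousSubmodule (Fin (N + 1)) k) f)
    (h' : genPt j ∈ Proj.basicOpen (homogeneousSubmodule (Fin (N + 1)) k) (f * g)) (z) :
    fracL j h' (HomogeneousLocalization.awayMap (homogeneousSubmodule (Fin (N + 1)) k) hg rfl z) = fracL j h z := by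
  have h1 := congr(pullL j h' ($(Proj.awayMap_awayToSection (homogeneousSubmodule (Fin (N + 1)) k) (f := f) hg rfl) z))
  exact h1.trans (pullL_map j h' _ _)

lemma fracL_awayMap' {e : ℕ} (hg : g ∈ homogeneousSubmodule (Fin (N + 1)) k e)
    (h : genPt j ∈ Proj.basicOpen (homogeneousSubmodule (Fin (N + 1)) k) f)
    (h' : genPt j ∈ Proj.basicOpen (homogeneousSubmodule (Fin (N + 1)) k) (g * f)) (z) :
    fracL j h' (HomogeneousLocalization.awayMap (homogeneousSubmodule (Fin (N + 1)) k) hg (mul_comm g f) z) = fracL j h z := by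
  have h1 := congr(pullL j h' ($(Proj.awayMap_awayToSection (homogeneousSubmodule (Fin (N + 1)) k) (f := f) hg (mul_comm g f)) z))
  exact h1.trans (pullL_map j h' _ _)

lemma fracL_fromZero {d : ℕ} (hf : f ∈ homogeneousSubmodule (Fin (N + 1)) k d) (hd : 0 < d)
    (h : genPt j ∈ Proj.basicOpen (homogeneousSubmodule (Fin (N + 1)) k) f)
    (hj : j ≫ PSpace.toSpec k N = Spec.map (CommRingCat.ofHom (algebraMap k (PS2 k)))) (c : k) :
    fracL j h (HomogeneousLocalization.fromZeroRingHom _ _ (algebraMap k (homogeneousSubmodule (Fin (N + 1)) k 0) c)) =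
      algebraMap k (FunT k) c := by
  rw [← pullL_top_toSpec j (PSpace.toSpec k N) hj trivial c, ← pullL_map j h (homOfLE le_top)]
  exact congrArg (pullL j h) (restrict_toSpec hf hd c).symm

/-- The affine coordinates of the generic point of `T`, with respect to a linear form. -/
def coord (j : FormalT k ⟶ PSpace k N) {l : MvPolynomial (Fin (N + 1)) k} (hl : l ∈ homogeneousSubmodule (Fin (N + 1)) k 1)
    (h : genPt j ∈ Proj.basicOpen (homogeneousSubmodule (Fin (N + 1)) k) l) (i : Fin (N + 1)) : FunT k :=
  fracL j h (.mk _ hl 1 (X i) (isHomogeneous_X k i))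

/-- Dehomogenization by l sends a form Q of degree n to Q/l^n. Followed by `fracL` it is a ring
homomorphism, which is determined on constants and variables. -/
lemma fracL_linear (hj : j ≫ PSpace.toSpec k N = Spec.map (CommRingCat.ofHom (algebraMap k (PS2 k))))
    {l : MvPolynomial (Fin (N + 1)) k} (hl : l ∈ homogeneousSubmodule (Fin (N + 1)) k 1)
    (h : genPt j ∈ Proj.basicOpen (homogeneousSubmodule (Fin (N + 1)) k) l) {n : ℕ} {Q : MvPolynomial (Fin (N + 1)) k}
    (hQ : Q ∈ homogeneousSubmodule (Fin (N + 1)) k (n • 1)) :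
    fracL j h (.mk _ hl n Q hQ) = aeval (coord j hl h) Q := by
  let φ : MvPolynomial (Fin (N + 1)) k →+* HomogeneousLocalization.Away (homogeneousSubmodule (Fin (N + 1)) k) l :=
    eval₂Hom ((HomogeneousLocalization.fromZeroRingHom _ _).comp (algebraMap k (homogeneousSubmodule (Fin (N + 1)) k 0)))
      fun i => .mk _ hl 1 (X i) (isHomogeneous_X k i)
  have h1 : (fracL j h).comp φ = (aeval (coord j hl h) : MvPolynomial (Fin (N + 1)) k →ₐ[k] FunT k).toRingHom := by
    apply MvPolynomial.ringHom_ext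
    · intro c
      simp [φ]
      exact fracL_fromZero hl one_pos h hj c
    · intro i
      simp [φ, coord]
  refine Eq.trans (congrArg _ ?_) congr($h1 Q)
  let y (i : Fin (N + 1)) : Localization.Away l := Localization.mk (X i) ⟨l ^ 1, 1, rfl⟩
  have h2 (P) : (φ P).val = aeval y P := by
    have : (algebraMap _ (Localization.Away l)).comp φ = (aeval y : MvPolynomial (Fin (N + 1)) k →ₐ[k] _).toRingHom := by
      apply MvPolynomial.ringHom_ext
      · intro c
        simp [φ]
        rfl
      · intro i
        simp [φ]
        rfl
    exact congr($this P)
  ext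
  rw [h2, HomogeneousLocalization.Away.val_mk]
  have h3 := MvPolynomial.aeval_mul_of_isHomogeneous (algebraMap _ (Localization.Away l) l) y (n := n) (Q := Q) (by simpa using hQ)
  have h4 (i : Fin (N + 1)) : algebraMap (MvPolynomial (Fin (N + 1)) k) (Localization.Away l) l * y i =
      algebraMap _ (Localization.Away l) (X i : MvPolynomial (Fin (N + 1)) k) := by
    simp only [y]
    rw [← Localization.mk_one_eq_algebraMap, Localization.mk_mul, ← Localization.mk_one_eq_algebraMap, Localization.mk_eq_mk_iff,
      Localization.r_iff_exists]
    exact ⟨1, by simp⟩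
  simp_rw [h4] at h3
  have h5 : aeval (fun i => algebraMap _ (Localization.Away l) (X i : MvPolynomial (Fin (N + 1)) k)) Q = algebraMap _ (Localization.Away l) Q := by
    have := MvPolynomial.aeval_algebraMap_apply (Localization.Away l) (X : Fin (N + 1) → MvPolynomial (Fin (N + 1)) k) Q
    rw [aeval_X_left_apply] at this
    exact this
  rw [h5] at h3
  have h6 : IsUnit (algebraMap _ (Localization.Away l) l ^ n) := (IsLocalization.Away.algebraMap_isUnit l).pow n
  apply h6.mul_left_cancel
  rw [← h3, ← map_pow, ← Localization.mk_one_eq_algebraMap, Localization.mk_mul, ← Localization.mk_one_eq_algebraMap, Localization.mk_eq_mk_iff,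
      Localization.r_iff_exists]
  exact ⟨1, by simp⟩

/-- Fractions with denominators f and l are compared on the open set where l f is nonzero. -/
lemma fracL_mk (hj : j ≫ PSpace.toSpec k N = Spec.map (CommRingCat.ofHom (algebraMap k (PS2 k))))
    {l : MvPolynomial (Fin (N + 1)) k} (hl : l ∈ homogeneousSubmodule (Fin (N + 1)) k 1)
    (h : genPt j ∈ Proj.basicOpen (homogeneousSubmodule (Fin (N + 1)) k) l)
    {d : ℕ} (hf : f ∈ homogeneousSubmodule (Fin (N + 1)) k d)
    (h' : genPt j ∈ Proj.basicOpen (homogeneousSubmodule (Fin (N + 1)) k) f)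
    {n : ℕ} {Q : MvPolynomial (Fin (N + 1)) k}
    (hQ : Q ∈ homogeneousSubmodule (Fin (N + 1)) k (n • d)) :
    fracL j h' (.mk _ hf n Q hQ) * aeval (coord j hl h) f ^ n = aeval (coord j hl h) Q := by
  have hlf : genPt j ∈ Proj.basicOpen (homogeneousSubmodule (Fin (N + 1)) k) (l * f) := by
    rw [Proj.basicOpen_mul]; exact ⟨h, h'⟩
  have hQ' : Q ∈ homogeneousSubmodule (Fin (N + 1)) k ((n * d) • 1) := by simpa using hQ
  have hf' : f ∈ homogeneousSubmodule (Fin (N + 1)) k (d • 1) := by simpa using hf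
  rw [← fracL_linear hj hl h hf', ← fracL_linear hj hl h hQ', ← fracL_awayMap hf h hlf, ← fracL_awayMap hf h hlf,
    ← fracL_awayMap' hl h' hlf, ← map_pow, ← map_mul]
  congr 1
  ext
  simp [Localization.mk_mul, Localization.mk_pow]
  rw [Localization.mk_eq_mk_iff, Localization.r_iff_exists]
  exact ⟨1, by simp; ring⟩

end coordinates

end PSpace

end

/-! ### Principal primes in a local ring with two-generated maximal ideal. -/

section

open IsLocalRing

lemma Submodule.exists_eq_span_pair {A M : Type*} [CommRing A] [AddCommGroup M] [Module A M] {p : Submodule A M} (hp : p.FG)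
    (h : p.spanFinrank ≤ 2) : ∃ a b, p = Submodule.span A {a, b} := by
  classical
  obtain ⟨s, hs, hsp⟩ := hp.exists_span_finset_card_eq_spanFinrank
  rw [← hs] at h
  rw [← hsp]
  have : s.card = 0 ∨ s.card = 1 ∨ s.card = 2 := by omega
  rcases this with h | h | h
  · rw [Finset.card_eq_zero] at h
    exact ⟨0, 0, by simp [h]⟩
  · obtain ⟨a, rfl⟩ := Finset.card_eq_one.mp h
    exact ⟨a, a, by simp⟩
  · obtain ⟨a, b, -, rfl⟩ := Finset.card_eq_two.mp h
    exact ⟨a, b, by simp⟩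

lemma Submodule.exists_eq_span_singleton {A M : Type*} [CommRing A] [AddCommGroup M] [Module A M] {p : Submodule A M} (hp : p.FG)
    (h : p.spanFinrank ≤ 1) : ∃ a, p = Submodule.span A {a} := by
  classical
  obtain ⟨s, hs, hsp⟩ := hp.exists_span_finset_card_eq_spanFinrank
  rw [← hs] at h
  rw [← hsp]
  have : s.card = 0 ∨ s.card = 1 := by omega
  rcases this with h | h
  · rw [Finset.card_eq_zero] at h
    exact ⟨0, by simp [h]⟩
  · obtain ⟨a, rfl⟩ := Finset.card_eq_one.mp h
    exact ⟨a, by simp⟩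

/-- A prime of a local ring with maximal ideal generated by two elements is principal if
the maximal ideal is principal modulo that prime. -/
theorem IsLocalRing.exists_eq_span_singleton {A : Type*} [CommRing A] [IsLocalRing A] [IsNoetherianRing A] {p : Ideal A}
    [p.IsPrime] (hp : p ≠ maximalIdeal A) (h2 : (maximalIdeal A).spanFinrank ≤ 2) {h : A}
    (hh : maximalIdeal A = p ⊔ Ideal.span {h}) :
    ∃ g, p = Ideal.span {g} ∧ maximalIdeal A = Ideal.span {g, h} := by
  have hhp : h ∉ p := by
    intro h1
    rw [sup_eq_left.mpr (by simpa [Ideal.span_le] using h1)] at hh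
    exact hp hh.symm
  have hmem {x} (hx : x ∈ maximalIdeal A) : ∃ y ∈ p, ∃ c, x = y + c * h := by
    rw [hh, Submodule.mem_sup] at hx
    obtain ⟨y, hy, z, hz, rfl⟩ := hx
    obtain ⟨c, rfl⟩ := Ideal.mem_span_singleton'.mp hz
    exact ⟨y, hy, c, rfl⟩
  have hple : p ≤ maximalIdeal A := le_maximalIdeal (Ideal.IsPrime.ne_top inferInstance)
  have hhm : h ∈ maximalIdeal A := by rw [hh]; exact Ideal.mem_sup_right (Ideal.mem_span_singleton_self h)
  -- If a g + b h lies in p then b lies in p, because p is prime and does not contain h. So p = (g)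
  -- + m p, and Nakayama's lemma gives p = (g).
  suffices H : ∃ g ∈ p, maximalIdeal A = Ideal.span {g, h} by
    obtain ⟨g, hg, hm⟩ := H
    refine ⟨g, le_antisymm ?_ (by simpa [Ideal.span_le] using hg), hm⟩
    refine Submodule.le_of_le_smul_of_le_jacobson_bot (I := maximalIdeal A) (IsNoetherian.noetherian p)
      (by rw [IsLocalRing.jacobson_eq_maximalIdeal _ bot_ne_top]) ?_
    intro x hx
    have hx' := hple hx
    rw [hm, Ideal.mem_span_pair] at hx'
    obtain ⟨a, b, rfl⟩ := hx'
    have hb : b ∈ p := by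
      have : b * h ∈ p := by simpa using p.sub_mem hx (p.mul_mem_left a hg)
      exact (Ideal.IsPrime.mem_or_mem inferInstance this).resolve_right hhp
    refine add_mem (Ideal.mem_sup_left (Ideal.mul_mem_left _ a (Ideal.mem_span_singleton_self g))) (Ideal.mem_sup_right ?_)
    rw [mul_comm]
    exact Submodule.smul_mem_smul hhm hb
  obtain ⟨a, b, hab⟩ := Submodule.exists_eq_span_pair (IsNoetherian.noetherian (maximalIdeal A)) h2
  have hab' : maximalIdeal A = Ideal.span {a, b} := hab
  -- When h involves a with a unit coefficient, (h, b) generates the maximal ideal, and b may be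
  -- replaced by its component in p.
  have key (a b : A) (hab : maximalIdeal A = Ideal.span {a, b}) (c : A) (d : A) (hcd : h = c * a + d * b) (hc : IsUnit c) :
      ∃ g ∈ p, maximalIdeal A = Ideal.span {g, h} := by
    obtain ⟨y, hy, e, rfl⟩ := hmem (x := b) (by rw [hab]; exact Ideal.subset_span (by simp))
    refine ⟨y, hy, le_antisymm ?_ ?_⟩
    · obtain ⟨c, rfl⟩ := hc
      rw [hab, Ideal.span_le]
      rintro z (rfl | rfl)
      · refine Ideal.mem_span_pair.mpr ⟨- ↑c⁻¹ * d, ↑c⁻¹ * (1 - d * e), ?_⟩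
        linear_combination (↑c⁻¹ : A) * hcd + z * c.inv_mul
      · exact Ideal.mem_span_pair.mpr ⟨1, e, by ring⟩
    · rw [Ideal.span_le]
      rintro z (rfl | rfl)
      · exact hple hy
      · exact hhm
  have hh' := hhm
  rw [hab', Ideal.mem_span_pair] at hh'
  obtain ⟨c, d, hcd⟩ := hh'
  obtain ⟨y, hy, e, hye⟩ := hmem (x := a) (by rw [hab']; exact Ideal.subset_span (by simp))
  obtain ⟨y', hy', e', hye'⟩ := hmem (x := b) (by rw [hab']; exact Ideal.subset_span (by simp))
  by_cases hc : IsUnit c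
  · exact key a b hab' c d hcd.symm hc
  by_cases hd : IsUnit d
  · exact key b a (by rw [hab', Set.pair_comm]) d c (by rw [← hcd, add_comm]) hd
  -- With both coefficients in the maximal ideal, h is congruent modulo p to a multiple of itself by
  -- a nonunit, which forces h into p.
  exfalso
  have h1 : (1 - (c * e + d * e')) * h ∈ p := by
    have : (1 - (c * e + d * e')) * h = c * y + d * y' := by
      have : h = c * (y + e * h) + d * (y' + e' * h) := by rw [← hye, ← hye', hcd]
      linear_combination this
    rw [this]
    exact add_mem (p.mul_mem_left _ hy) (p.mul_mem_left _ hy')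
  have h2 : c * e + d * e' ∈ maximalIdeal A :=
    add_mem (Ideal.mul_mem_right _ _ hc) (Ideal.mul_mem_right _ _ hd)
  have h3 : IsUnit (1 - (c * e + d * e')) := by
    by_contra h4
    have := add_mem (S := Ideal A) h2 ((mem_maximalIdeal _).mpr h4)
    rw [add_sub_cancel] at this
    exact (Ideal.ne_top_iff_one _).mp (maximalIdeal.isMaximal A).ne_top this
  rw [Ideal.unit_mul_mem_iff_mem _ h3] at h1
  exact hhp h1

lemma AlgebraicGeometry.Scheme.coheight_le_topologicalKrullDim {X : Scheme.{u}} (x : X) : (Order.coheight x : WithBot ℕ∞) ≤ topologicalKrullDim X := by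
  refine (Order.coheight_le_krullDim x).trans ?_
  rw [topologicalKrullDim, ← Order.krullDim_eq_of_orderIso (irreducibleSetEquivPoints (α := X))]

open PS2 in
-- Orders modulo t add under multiplication, so a product of two series not divisible by t is not
-- divisible by t.
lemma PS2.t_prime {k : Type u} [Field k] : Prime (PS2.t k) := by
  refine ⟨t_ne_zero, fun h => ?_, fun a b hab => ?_⟩
  · rw [MvPowerSeries.isUnit_iff_constantCoeff] at h
    simp [t] at h
  · by_contra! h
    obtain ⟨e, he⟩ := exists_hasOrder h.1
    obtain ⟨e', he'⟩ := exists_hasOrder h.2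
    exact (he.mul he').coeff_ne_zero (t_dvd_iff.mp hab _)

end

/-! ### Functions near P as power series; finiteness properties of X. -/

section

variable {k : Type u} [Field k]

lemma FormalT.eq_top_of_closedPoint_mem {V : (FormalT k).Opens} (h : IsLocalRing.closedPoint (PS2 k) ∈ V) : ⊤ ≤ V := by
  rw [show V = ⊤ from (IsLocalRing.closedPoint_mem_iff V).mp h]

/-- Global sections of `𝒪_T` as power series. -/
def resTop {V : (FormalT k).Opens} (hV : ⊤ ≤ V) : Γ(FormalT k, V) →+* PS2 k :=
  ((Scheme.ΓSpecIso (.of (PS2 k))).hom.hom).comp ((FormalT k).presheaf.map (homOfLE hV).op).hom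

lemma algebraMap_resTop {V : (FormalT k).Opens} (hV : ⊤ ≤ V) (a : Γ(FormalT k, V)) :
    algebraMap (PS2 k) (FunT k) (resTop hV a) = germT (hV trivial) a := by
  rw [← germT_res (V := ⊤) trivial, ← germT_map (V := ⊤) trivial (homOfLE hV)]
  unfold FormalT.res resTop
  have h1 : (FormalT k).presheaf.map (homOfLE (le_top : (⊤ : (FormalT k).Opens) ≤ ⊤)).op = 𝟙 _ :=
    (FormalT k).presheaf.map_id _
  rw [h1]
  have h2 (z : Γ(FormalT k, ⊤)) : (Scheme.ΓSpecIso (.of (PS2 k))).inv.hom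
      ((Scheme.ΓSpecIso (.of (PS2 k))).hom.hom z) = z :=
    Iso.hom_inv_id_apply (Scheme.ΓSpecIso (.of (PS2 k))) z
  exact congrArg (germT (V := ⊤) trivial) (h2 _)

lemma resTop_bijective {V : (FormalT k).Opens} (hV : ⊤ ≤ V) : Function.Bijective (resTop (k := k) hV) := by
  obtain rfl := top_le_iff.mp hV
  have h1 : (FormalT k).presheaf.map (homOfLE hV).op = 𝟙 _ := (FormalT k).presheaf.map_id _
  have : IsIso ((FormalT k).presheaf.map (homOfLE hV).op ≫ (Scheme.ΓSpecIso (.of (PS2 k))).hom) := by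
    rw [h1]; infer_instance
  exact ConcreteCategory.bijective_of_isIso ((FormalT k).presheaf.map (homOfLE hV).op ≫ (Scheme.ΓSpecIso (.of (PS2 k))).hom)

lemma FormalT.mem_idealSheaf_iff (I : Ideal (PS2 k)) {V : (FormalT k).affineOpens} (hV : ⊤ ≤ V.1) (a : Γ(FormalT k, V)) :
    a ∈ (FormalT.idealSheaf I).ideal V ↔ resTop hV a ∈ I := by
  obtain ⟨V, hVa⟩ := V
  obtain rfl := top_le_iff.mp hV
  rw [FormalT.idealSheaf, Scheme.Hom.ker_apply, RingHom.mem_ker, FormalT.sub]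
  have h1 := congr($(Scheme.ΓSpecIso_naturality (CommRingCat.ofHom (Ideal.Quotient.mk I))) a)
  have h2 : resTop hV a = (Scheme.ΓSpecIso (.of (PS2 k))).hom a := by
    have h1 : (FormalT k).presheaf.map (homOfLE hV).op = 𝟙 _ :=
      (FormalT k).presheaf.map_id _
    unfold resTop
    rw [h1]
    rfl
  rw [← Ideal.Quotient.eq_zero_iff_mem, h2]
  refine Iff.trans ?_ (iff_of_eq (congrArg (· = 0) h1))
  exact (map_eq_zero_iff (Scheme.ΓSpecIso (.of (PS2 k ⧸ I))).hom.hom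
    (ConcreteCategory.bijective_of_isIso (Scheme.ΓSpecIso (.of (PS2 k ⧸ I))).hom).1).symm

lemma FormalT.mem_basicOpen_iff {V : (FormalT k).Opens} (hV : ⊤ ≤ V) (a : Γ(FormalT k, V)) (x : FormalT k) :
    x ∈ (FormalT k).basicOpen a ↔ resTop hV a ∉ PrimeSpectrum.asIdeal x := by
  obtain rfl := top_le_iff.mp hV
  have h2 : resTop hV a = (Scheme.ΓSpecIso (.of (PS2 k))).hom a := by
    have h1 : (FormalT k).presheaf.map (homOfLE hV).op = 𝟙 _ :=
      (FormalT k).presheaf.map_id _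
    unfold resTop
    rw [h1]
    rfl
  rw [h2, basicOpen_eq_of_affine']
  rfl

lemma FormalT.closedPoint_mem_basicOpen_iff {V : (FormalT k).Opens} (hV : ⊤ ≤ V) (a : Γ(FormalT k, V)) :
    IsLocalRing.closedPoint (PS2 k) ∈ (FormalT k).basicOpen a ↔ IsUnit (resTop hV a) := by
  refine (FormalT.mem_basicOpen_iff hV a (IsLocalRing.closedPoint (PS2 k))).trans ?_
  change resTop hV a ∉ IsLocalRing.maximalIdeal (PS2 k) ↔ _
  rw [IsLocalRing.mem_maximalIdeal, mem_nonunits_iff, not_not]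

section

variable {X : Scheme.{u}} (j : FormalT k ⟶ X)

lemma preimage_eq_top {U : X.Opens} (hU : basePoint j ∈ U) : ⊤ ≤ j ⁻¹ᵁ U :=
  FormalT.eq_top_of_closedPoint_mem hU

/-- Sections of `𝒪_X` near the image of the closed point of `T`, as power series. -/
def toPS2 {U : X.Opens} (hU : basePoint j ∈ U) : Γ(X, U) →+* PS2 k :=
  (resTop (preimage_eq_top j hU)).comp (j.app U).hom

lemma genPt_mem_of_basePoint_mem {U : X.Opens} (hU : basePoint j ∈ U) : genPt j ∈ U :=
  preimage_eq_top j hU trivial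

lemma algebraMap_toPS2 {U : X.Opens} (hU : basePoint j ∈ U) (b : Γ(X, U)) :
    algebraMap (PS2 k) (FunT k) (toPS2 j hU b) = pullL j (genPt_mem_of_basePoint_mem j hU) b :=
  algebraMap_resTop _ _

lemma basePoint_mem_basicOpen_iff {U : X.Opens} (hU : basePoint j ∈ U) (b : Γ(X, U)) :
    basePoint j ∈ X.basicOpen b ↔ IsUnit (toPS2 j hU b) := by
  rw [toPS2, RingHom.comp_apply, ← FormalT.closedPoint_mem_basicOpen_iff, ← Scheme.preimage_basicOpen]
  rfl

lemma mem_curveIdeal_iff [QuasiCompact j] {U : X.affineOpens} (hU : basePoint j ∈ U.1) (b : Γ(X, U)) :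
    b ∈ (curveIdeal j).ideal U ↔ PS2.t k ∣ toPS2 j hU b := by
  have hV := preimage_eq_top j hU
  have ha : IsAffineOpen (j ⁻¹ᵁ U.1) := by
    rw [top_le_iff.mp hV]; exact isAffineOpen_top _
  have h1 := FormalT.mem_idealSheaf_iff (Ideal.span {PS2.t k}) (V := ⟨j ⁻¹ᵁ U.1, ha⟩) hV (j.app U.1 b)
  rw [Ideal.mem_span_singleton] at h1
  refine Iff.trans ?_ h1
  rw [curveIdeal, FormalT.idealSheaf, Scheme.Hom.ker_apply, Scheme.Hom.ker_apply, Scheme.Hom.comp_app]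
  rfl

end

section
open MvPolynomial

instance PSpace.finiteType (N : ℕ) : Algebra.FiniteType (homogeneousSubmodule (Fin (N + 1)) k 0) (MvPolynomial (Fin (N + 1)) k) :=
  have : IsScalarTower k (homogeneousSubmodule (Fin (N + 1)) k 0) (MvPolynomial (Fin (N + 1)) k) :=
    ⟨fun a b c => smul_mul_assoc a (b : MvPolynomial (Fin (N + 1)) k) c⟩
  .of_restrictScalars_finiteType k _ _

instance (N : ℕ) : LocallyOfFiniteType (PSpace.toSpec k N) := by
  have : LocallyOfFiniteType (Spec.map (CommRingCat.ofHom
      (algebraMap k (MvPolynomial.homogeneousSubmodule (Fin (N + 1)) k 0)))) := by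
    rw [HasRingHomProperty.Spec_iff (P := @LocallyOfFiniteType)]
    apply RingHom.FiniteType.of_surjective
    rintro ⟨f, hf⟩
    rw [homogeneousSubmodule_zero] at hf
    obtain ⟨c, hc⟩ := Submodule.mem_one.mp hf
    exact ⟨c, Subtype.ext hc⟩
  rw [PSpace.toSpec]
  infer_instance

end

namespace GeometricDatum

variable (G : GeometricDatum k)

instance : G.X.IsSeparated := by
  obtain ⟨N, i, hi, -⟩ := G.projective
  refine ⟨?_⟩
  rw [← Limits.terminal.comp_from i]
  infer_instance

instance : IsLocallyNoetherian G.X := by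
  obtain ⟨N, i, hi, hs⟩ := G.projective
  have : LocallyOfFiniteType G.str := by
    rw [← hs]
    infer_instance
  refine ⟨fun U => ?_⟩
  have h1 := LocallyOfFiniteType.finiteType_appLE G.str (isAffineOpen_top (Spec (.of k))) U.2 le_top
  have : IsNoetherianRing Γ(Spec (.of k), ⊤) := inferInstance
  algebraize [(G.str.appLE ⊤ U.1 le_top).hom]
  exact Algebra.FiniteType.isNoetherianRing Γ(Spec (.of k), ⊤) _

end GeometricDatum

end

/-! ### The local ring at P and the prime ideal of C in it. -/

section

variable {k : Type u} [Field k]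

section
variable {X : Scheme.{u}} (j : FormalT k ⟶ X)

/-- The local ring at the image of the closed point, mapped to the rational functions on `T`. -/
def stalkL : X.presheaf.stalk (basePoint j) →+* FunT k :=
  ((X.presheaf.stalkSpecializes ((genericPoint_specializes (IsLocalRing.closedPoint (PS2 k))).map j.continuous)) ≫
    j.stalkMap (genericPoint (FormalT k))).hom

lemma stalkL_germ {U : X.Opens} (hU : basePoint j ∈ U) (b : Γ(X, U)) :
    stalkL j (X.presheaf.germ U _ hU b) = pullL j (genPt_mem_of_basePoint_mem j hU) b := by
  have h1 := congr($(X.presheaf.germ_stalkSpecializes hU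
    ((genericPoint_specializes (IsLocalRing.closedPoint (PS2 k))).map j.continuous)) b)
  refine (congrArg (j.stalkMap (genericPoint (FormalT k))) h1).trans ?_
  exact Scheme.Hom.germ_stalkMap_apply j U _ _ b

lemma exists_stalkL_eq (z : X.presheaf.stalk (basePoint j)) :
    ∃ a : PS2 k, algebraMap (PS2 k) (FunT k) a = stalkL j z := by
  obtain ⟨U, hU, b, rfl⟩ := X.presheaf.exists_germ_eq z
  exact ⟨toPS2 j hU b, by rw [algebraMap_toPS2, stalkL_germ]⟩

/-- The map `𝒪_{X, P} → R`. -/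
def stalkR : X.presheaf.stalk (basePoint j) →+* PS2 k where
  toFun z := (exists_stalkL_eq j z).choose
  map_one' := by
    apply IsFractionRing.injective (PS2 k) (FunT k)
    rw [(exists_stalkL_eq j 1).choose_spec, map_one, map_one]
  map_zero' := by
    apply IsFractionRing.injective (PS2 k) (FunT k)
    rw [(exists_stalkL_eq j 0).choose_spec, map_zero, map_zero]
  map_mul' x y := by
    apply IsFractionRing.injective (PS2 k) (FunT k)
    rw [(exists_stalkL_eq j _).choose_spec, map_mul, map_mul, (exists_stalkL_eq j x).choose_spec,
      (exists_stalkL_eq j y).choose_spec]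
  map_add' x y := by
    apply IsFractionRing.injective (PS2 k) (FunT k)
    rw [(exists_stalkL_eq j _).choose_spec, map_add, map_add, (exists_stalkL_eq j x).choose_spec,
      (exists_stalkL_eq j y).choose_spec]

lemma algebraMap_stalkR (z : X.presheaf.stalk (basePoint j)) :
    algebraMap (PS2 k) (FunT k) (stalkR j z) = stalkL j z := (exists_stalkL_eq j z).choose_spec

lemma stalkR_germ {U : X.Opens} (hU : basePoint j ∈ U) (b : Γ(X, U)) :
    stalkR j (X.presheaf.germ U _ hU b) = toPS2 j hU b := by
  apply IsFractionRing.injective (PS2 k) (FunT k)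
  rw [algebraMap_stalkR, stalkL_germ, algebraMap_toPS2]

instance : IsLocalHom (stalkR j) := by
  refine ⟨fun z hz => ?_⟩
  obtain ⟨U, hU, b, rfl⟩ := X.presheaf.exists_germ_eq z
  rw [stalkR_germ, ← basePoint_mem_basicOpen_iff] at hz
  exact (X.mem_basicOpen b _ hU).mp hz

lemma toPS2_map {U V : X.Opens} (hU : basePoint j ∈ U) (hUV : U ≤ V) (b : Γ(X, V)) :
    toPS2 j hU (X.presheaf.map (homOfLE hUV).op b) = toPS2 j (hUV hU) b := by
  apply IsFractionRing.injective (PS2 k) (FunT k)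
  rw [algebraMap_toPS2, algebraMap_toPS2, pullL_map]

lemma exists_germ_mul_eq {U : X.Opens} (hUa : IsAffineOpen U) {x : X} (hU : x ∈ U) (z : X.presheaf.stalk x) :
    ∃ a s : Γ(X, U), x ∈ X.basicOpen s ∧ z * X.presheaf.germ U _ hU s = X.presheaf.germ U _ hU a := by
  let := X.presheaf.algebra_section_stalk ⟨x, hU⟩
  have := hUa.isLocalization_stalk ⟨x, hU⟩
  obtain ⟨⟨a, s⟩, h⟩ := IsLocalization.surj (hUa.primeIdealOf ⟨x, hU⟩).asIdeal.primeCompl z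
  exact ⟨a, s, (X.mem_basicOpen _ _ hU).mpr (IsLocalization.map_units (X.presheaf.stalk x) s), h⟩

lemma basePoint_mem_support [QuasiCompact j] : basePoint j ∈ (curveIdeal j).support := by
  obtain ⟨U, hUa, hU, -⟩ := exists_isAffineOpen_mem_and_subset (x := basePoint j) (U := ⊤) trivial
  rw [Scheme.IdealSheafData.mem_support_iff_of_mem (U := ⟨U, hUa⟩) hU, Scheme.mem_zeroLocus_iff]
  intro b hb
  rw [basePoint_mem_basicOpen_iff j hU]
  rw [SetLike.mem_coe, mem_curveIdeal_iff j hU] at hb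
  intro h
  exact PS2.t_prime.not_isUnit (isUnit_of_dvd_unit hb h)

/-- The ideal of the curve `C` in the local ring at `P`. -/
def curvePrime : Ideal (X.presheaf.stalk (basePoint j)) := (Ideal.span {PS2.t k}).comap (stalkR j)

lemma mem_curvePrime {z : X.presheaf.stalk (basePoint j)} : z ∈ curvePrime j ↔ PS2.t k ∣ stalkR j z := by
  rw [curvePrime, Ideal.mem_comap, Ideal.mem_span_singleton]

instance : (curvePrime j).IsPrime := by
  have : (Ideal.span {PS2.t k}).IsPrime := (Ideal.span_singleton_prime PS2.t_ne_zero).mpr PS2.t_prime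
  exact Ideal.IsPrime.comap _

end
section
variable {X : Scheme.{u}} {j : FormalT k ⟶ X}

/-- The closed immersion of the curve induces a surjection of local rings, whose kernel consists of
equations of the curve. -/
lemma exists_maximalIdeal_eq_sup [QuasiCompact j] (c : (curveIdeal j).subscheme) (hc : (curveIdeal j).subschemeι c = basePoint j)
    {y : (curveIdeal j).subscheme.presheaf.stalk c} (hy : IsLocalRing.maximalIdeal _ = Ideal.span {y}) :
    ∃ h, IsLocalRing.maximalIdeal (X.presheaf.stalk (basePoint j)) = curvePrime j ⊔ Ideal.span {h} := by
  let i := (curveIdeal j).subschemeι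
  have hsp : i c ⤳ basePoint j := by rw [hc]
  let σ : X.presheaf.stalk (basePoint j) →+* (curveIdeal j).subscheme.presheaf.stalk c :=
    (X.presheaf.stalkSpecializes hsp ≫ i.stalkMap c).hom
  have hmem {U : X.Opens} (hU : basePoint j ∈ U) : i c ∈ U := by rw [hc]; exact hU
  have hσ {U : X.Opens} (hU : basePoint j ∈ U) (b : Γ(X, U)) : σ (X.presheaf.germ U _ hU b) =
      (curveIdeal j).subscheme.presheaf.germ (i ⁻¹ᵁ U) c (hmem hU) (i.app U b) := by
    refine (congrArg (i.stalkMap c) congr($(X.presheaf.germ_stalkSpecializes hU hsp) b)).trans ?_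
    exact Scheme.Hom.germ_stalkMap_apply i U c _ b
  have hσs : Function.Surjective σ := by
    intro z
    obtain ⟨w, rfl⟩ := i.stalkMap_surjective c z
    obtain ⟨U, hU, b, rfl⟩ := X.presheaf.exists_germ_eq w
    have hU' : basePoint j ∈ U := by rw [← hc]; exact hU
    refine ⟨X.presheaf.germ U _ hU' b, ?_⟩
    rw [hσ]
    exact (Scheme.Hom.germ_stalkMap_apply i U c _ b).symm
  have hσl : IsLocalHom σ := by
    refine ⟨fun z hz => ?_⟩
    obtain ⟨U, hU, b, rfl⟩ := X.presheaf.exists_germ_eq z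
    rw [hσ] at hz
    have hz := ((curveIdeal j).subscheme.mem_basicOpen (i.app U b) c (hmem hU)).mpr hz
    rw [← Scheme.preimage_basicOpen] at hz
    refine (X.mem_basicOpen b _ hU).mp ?_
    have : i c ∈ X.basicOpen b := hz
    rwa [hc] at this
  -- A germ vanishing in the local ring of C vanishes on the trace on C of an affine neighbourhood
  -- of P, and there it belongs to the curve ideal.
  have hσk (z) (hz : σ z = 0) : z ∈ curvePrime j := by
    obtain ⟨U, hU, b, rfl⟩ := X.presheaf.exists_germ_eq z
    rw [hσ, ← map_zero ((curveIdeal j).subscheme.presheaf.germ (i ⁻¹ᵁ U) c (hmem hU)).hom] at hz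
    obtain ⟨W, hcW, iW, iW', hW⟩ := TopCat.Presheaf.germ_eq _ _ _ _ _ _ hz
    obtain ⟨W', hW', hWW'⟩ := i.isEmbedding.isInducing.isOpen_iff.mp W.2
    have hcW' : i c ∈ W' := by
      have : c ∈ i ⁻¹' W' := by rw [hWW']; exact hcW
      exact this
    rw [hc] at hcW'
    obtain ⟨V, hVa, hV, hVle⟩ := exists_isAffineOpen_mem_and_subset (x := basePoint j) (U := ⟨W', hW'⟩ ⊓ U) ⟨hcW', hU⟩
    have hVU : V ≤ U := fun x hx => (hVle hx).2
    have hVW : i ⁻¹ᵁ V ≤ W := fun x hx => hWW'.le (show x ∈ i ⁻¹' W' from (hVle hx).1)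
    have h1 : i.app V (X.presheaf.map (homOfLE hVU).op b) = 0 := by
      refine congr($(i.naturality (homOfLE hVU).op) b).trans ?_
      have h2 := congrArg ((curveIdeal j).subscheme.presheaf.map (homOfLE hVW).op) hW
      rw [map_zero, map_zero] at h2
      refine Eq.trans ?_ h2
      exact congrArg (fun φ => φ.hom (i.app U b)) ((curveIdeal j).subscheme.presheaf.map_comp iW.op (homOfLE hVW).op)
    have h2 : X.presheaf.map (homOfLE hVU).op b ∈ (curveIdeal j).ideal ⟨V, hVa⟩ := by
      have := (curveIdeal j).ker_subschemeι
      rw [← this, Scheme.Hom.ker_apply]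
      exact h1
    rw [mem_curveIdeal_iff j hV, toPS2_map] at h2
    rwa [mem_curvePrime, stalkR_germ]
  obtain ⟨h, rfl⟩ := hσs y
  have hhm : h ∈ IsLocalRing.maximalIdeal (X.presheaf.stalk (basePoint j)) := by
    have h1 : σ h ∈ IsLocalRing.maximalIdeal _ := by rw [hy]; exact Ideal.mem_span_singleton_self _
    exact fun hu => h1 (hu.map σ)
  refine ⟨h, le_antisymm ?_ (sup_le (IsLocalRing.le_maximalIdeal (Ideal.IsPrime.ne_top inferInstance))
    (by simpa [Ideal.span_le] using hhm))⟩
  intro x hx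
  have h1 : σ x ∈ IsLocalRing.maximalIdeal _ := fun hu => hx (isUnit_of_map_unit σ x hu)
  rw [hy] at h1
  obtain ⟨w, hw⟩ := Ideal.mem_span_singleton'.mp h1
  obtain ⟨w, rfl⟩ := hσs w
  refine Submodule.mem_sup.mpr ⟨x - w * h, hσk _ ?_, w * h, Ideal.mul_mem_left _ _ (Ideal.mem_span_singleton_self h), by ring⟩
  rw [map_sub, map_mul, hw, sub_self]

end

end

/-! ### Local equations of C at P. -/

section

variable {k : Type u} [Field k]

section
variable {X : Scheme.{u}} {j : FormalT k ⟶ X}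

/-- If the equations of `C` at `P` are all functions vanishing at `P`, then `C = {P}`. -/
lemma curveIdeal_eq_vanishingIdeal [QuasiCompact j]
    (h : curvePrime j = IsLocalRing.maximalIdeal _) :
    curveIdeal j = Scheme.IdealSheafData.vanishingIdeal (TopologicalSpace.Closeds.closure {basePoint j}) := by
  have : (Ideal.span {PS2.t k}).IsPrime := (Ideal.span_singleton_prime PS2.t_ne_zero).mpr PS2.t_prime
  have hdom : IsDomain (PS2 k ⧸ Ideal.span {PS2.t k}) := inferInstance
  have hint : IsIntegral (Spec (.of (PS2 k ⧸ Ideal.span {PS2.t k}))) := inferInstance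
  let f := FormalT.sub (Ideal.span {PS2.t k}) ≫ j
  obtain ⟨U, hUa, hU, -⟩ := exists_isAffineOpen_mem_and_subset (x := basePoint j) (U := ⊤) trivial
  have hf (x) : f x = basePoint j := by
    let y : FormalT k := FormalT.sub (Ideal.span {PS2.t k}) x
    have hy : PS2.t k ∈ PrimeSpectrum.asIdeal y := by
      change Ideal.Quotient.mk (Ideal.span {PS2.t k}) (PS2.t k) ∈ PrimeSpectrum.asIdeal x
      rw [Ideal.Quotient.eq_zero_iff_mem.mpr (Ideal.mem_span_singleton_self _)]
      exact zero_mem _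
    have h1 : j y ⤳ basePoint j := (IsLocalRing.specializes_closedPoint y).map j.continuous
    have hyU : j y ∈ U := h1.mem_open U.2 hU
    -- A function nonzero at j(y) but zero at P would have its germ in the curve prime, so its
    -- pullback would be divisible by t and vanish at y. Thus all points of T₁ map to P.
    have h2 : basePoint j ⤳ j y := by
      rw [specializes_iff_forall_open]
      intro W hW hyW
      obtain ⟨b, hb, hyb⟩ := hUa.exists_basicOpen_le (V := ⟨W, hW⟩) ⟨j y, hyW⟩ hyU
      refine hb ?_
      rw [basePoint_mem_basicOpen_iff j hU, ← stalkR_germ]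
      by_contra hc
      have h3 : X.presheaf.germ U _ hU b ∈ curvePrime j := by
        rw [h]
        exact fun hu => hc (hu.map _)
      rw [mem_curvePrime, stalkR_germ] at h3
      have h4 : y ∈ (FormalT k).basicOpen (j.app U b) := by
        rw [← Scheme.preimage_basicOpen]; exact hyb
      rw [FormalT.mem_basicOpen_iff (preimage_eq_top j hU)] at h4
      exact h4 (Ideal.mem_of_dvd _ h3 hy)
    exact (h1.antisymm h2).eq
  -- T₁ is reduced, so its scheme-theoretic image is determined by its set of points.
  have h1 : (⊥ : Scheme.IdealSheafData _) = Scheme.IdealSheafData.vanishingIdeal (X := Spec (.of (PS2 k ⧸ Ideal.span {PS2.t k}))) ⊤ := by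
    rw [Scheme.IdealSheafData.vanishingIdeal_top, Scheme.nilradical_eq_bot]
  have h2 : f.ker = Scheme.IdealSheafData.vanishingIdeal (TopologicalSpace.Closeds.closure {basePoint j}) := by
    rw [← Scheme.IdealSheafData.map_bot, h1, Scheme.IdealSheafData.map_vanishingIdeal]
    congr 2
    ext x
    constructor
    · rintro ⟨y, -, rfl⟩
      exact hf y
    · rintro rfl
      obtain ⟨y⟩ : Nonempty (Spec (.of (PS2 k ⧸ Ideal.span {PS2.t k}))) := inferInstance
      exact ⟨y, trivial, hf y⟩
  exact h2

end

namespace GeometricDatum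

variable (G : GeometricDatum k)

lemma map_toPS2_curveIdeal {U : G.X.affineOpens} (hU : basePoint G.j ∈ U.1) :
    ((curveIdeal G.j).ideal U).map (toPS2 G.j hU) = Ideal.span {PS2.t k ^ G.rank} := by
  have hV := preimage_eq_top G.j hU
  have ha : IsAffineOpen (G.j ⁻¹ᵁ U.1) := by
    rw [top_le_iff.mp hV]; exact isAffineOpen_top _
  have h1 := Scheme.IdealSheafData.ideal_comap (curveIdeal G.j) G.j U ha
  rw [G.fiber_C] at h1
  have hb := resTop_bijective hV
  rw [toPS2, ← Ideal.map_map, ← h1]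
  apply le_antisymm
  · rw [Ideal.map_le_iff_le_comap]
    intro a haI
    exact (FormalT.mem_idealSheaf_iff (Ideal.span {PS2.t k ^ G.rank}) (V := ⟨G.j ⁻¹ᵁ U.1, ha⟩) hV a).mp haI
  · rw [Ideal.span_singleton_le_iff_mem]
    obtain ⟨a, haI⟩ := hb.2 (PS2.t k ^ G.rank)
    have h2 : a ∈ (FormalT.idealSheaf (Ideal.span {PS2.t k ^ G.rank})).ideal ⟨G.j ⁻¹ᵁ U.1, ha⟩ := by
      rw [FormalT.mem_idealSheaf_iff _ hV, haI]
      exact Ideal.mem_span_singleton_self _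
    have h3 := Ideal.mem_map_of_mem (resTop hV) h2
    rwa [haI] at h3

/-- For r = 0 the ideal of C would generate the unit ideal of R, but its pullback is contained in
(t). -/
lemma rank_pos : 0 < G.rank := by
  obtain ⟨U, hUa, hU, -⟩ := exists_isAffineOpen_mem_and_subset (x := basePoint G.j) (U := ⊤) trivial
  by_contra h
  have h1 := G.map_toPS2_curveIdeal (U := ⟨U, hUa⟩) hU
  rw [Nat.eq_zero_of_not_pos h, pow_zero, Ideal.span_singleton_one] at h1
  have h2 : ((curveIdeal G.j).ideal ⟨U, hUa⟩).map (toPS2 G.j hU) ≤ Ideal.span {PS2.t k} := by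
    rw [Ideal.map_le_iff_le_comap]
    intro b hb
    rw [mem_curveIdeal_iff G.j hU] at hb
    exact Ideal.mem_span_singleton.mpr hb
  rw [h1, top_le_iff, Ideal.span_singleton_eq_top] at h2
  exact PS2.t_prime.not_isUnit h2

/-- Equality would make C the reduced subscheme on the closure of P. The two conditions on fibres
would then say (t^r) + (t) = (u, t), which is false since r > 0. -/
lemma curvePrime_ne_maximalIdeal : curvePrime G.j ≠ IsLocalRing.maximalIdeal _ := by
  intro h
  have h1 := G.fiber_P
  rw [← curveIdeal_eq_vanishingIdeal h, G.fiber_C] at h1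
  have h2 : Ideal.span {PS2.t k ^ G.rank} ⊔ Ideal.span {PS2.t k} = PS2.maxIdeal k := by
    have h3 := congrArg (fun D => Scheme.IdealSheafData.ideal D ⟨⊤, isAffineOpen_top _⟩) h1
    have hb := resTop_bijective (k := k) (le_refl ⊤)
    have h4 (I : Ideal (PS2 k)) : (FormalT.idealSheaf I).ideal ⟨⊤, isAffineOpen_top _⟩ = I.comap (resTop (le_refl ⊤)) :=
      Ideal.ext fun a => FormalT.mem_idealSheaf_iff I (V := ⟨⊤, isAffineOpen_top _⟩) le_rfl a
    simp only [Scheme.IdealSheafData.ideal_sup, Pi.sup_apply, h4] at h3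
    have h5 := congrArg (Ideal.map (resTop (le_refl ⊤))) h3
    rwa [Ideal.map_sup, Ideal.map_comap_of_surjective _ hb.2, Ideal.map_comap_of_surjective _ hb.2,
      Ideal.map_comap_of_surjective _ hb.2] at h5
  have h6 : PS2.u k ∈ Ideal.span {PS2.t k} := by
    have : Ideal.span {PS2.t k ^ G.rank} ≤ Ideal.span {PS2.t k} := by
      rw [Ideal.span_singleton_le_span_singleton]
      exact dvd_pow_self _ G.rank_pos.ne'
    rw [sup_eq_right.mpr this] at h2
    rw [h2]
    exact Ideal.subset_span (by simp)
  rw [Ideal.mem_span_singleton, PS2.t_dvd_iff] at h6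
  have := h6 1
  rw [PS2.u, MvPowerSeries.coeff_index_single_self_X] at this
  exact one_ne_zero this

/-- Local equations of the curve `C` at the point `P`. -/
theorem exists_generators : ∃ (U : G.X.affineOpens) (hU : basePoint G.j ∈ U.1) (g : Γ(G.X, U)) (h : G.X.presheaf.stalk (basePoint G.j)),
    (curveIdeal G.j).ideal U = Ideal.span {g} ∧
      IsLocalRing.maximalIdeal _ = Ideal.span {G.X.presheaf.germ U.1 _ hU g, h} := by
  obtain ⟨c, hc⟩ : basePoint G.j ∈ Set.range (curveIdeal G.j).subschemeι := by
    rw [Scheme.IdealSheafData.range_subschemeι]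
    exact basePoint_mem_support G.j
  have hreg := G.regular_C c hc
  -- Regularity turns the dimension bounds for C and X into bounds of one and two on the number of
  -- generators of the maximal ideals.
  have h1 : (IsLocalRing.maximalIdeal ((curveIdeal G.j).subscheme.presheaf.stalk c)).spanFinrank ≤ 1 := by
    have h2 := (isRegularLocalRing_iff _).mp hreg
    have h3 := Scheme.coheight_le_topologicalKrullDim c
    rw [G.dim_curve, ← ringKrullDim_stalk_eq_coheight, ← h2] at h3
    exact_mod_cast h3
  obtain ⟨y, hy⟩ := Submodule.exists_eq_span_singleton (IsNoetherian.noetherian (IsLocalRing.maximalIdeal ((curveIdeal G.j).subscheme.presheaf.stalk c))) h1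
  obtain ⟨h, hh⟩ := exists_maximalIdeal_eq_sup c hc hy
  have h2 : (IsLocalRing.maximalIdeal (G.X.presheaf.stalk (basePoint G.j))).spanFinrank ≤ 2 := by
    have h2 := (isRegularLocalRing_iff _).mp G.regular_X
    have h3 := Scheme.coheight_le_topologicalKrullDim (basePoint G.j)
    rw [G.dim_eq_two, ← ringKrullDim_stalk_eq_coheight, ← h2] at h3
    exact_mod_cast h3
  obtain ⟨g, hg, hm⟩ := IsLocalRing.exists_eq_span_singleton G.curvePrime_ne_maximalIdeal h2 hh
  obtain ⟨V, hV, b, hb⟩ := G.X.presheaf.exists_germ_eq g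
  obtain ⟨W, hWa, hW, hWV⟩ := exists_isAffineOpen_mem_and_subset hV
  let b' := G.X.presheaf.map (homOfLE hWV).op b
  have hb' : G.X.presheaf.germ W _ hW b' = g := by
    rw [← hb]
    exact TopCat.Presheaf.germ_res_apply _ _ _ hW b
  have hinj : Function.Injective (G.X.presheaf.germ W _ hW) := germ_injective_of_isIntegral _ _ _
  -- Each equation of C becomes a multiple of b' after multiplication by a function nonvanishing at
  -- P. By noetherianity finitely many equations suffice, so one such function s serves for all, and
  -- b' generates the ideal where s is nonzero.
  have hone (z) (hz : z ∈ (curveIdeal G.j).ideal ⟨W, hWa⟩) : ∃ s : Γ(G.X, W), basePoint G.j ∈ G.X.basicOpen s ∧ b' ∣ s * z := by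
    have h3 : G.X.presheaf.germ W _ hW z ∈ curvePrime G.j := by
      rw [mem_curveIdeal_iff G.j hW] at hz
      rwa [mem_curvePrime, stalkR_germ]
    rw [hg, ← hb', Ideal.mem_span_singleton] at h3
    obtain ⟨α, hα⟩ := h3
    obtain ⟨a, s, hs, has⟩ := exists_germ_mul_eq hWa hW α
    refine ⟨s, hs, a, hinj ?_⟩
    rw [map_mul, map_mul, hα, ← has]
    ring
  have hfin (S : Finset Γ(G.X, W)) (hS : ∀ z ∈ S, z ∈ (curveIdeal G.j).ideal ⟨W, hWa⟩) : ∃ s : Γ(G.X, W), basePoint G.j ∈ G.X.basicOpen s ∧ ∀ z ∈ S, b' ∣ s * z := by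
    classical
    induction S using Finset.induction_on with
    | empty => exact ⟨1, by rw [Scheme.basicOpen_of_isUnit _ isUnit_one]; exact hW, by simp⟩
    | insert z S hzS ih =>
      obtain ⟨s, hs, hsS⟩ := ih fun z hz => hS z (Finset.mem_insert_of_mem hz)
      obtain ⟨s', hs', hsz⟩ := hone z (hS z (Finset.mem_insert_self _ _))
      refine ⟨s * s', by rw [Scheme.basicOpen_mul]; exact ⟨hs, hs'⟩, fun w hw => ?_⟩
      rcases Finset.mem_insert.mp hw with rfl | hw
      · rw [mul_assoc]; exact hsz.mul_left _
      · rw [mul_comm s, mul_assoc]; exact (hsS w hw).mul_left _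
  have hnoeth : IsNoetherianRing Γ(G.X, W) := IsLocallyNoetherian.component_noetherian ⟨W, hWa⟩
  obtain ⟨S, hS⟩ := IsNoetherian.noetherian ((curveIdeal G.j).ideal ⟨W, hWa⟩)
  obtain ⟨s, hs, hsS⟩ := hfin S fun z hz => by rw [← hS]; exact Submodule.subset_span hz
  let U := G.X.affineBasicOpen (U := ⟨W, hWa⟩) s
  have hUW : U.1 ≤ W := G.X.basicOpen_le s
  have h5 := toPS2_map G.j (U := U.1) hs hUW b'
  refine ⟨U, hs, G.X.presheaf.map (homOfLE hUW).op b', h, ?_, ?_⟩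
  · have h4 := (curveIdeal G.j).map_ideal (U := U) (V := ⟨W, hWa⟩) hUW
    apply le_antisymm
    · rw [← h4, ← hS, Ideal.map_le_iff_le_comap]
      refine Submodule.span_le.mpr fun z hz => ?_
      have hsu : IsUnit (G.X.presheaf.map (homOfLE hUW).op s) := RingedSpace.isUnit_res_basicOpen _ s
      rw [SetLike.mem_coe, Ideal.mem_comap, ← Ideal.unit_mul_mem_iff_mem _ hsu, Ideal.mem_span_singleton]
      have := map_dvd (G.X.presheaf.map (homOfLE hUW).op).hom (hsS z hz)
      rw [map_mul] at this
      exact this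
    · rw [Ideal.span_singleton_le_iff_mem, mem_curveIdeal_iff (U := U) G.j hs, h5, ← stalkR_germ, hb', ← mem_curvePrime, hg]
      exact Ideal.mem_span_singleton_self _
  · rw [hm, ← hb']
    congr 2
    exact (TopCat.Presheaf.germ_res_apply _ _ _ hs b').symm

end GeometricDatum

end

/-! ### Divisors with cycle d C: local equations are units times d-th powers. -/

section

open IsLocalRing

/-- In a regular local ring of dimension one, the length of `A / f` is the order of `f`. -/
lemma IsLocalRing.eq_unit_mul_pow_of_length {A : Type*} [CommRing A] [IsDomain A] [IsLocalRing A] [IsNoetherianRing A] {π : A}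
    (hπ : maximalIdeal A = Ideal.span {π}) (h0 : π ≠ 0) {f : A} (hf : f ≠ 0) {d : ℕ}
    (hd : Module.length A (A ⧸ Ideal.span {f}) = d) : ∃ w : A, IsUnit w ∧ f = w * π ^ d := by
  have hnf : ¬ IsField A := by
    rw [IsLocalRing.isField_iff_maximalIdeal_eq, hπ, Ideal.span_singleton_eq_bot]
    exact h0
  have hdvr : IsDiscreteValuationRing A :=
    ((IsDiscreteValuationRing.TFAE A hnf).out 0 4).mpr (by rw [hπ]; exact ⟨⟨π, rfl⟩⟩)
  have hirr : Irreducible π := (IsDiscreteValuationRing.irreducible_iff_uniformizer π).mpr hπ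
  obtain ⟨n, w, rfl⟩ := IsDiscreteValuationRing.eq_unit_mul_pow_irreducible hf hirr
  have h1 : Ring.ord A (↑w * π ^ n) = n := by
    rw [Ring.ord_mul_of_isUnit_left w.isUnit, Ring.ord_pow (mem_nonZeroDivisors_of_ne_zero h0),
      Ring.ord_of_irreducible hirr, nsmul_one]
  have h2 : (n : ℕ∞) = d := h1.symm.trans hd
  exact ⟨w, w.isUnit, by rw [Nat.cast_inj.mp h2]⟩

lemma ringKrullDim_eq_one_of_maximalIdeal {A : Type*} [CommRing A] [IsDomain A] [IsLocalRing A] [IsNoetherianRing A] {π : A}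
    (hπ : maximalIdeal A = Ideal.span {π}) (h0 : π ≠ 0) : ringKrullDim A = 1 := by
  rw [← IsLocalRing.maximalIdeal_height_eq_ringKrullDim, hπ,
    Ideal.height_span_singleton_eq_one_of_mem_nonZeroDivisors (mem_nonZeroDivisors_of_ne_zero h0)]
  · rfl
  · have : π ∈ maximalIdeal A := by rw [hπ]; exact Ideal.mem_span_singleton_self π
    exact this

/-- A function on an affine open set which is a unit at all points of codimension one is a unit. -/
lemma isUnit_of_codim_one {X : Scheme.{u}} [IsIntegral X] [IsLocallyNoetherian X] (U : X.affineOpens) {v : Γ(X, U)}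
    (h0 : v ≠ 0) (h : ∀ z ∈ U.1, Order.coheight z = 1 → z ∈ X.basicOpen v) : IsUnit v := by
  by_contra hv
  have hnoeth : IsNoetherianRing Γ(X, U) := IsLocallyNoetherian.component_noetherian U
  have hne : Ideal.span {v} ≠ ⊤ := by rwa [Ne, Ideal.span_singleton_eq_top]
  -- By Krull's principal ideal theorem a minimal prime over a nonzero nonunit has height one. It is
  -- a point of codimension one where v vanishes, so no normality is required.
  obtain ⟨q, hq⟩ := Ideal.nonempty_minimalPrimes hne
  have hqp : q.IsPrime := hq.1.1
  have hvq : v ∈ q := hq.1.2 (Ideal.mem_span_singleton_self v)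
  have hht : q.height = 1 := by
    apply le_antisymm
    · exact Ideal.height_le_one_of_isPrincipal_of_mem_minimalPrimes (Ideal.span {v}) q hq
    · rw [Order.one_le_iff_ne_zero]
      intro h1
      have : Nonempty U.1 := by
        by_contra h2
        have : IsEmpty U.1 := not_nonempty_iff.mp h2
        have h3 : U.1 = ⊥ := by
          ext x; simp; exact fun hx => h2 ⟨x, hx⟩
        have : Subsingleton Γ(X, U) := by
          rw [h3]; infer_instance
        exact h0 (Subsingleton.elim _ _)
      have : IsDomain Γ(X, U) := inferInstance
      rw [Ideal.height_eq_zero_iff_eq_bot] at h1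
      rw [h1] at hvq
      exact h0 hvq
  have hU : IsAffineOpen U.1 := U.2
  let z := hU.fromSpec ⟨q, hqp⟩
  have hz : z ∈ U.1 := hU.range_fromSpec.le ⟨_, rfl⟩
  let := X.presheaf.algebra_section_stalk ⟨z, hz⟩
  have hloc : IsLocalization.AtPrime (X.presheaf.stalk z) q := hU.isLocalization_stalk' ⟨q, hqp⟩ hz
  have h1 : Order.coheight z = 1 := by
    have h2 := ringKrullDim_stalk_eq_coheight z
    rw [IsLocalization.AtPrime.ringKrullDim_eq_height q (X.presheaf.stalk z), hht] at h2
    exact_mod_cast h2.symm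
  have h3 := (X.mem_basicOpen v z hz).mp (h z hz h1)
  exact (IsLocalization.AtPrime.isUnit_to_map_iff (X.presheaf.stalk z) q v).mp h3 hvq

section
variable {k : Type u} [Field k] {X : Scheme.{u}} (j : FormalT k ⟶ X)

instance : IsIntegral (Spec (.of (PS2 k ⧸ Ideal.span {PS2.t k}))) := by
  have : (Ideal.span {PS2.t k}).IsPrime := (Ideal.span_singleton_prime PS2.t_ne_zero).mpr PS2.t_prime
  have hdom : IsDomain (PS2 k ⧸ Ideal.span {PS2.t k}) := inferInstance
  infer_instance

/-- The generic point of the curve `C`. -/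
def curvePt : X := (FormalT.sub (Ideal.span {PS2.t k}) ≫ j) (genericPoint _)

lemma mem_curveIdeal_iff_curvePt [QuasiCompact j] (U : X.affineOpens) (b : Γ(X, U)) :
    b ∈ (curveIdeal j).ideal U ↔ curvePt j ∉ X.basicOpen b := by
  rw [curveIdeal, Scheme.Hom.ker_apply, RingHom.mem_ker]
  set f := FormalT.sub (Ideal.span {PS2.t k}) ≫ j
  have h1 : (f.app U.1).hom b = 0 ↔ f ⁻¹ᵁ X.basicOpen b = ⊥ := by
    rw [Scheme.preimage_basicOpen]
    exact (basicOpen_eq_bot_iff _).symm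
  refine h1.trans ?_
  constructor
  · intro h hx
    have h2 : genericPoint _ ∈ f ⁻¹ᵁ X.basicOpen b := hx
    rw [h] at h2
    exact h2
  · intro h
    by_contra h2
    obtain ⟨x, hx⟩ := (TopologicalSpace.Opens.ne_bot_iff_nonempty _).mp h2
    exact h ((genericPoint_specializes x).mem_open (f ⁻¹ᵁ X.basicOpen b).2 hx)

lemma support_curveIdeal [QuasiCompact j] : ((curveIdeal j).support : Set X) = closure {curvePt j} := by
  rw [curveIdeal]
  set f := FormalT.sub (Ideal.span {PS2.t k}) ≫ j
  rw [f.support_ker]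
  apply subset_antisymm
  · refine closure_minimal ?_ isClosed_closure
    rintro _ ⟨x, rfl⟩
    exact ((genericPoint_specializes x).map f.continuous).mem_closed isClosed_closure (subset_closure rfl)
  · exact closure_mono (by rintro _ rfl; exact ⟨_, rfl⟩)

/-- If the divisor `D` has cycle `d C`, then its local equations are, up to units, `d`-th powers of
equations of `C`. -/
theorem HasCycle.eq_unit_mul_pow {j : FormalT k ⟶ X} [QuasiCompact j] [IsIntegral X] [IsLocallyNoetherian X]
    {D : X.IdealSheafData} {d : ℕ} (h : HasCycle D (curveIdeal j) d) {U : X.affineOpens}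
    {f g : Γ(X, U)} (hf : D.ideal U = Ideal.span {f}) (hg : (curveIdeal j).ideal U = Ideal.span {g})
    (hf0 : f ≠ 0) (hg0 : g ≠ 0) : ∃ v, IsUnit v ∧ f = v * g ^ d := by
  have hU : IsAffineOpen U.1 := U.2
  have hnoeth : IsNoetherianRing Γ(X, U) := IsLocallyNoetherian.component_noetherian U
  have hne : Nonempty U.1 := by
    by_contra h2
    have h3 : U.1 = ⊥ := by
      ext x; simp; exact fun hx => h2 ⟨x, hx⟩
    have : Subsingleton Γ(X, U) := by
      rw [h3]; infer_instance
    exact hf0 (Subsingleton.elim _ _)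
  have hdom : IsDomain Γ(X, U) := inferInstance
  obtain ⟨v, hv, hvη⟩ : ∃ v, f = v * g ^ d ∧ (curvePt j ∈ U.1 → curvePt j ∈ X.basicOpen v) := by
    by_cases hη : curvePt j ∈ U.1
    · let := X.presheaf.algebra_section_stalk ⟨curvePt j, hη⟩
      have hloc := hU.isLocalization_stalk ⟨curvePt j, hη⟩
      -- The prime of the generic point of C is (g), so the local ring there is a discrete valuation
      -- ring with uniformizer g, and the length in the cycle is the order of f.
      have hq : (hU.primeIdealOf ⟨curvePt j, hη⟩).asIdeal = Ideal.span {g} := by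
        rw [← hg]
        ext b
        rw [mem_curveIdeal_iff_curvePt, X.mem_basicOpen b _ hη]
        exact not_not.symm.trans (not_congr (IsLocalization.AtPrime.isUnit_to_map_iff
          (X.presheaf.stalk (curvePt j)) (hU.primeIdealOf ⟨curvePt j, hη⟩).asIdeal b).symm)
      have hgerm (b : Γ(X, U)) : algebraMap Γ(X, U) (X.presheaf.stalk (curvePt j)) b = X.presheaf.germ U.1 _ hη b := rfl
      have hinj : Function.Injective (X.presheaf.germ U.1 _ hη) := germ_injective_of_isIntegral _ _ _
      have hm : maximalIdeal (X.presheaf.stalk (curvePt j)) = Ideal.span {X.presheaf.germ U.1 _ hη g} := by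
        rw [← IsLocalization.AtPrime.map_eq_maximalIdeal (hU.primeIdealOf ⟨curvePt j, hη⟩).asIdeal
          (X.presheaf.stalk (curvePt j)), hq, Ideal.map_span, Set.image_singleton]
        rfl
      have hg0' : X.presheaf.germ U.1 _ hη g ≠ 0 := by
        rwa [Ne, map_eq_zero_iff _ hinj]
      have hf0' : X.presheaf.germ U.1 _ hη f ≠ 0 := by
        rwa [Ne, map_eq_zero_iff _ hinj]
      have h1 : Order.coheight (curvePt j) = 1 := by
        have h2 := ringKrullDim_stalk_eq_coheight (curvePt j)
        rw [ringKrullDim_eq_one_of_maximalIdeal hm hg0'] at h2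
        exact_mod_cast h2.symm
      have h2 := (h U _ hη h1).1 (support_curveIdeal j).symm
      rw [hf, Ideal.map_span, Set.image_singleton] at h2
      obtain ⟨w, hw, hfw⟩ := IsLocalRing.eq_unit_mul_pow_of_length hm hg0' hf0' h2
      obtain ⟨a, s, hs, has⟩ := exists_germ_mul_eq hU hη w
      have h3 : f * s = g ^ d * a := by
        apply hinj
        rw [map_mul, map_mul, map_pow, ← has, hfw]
        ring
      have hgp : Prime g := by
        rw [← Ideal.span_singleton_prime hg0, ← hq]
        infer_instance
      have hgs : ¬ g ∣ s := by
        rw [← Ideal.mem_span_singleton, ← hg, mem_curveIdeal_iff_curvePt, not_not]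
        exact hs
      -- Divisibility by g^d descends from the local ring to the whole chart, because g is prime and
      -- does not divide the denominator s.
      obtain ⟨v, hv⟩ := hgp.pow_dvd_of_dvd_mul_right d hgs ⟨a, h3⟩
      refine ⟨v, by rw [hv, mul_comm], fun _ => ?_⟩
      have h4 : v * s = a := by
        apply mul_left_cancel₀ (pow_ne_zero d hg0)
        rw [← h3, hv, mul_assoc]
      rw [X.mem_basicOpen v _ hη]
      have h5 : IsUnit (X.presheaf.germ U.1 _ hη a) := by
        rw [← has]
        exact hw.mul ((X.mem_basicOpen s _ hη).mp hs)
      rw [← h4, map_mul] at h5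
      exact isUnit_of_mul_isUnit_left h5
    · have h1 : IsUnit g := by
        rw [← Ideal.span_singleton_eq_top, ← hg, Ideal.eq_top_iff_one, mem_curveIdeal_iff_curvePt]
        exact fun h => hη (X.basicOpen_le _ h)
      obtain ⟨g', hg'⟩ := (h1.pow d).exists_left_inv
      exact ⟨f * g', by rw [mul_assoc, hg', mul_one], fun h => absurd h hη⟩
  -- The quotient v is a unit at the generic point of C by construction, and at the other points of
  -- codimension one because f itself is a unit there.
  refine ⟨v, isUnit_of_codim_one U (by rintro rfl; exact hf0 (by rw [hv, zero_mul])) fun z hz hz1 => ?_, hv⟩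
  by_cases hzη : z = curvePt j
  · subst hzη
    exact hvη hz
  have h1 := (h U z hz hz1).2 (fun e => hzη (by
    rw [support_curveIdeal] at e
    exact (inseparable_iff_closure_eq.mpr e).eq))
  rw [hf, Ideal.map_span, Set.image_singleton, Module.length_eq_zero_iff, Ideal.Quotient.subsingleton_iff, Ideal.span_singleton_eq_top, hv, map_mul] at h1
  exact (X.mem_basicOpen v z hz).mpr (isUnit_of_mul_isUnit_left h1)

end

namespace GeometricDatum
variable {k : Type u} [Field k] (G : GeometricDatum k)

lemma exists_toPS2_eq {U : G.X.affineOpens} (hU : basePoint G.j ∈ U.1) {g : Γ(G.X, U)}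
    (hg : (curveIdeal G.j).ideal U = Ideal.span {g}) :
    ∃ w, IsUnit w ∧ toPS2 G.j hU g = w * PS2.t k ^ G.rank := by
  have h1 := G.map_toPS2_curveIdeal hU
  rw [hg, Ideal.map_span, Set.image_singleton, Ideal.span_singleton_eq_span_singleton] at h1
  obtain ⟨w, hw⟩ := h1.symm
  exact ⟨w, w.isUnit, by rw [← hw, mul_comm]⟩

/-- On an overlap g divides a generator near P, and that generator pulls back to a unit times t^r.
-/
lemma ne_zero_of_curveIdeal_eq {U : G.X.affineOpens} (hU : genPt G.j ∈ U.1) {g : Γ(G.X, U)}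
    (hg : (curveIdeal G.j).ideal U = Ideal.span {g}) : g ≠ 0 := by
  rintro rfl
  obtain ⟨V, hV, g', h, hg', -⟩ := G.exists_generators
  have hV' := genPt_mem_of_basePoint_mem G.j hV
  obtain ⟨W, hWa, hW, hWUV⟩ := exists_isAffineOpen_mem_and_subset (x := genPt G.j) (U := U.1 ⊓ V.1) ⟨hU, hV'⟩
  obtain ⟨v, hv⟩ := exists_pullL_eq_mul (j := G.j) (curveIdeal G.j) (W := ⟨W, hWa⟩)
    (hWUV.trans inf_le_right) (hWUV.trans inf_le_left) hW hg' hg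
  rw [map_zero, mul_zero, ← algebraMap_toPS2 G.j hV] at hv
  obtain ⟨w, hw, hgw⟩ := G.exists_toPS2_eq hV hg'
  rw [hgw, map_eq_zero_iff _ (IsFractionRing.injective (PS2 k) (FunT k))] at hv
  exact (mul_ne_zero hw.ne_zero (pow_ne_zero _ PS2.t_ne_zero)) hv

lemma ne_zero_of_isEffectiveCartier {D : G.X.IdealSheafData} (hD : IsEffectiveCartier D)
    {U : G.X.affineOpens} (hU : genPt G.j ∈ U.1) {f : Γ(G.X, U)} (hf : D.ideal U = Ideal.span {f}) :
    f ≠ 0 := by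
  rintro rfl
  obtain ⟨V, f', hV, hf0, hf'⟩ := hD (genPt G.j)
  obtain ⟨W, hWa, hW, hWUV⟩ := exists_isAffineOpen_mem_and_subset (x := genPt G.j) (U := U.1 ⊓ V.1) ⟨hU, hV⟩
  obtain ⟨v, hv⟩ := exists_pullL_eq_mul (j := G.j) D (W := ⟨W, hWa⟩)
    (hWUV.trans inf_le_right) (hWUV.trans inf_le_left) hW hf' hf
  rw [map_zero, mul_zero, map_eq_zero_iff _ (pullL_injective _)] at hv
  have : Nonempty V.1 := ⟨⟨_, hV⟩⟩
  have : Nontrivial Γ(G.X, V) := inferInstanceAs (Nontrivial Γ(G.X, V.1))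
  exact nonZeroDivisors.ne_zero hf0 hv

/-- Local equations of a divisor with cycle `d C` are units times `d`-th powers of equations of `C`. -/
lemma exists_eq_unit_mul_pow {D : G.X.IdealSheafData} (hD : IsEffectiveCartier D) {d : ℕ}
    (h : HasCycle D (curveIdeal G.j) d) {U : G.X.affineOpens} (hU : genPt G.j ∈ U.1)
    {f g : Γ(G.X, U)} (hf : D.ideal U = Ideal.span {f})
    (hg : (curveIdeal G.j).ideal U = Ideal.span {g}) : ∃ v, IsUnit v ∧ f = v * g ^ d :=
  h.eq_unit_mul_pow hf hg (G.ne_zero_of_isEffectiveCartier hD hU hf) (G.ne_zero_of_curveIdeal_eq hU hg)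

end GeometricDatum

end

/-! ### Rank one when e is an isomorphism at P. -/

section

namespace PS2
variable {k : Type u} [Field k]
open MvPowerSeries Finsupp

/-- `u` and `t` are not both multiples of one element of `ℳ`, modulo `ℳ ^ 2`. -/
lemma not_common_factor {p q h : PS2 k} (hh : h ∈ maxIdeal k) (hu : q * h - u k ∈ maxIdeal k ^ 2)
    (ht : p * h - t k ∈ maxIdeal k ^ 2) : False := by
  classical
  -- Eliminating h shows q t - p u ∈ M^2. Hence q has zero constant term, so q h ∈ M^2, and u ∈ M^2
  -- follows.
  have h1 : q * t k - p * u k ∈ maxIdeal k ^ 2 := by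
    have : q * t k - p * u k = p * (q * h - u k) - q * (p * h - t k) := by ring
    rw [this]
    exact Ideal.sub_mem _ (Ideal.mul_mem_left _ _ hu) (Ideal.mul_mem_left _ _ ht)
  have h2 := mem_maxIdeal_pow_iff.mp h1 (single 1 1) (by simp)
  rw [map_sub, t, u, X_def, X_def, coeff_mul_monomial, coeff_mul_monomial, if_pos le_rfl,
    if_neg (by intro h; have := h 0; simp at this), sub_zero, mul_one, tsub_self] at h2
  have h3 : q ∈ maxIdeal k := by
    rw [mem_maxIdeal_iff, ← coeff_zero_eq_constantCoeff_apply]; exact h2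
  have h4 : u k ∈ maxIdeal k ^ 2 := by
    have : u k = q * h - (q * h - u k) := by ring
    rw [this, pow_two]
    exact Ideal.sub_mem _ (Ideal.mul_mem_mul h3 hh) (by rw [← pow_two]; exact hu)
  have h5 := mem_maxIdeal_pow_iff.mp h4 (single 0 1) (by simp)
  rw [u, coeff_index_single_self_X] at h5
  exact one_ne_zero h5

lemma maxIdeal_eq : maxIdeal k = IsLocalRing.maximalIdeal (PS2 k) := by
  ext a
  rw [mem_maxIdeal_iff, IsLocalRing.mem_maximalIdeal, mem_nonunits_iff, isUnit_iff_constantCoeff,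
    isUnit_iff_ne_zero, not_not]

end PS2

namespace GeometricDatum
variable {k : Type u} [Field k] {G : GeometricDatum k}

/-- If `𝒪_{X, P} = F_P`, then sections of `F` near `P` are sections of `𝒪_X`. -/
lemma exists_modL_eq {e : OMod G.X ⟶ G.F} (he : IsIso (G.stalkMap e)) {V : G.X.Opens}
    (hV : basePoint G.j ∈ V) (m : G.F.presheaf.obj (.op V)) :
    ∃ z : G.X.presheaf.stalk (basePoint G.j), modL G.incl (genPt_mem_of_basePoint_mem G.j hV) m =
      algebraMap _ _ (stalkR G.j z * G.valueAtOne e) := by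
  have hsurj : Function.Surjective (G.stalkMap e) := (ConcreteCategory.bijective_of_isIso (G.stalkMap e)).2
  obtain ⟨s, hs⟩ := hsurj (G.F.presheaf.germ V _ hV m)
  obtain ⟨W, hW, b, rfl⟩ := (OMod G.X).presheaf.exists_germ_eq s
  have h1 : G.stalkMap e ((OMod G.X).presheaf.germ W _ hW b) =
      G.F.presheaf.germ W _ hW ((Scheme.Modules.Hom.app e W).hom b) :=
    congr($(TopCat.Presheaf.stalkFunctor_map_germ W G.P hW (Scheme.Modules.Hom.mapPresheaf e)) b)
  rw [h1] at hs
  obtain ⟨U, hU, iW, iV, h2⟩ := TopCat.Presheaf.germ_eq _ _ hW hV _ _ hs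
  have hUg := genPt_mem_of_basePoint_mem G.j hU
  have h3 := congrArg (modL G.incl hUg) h2
  let b' : Γ(G.X, W) := b
  have hW' : basePoint G.j ∈ W := hW
  refine ⟨G.X.presheaf.germ W (basePoint G.j) hW' b', ?_⟩
  have h4 := modL_app G e (genPt_mem_of_basePoint_mem G.j hW) b'
  have h5 : modL G.incl hUg (G.F.presheaf.map iW.op ((Scheme.Modules.Hom.app e W).hom b)) =
    modL G.incl _ ((Scheme.Modules.Hom.app e W).hom (OMod.ofSection b')) := modL_map G.incl hUg iW _
  rw [stalkR_germ, map_mul, algebraMap_toPS2, ← h4, ← h5]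
  exact (h3.trans (modL_map G.incl hUg iV m)).symm

/-- Every element of R is congruent modulo M^2 to a function at P. If r ≥ 2, an equation of C
disappears modulo M^2 and one remaining generator cannot span both u and t. -/
theorem rank_eq_one {e : OMod G.X ⟶ G.F} (hc : G.IsCanonicalEmbedding e) (he : IsIso (G.stalkMap e)) :
    G.rank = 1 := by
  obtain ⟨D, d, hd, hD, -, hcyc, hbij⟩ := G.sections_iso
  obtain ⟨U, hU, g, h, hg, hm⟩ := G.exists_generators
  obtain ⟨V, f, hV, -, hf⟩ := hD (basePoint G.j)
  obtain ⟨W, hWa, hW, hWUV⟩ := exists_isAffineOpen_mem_and_subset (x := basePoint G.j) (U := U.1 ⊓ V.1) ⟨hU, hV⟩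
  have hWg := genPt_mem_of_basePoint_mem G.j hW
  have hg' := ideal_eq_span_restrict _ (W := ⟨W, hWa⟩) (hWUV.trans inf_le_left) hg
  have hf' := ideal_eq_span_restrict _ (W := ⟨W, hWa⟩) (hWUV.trans inf_le_right) hf
  obtain ⟨v, hv, hfv⟩ := G.exists_eq_unit_mul_pow hD hcyc hWg hf' hg'
  obtain ⟨w, hw, hgw⟩ := G.exists_toPS2_eq (U := ⟨W, hWa⟩) hW hg'
  set f' : Γ(G.X, W) := G.X.presheaf.map (homOfLE (hWUV.trans inf_le_right)).op f
  obtain ⟨w', hw', hfw⟩ : ∃ w', IsUnit w' ∧ toPS2 G.j hW f' = w' * PS2.t k ^ (1 * d * G.rank) := by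
    refine ⟨toPS2 G.j hW v * w ^ d, (hv.map _).mul (hw.pow d), ?_⟩
    have h1 := congrArg (toPS2 G.j hW) hfv
    rw [map_mul, map_pow, hgw] at h1
    refine h1.trans ?_
    ring
  have key (x : PS2 k) : ∃ z, stalkR G.j z - x ∈ PS2.maxIdeal k ^ 2 := by
    have ha := hc.isUnit
    set a := G.valueAtOne e
    obtain ⟨a', haa'⟩ := ha.exists_right_inv
    obtain ⟨w'', hww'⟩ := hw'.exists_right_inv
    -- The factors w'' and a compensate for the unit in the local equation of C' and for the
    -- canonical embedding. The jets determine elements modulo M^(dr+1), which is contained in M^2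
    -- since dr ≥ 1.
    obtain ⟨b, hb, hbx⟩ := (hbij 1).surjOn (Set.mem_univ (Ideal.Quotient.mk _ (w'' * a * x)))
    rw [Ideal.Quotient.mk_eq_mk_iff_sub_mem] at hbx
    rw [mem_twistedSections_iff] at hb
    obtain ⟨m, hm⟩ := hb ⟨W, hWa⟩ f' hWg hf'
    obtain ⟨z, hz⟩ := exists_modL_eq he hW m
    refine ⟨z, ?_⟩
    have h1 : w' * b = stalkR G.j z * a := by
      apply IsFractionRing.injective (PS2 k) (FunT k)
      rw [← hz, hm, pow_one, ← algebraMap_toPS2 G.j hW, hfw, map_mul, map_mul, map_pow]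
      have := tL_ne_zero (k := k)
      unfold tL at this ⊢
      field_simp
    have h2 : stalkR G.j z - x = a' * w' * (b - w'' * a * x) := by
      calc stalkR G.j z - x = (stalkR G.j z * a) * a' - x * (a * a') * (w' * w'') := by
            rw [haa', hww', mul_assoc, haa']; ring
        _ = _ := by rw [← h1]; ring
    rw [h2]
    refine Ideal.mul_mem_left _ _ (Ideal.pow_le_pow_right ?_ hbx)
    have := Nat.mul_pos hd G.rank_pos
    rw [one_mul]
    omega
  by_contra hr
  have hr2 : 2 ≤ G.rank := by have := G.rank_pos; omega
  obtain ⟨z₁, hz₁⟩ := key (PS2.u k)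
  obtain ⟨z₂, hz₂⟩ := key (PS2.t k)
  have hloc {z : G.X.presheaf.stalk (basePoint G.j)} : z ∈ IsLocalRing.maximalIdeal _ ↔ stalkR G.j z ∈ PS2.maxIdeal k := by
    rw [PS2.maxIdeal_eq, IsLocalRing.mem_maximalIdeal, IsLocalRing.mem_maximalIdeal, mem_nonunits_iff,
      mem_nonunits_iff, isUnit_map_iff]
  obtain ⟨w₁, hw₁, hgw₁⟩ := G.exists_toPS2_eq hU hg
  -- The component along the equation of C is a multiple of t^r and lies in M^2, so only the
  -- component along h survives.
  have hdecomp {z : G.X.presheaf.stalk (basePoint G.j)} {x : PS2 k} (hx : x ∈ PS2.maxIdeal k)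
      (hz : stalkR G.j z - x ∈ PS2.maxIdeal k ^ 2) : ∃ q, q * stalkR G.j h - x ∈ PS2.maxIdeal k ^ 2 := by
    have h1 : z ∈ IsLocalRing.maximalIdeal _ := by
      rw [hloc, ← sub_add_cancel (stalkR G.j z) x]
      exact Ideal.add_mem _ (Ideal.pow_le_self two_ne_zero hz) hx
    rw [hm] at h1
    obtain ⟨p, q, rfl⟩ := Ideal.mem_span_pair.mp h1
    refine ⟨stalkR G.j q, ?_⟩
    rw [map_add, map_mul, map_mul, stalkR_germ, hgw₁] at hz
    have h2 : PS2.t k ^ G.rank ∈ PS2.maxIdeal k ^ 2 :=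
      Ideal.pow_le_pow_right hr2 (Ideal.pow_mem_pow (Ideal.subset_span (by simp)) _)
    have := Ideal.sub_mem _ hz (Ideal.mul_mem_left _ (stalkR G.j p * w₁) h2)
    convert this using 1
    ring
  obtain ⟨q₁, hq₁⟩ := hdecomp (Ideal.subset_span (by simp)) hz₁
  obtain ⟨q₂, hq₂⟩ := hdecomp (Ideal.subset_span (by simp)) hz₂
  refine PS2.not_common_factor (hloc.mp ?_) hq₁ hq₂
  rw [hm]
  exact Ideal.subset_span (by simp)

lemma rank_eq_one_of_isIso {e : OMod G.X ⟶ G.F} (hc : G.IsCanonicalEmbedding e) [IsIso e] : G.rank = 1 := by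
  apply rank_eq_one hc
  exact (TopCat.Presheaf.stalkFunctor Ab G.P).map_isIso ((Scheme.Modules.toPresheaf G.X).map e)

end GeometricDatum

end

/-! ### Standard charts of projective space and equations of hyperplanes. -/

section

open MvPolynomial

/-- A nonzero linear form is prime. -/
lemma MvPolynomial.IsHomogeneous.prime_of_linear {σ k : Type*} [Field k] {l : MvPolynomial σ k}
    (hl : l.IsHomogeneous 1) (h0 : l ≠ 0) : Prime l := by
  rw [← irreducible_iff_prime]
  refine irreducible_of_totalDegree_eq_one (hl.totalDegree h0) fun x hx => ?_
  rw [isUnit_iff_ne_zero]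
  rintro rfl
  exact h0 (MvPolynomial.ext _ _ fun m => by simpa using hx m)

namespace PSpace
variable {k : Type u} [Field k] {N : ℕ}

/-- The open set `D₊(f)` of `ℙᴺ`. -/
abbrev D (f : MvPolynomial (Fin (N + 1)) k) : (PSpace k N).Opens :=
  Proj.basicOpen (homogeneousSubmodule (Fin (N + 1)) k) f

lemma X_mem (i : Fin (N + 1)) : (X i : MvPolynomial (Fin (N + 1)) k) ∈ homogeneousSubmodule (Fin (N + 1)) k 1 :=
  isHomogeneous_X k i

variable {f : MvPolynomial (Fin (N + 1)) k} {d : ℕ}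

lemma isAffineOpen_D (hf : f ∈ homogeneousSubmodule (Fin (N + 1)) k d) (hd : 0 < d) : IsAffineOpen (D f) :=
  Proj.isAffineOpen_basicOpen _ f hf hd

/-- The section `Q / fⁿ` of the structure sheaf over `D₊(f)`. -/
def frac (hf : f ∈ homogeneousSubmodule (Fin (N + 1)) k d) {n : ℕ} {Q : MvPolynomial (Fin (N + 1)) k}
    (hQ : Q ∈ homogeneousSubmodule (Fin (N + 1)) k (n • d)) : Γ(PSpace k N, D f) :=
  Proj.awayToSection (homogeneousSubmodule (Fin (N + 1)) k) f (.mk _ hf n Q hQ)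

lemma awayToSection_bijective (hf : f ∈ homogeneousSubmodule (Fin (N + 1)) k d) (hd : 0 < d) :
    Function.Bijective (Proj.awayToSection (homogeneousSubmodule (Fin (N + 1)) k) f) := by
  rw [← Proj.basicOpenIsoAway_hom _ f hf hd]
  exact ConcreteCategory.bijective_of_isIso _

lemma exists_frac_eq (hf : f ∈ homogeneousSubmodule (Fin (N + 1)) k d) (hd : 0 < d) (b : Γ(PSpace k N, D f)) :
    ∃ (n : ℕ) (Q : MvPolynomial (Fin (N + 1)) k) (hQ : Q ∈ homogeneousSubmodule (Fin (N + 1)) k (n • d)),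
      frac hf hQ = b := by
  obtain ⟨z, rfl⟩ := (awayToSection_bijective hf hd).2 b
  obtain ⟨n, Q, hQ, rfl⟩ := HomogeneousLocalization.Away.mk_surjective _ hf z
  exact ⟨n, Q, hQ, rfl⟩

lemma frac_eq_zero (hf : f ∈ homogeneousSubmodule (Fin (N + 1)) k d) (hd : 0 < d) (hf0 : f ≠ 0) {n : ℕ} {Q : MvPolynomial (Fin (N + 1)) k}
    (hQ : Q ∈ homogeneousSubmodule (Fin (N + 1)) k (n • d)) (h : frac hf hQ = 0) : Q = 0 := by
  rw [frac, map_eq_zero_iff _ (awayToSection_bijective hf hd).1] at h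
  have h1 := congrArg HomogeneousLocalization.val h
  rw [HomogeneousLocalization.Away.val_mk, HomogeneousLocalization.val_zero, Localization.mk_eq_mk', IsLocalization.mk'_eq_zero_iff] at h1
  obtain ⟨⟨_, m, rfl⟩, hm⟩ := h1
  exact (mul_eq_zero.mp hm).resolve_left (pow_ne_zero _ hf0)

lemma exists_mem_D (x : PSpace k N) : ∃ i : Fin (N + 1), x ∈ D (X i : MvPolynomial (Fin (N + 1)) k) := by
  have h := Proj.iSup_basicOpen_eq_top' (homogeneousSubmodule (Fin (N + 1)) k) (X : Fin (N + 1) → MvPolynomial (Fin (N + 1)) k)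
    (fun i => ⟨1, X_mem i⟩) (by
      rw [eq_top_iff]
      intro p _
      induction p using MvPolynomial.induction_on with
      | C a => exact Subalgebra.algebraMap_mem (Algebra.adjoin (homogeneousSubmodule (Fin (N + 1)) k 0) _) ⟨C a, isHomogeneous_C _ _⟩
      | add p q hp hq => exact add_mem (hp trivial) (hq trivial)
      | mul_X p i hp => exact mul_mem (hp trivial) (Algebra.subset_adjoin ⟨i, rfl⟩))
  exact TopologicalSpace.Opens.mem_iSup.mp (h.ge (Set.mem_univ x))

lemma mem_basicOpen_frac (hf : f ∈ homogeneousSubmodule (Fin (N + 1)) k d) {n : ℕ} {Q : MvPolynomial (Fin (N + 1)) k}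
    (hQ : Q ∈ homogeneousSubmodule (Fin (N + 1)) k (n • d)) {x : PSpace k N} (hx : x ∈ D f) :
    x ∈ (PSpace k N).basicOpen (frac hf hQ) ↔ Q ∉ x.asHomogeneousIdeal := by
  rw [(PSpace k N).mem_basicOpen _ x hx]
  have hxp : x.asHomogeneousIdeal.toIdeal.IsPrime := x.isPrime
  have h1 := congr($(ProjectiveSpectrum.Proj.awayToSection_germ (homogeneousSubmodule (Fin (N + 1)) k) f x hx)
    (HomogeneousLocalization.Away.mk _ hf n Q hQ))
  have h2 : (PSpace k N).presheaf.germ _ x hx (frac hf hQ) = (Proj.stalkIso' (homogeneousSubmodule (Fin (N + 1)) k) x).symm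
    (HomogeneousLocalization.mapId _ (Submonoid.powers_le.mpr hx) (HomogeneousLocalization.Away.mk _ hf n Q hQ)) := h1
  rw [h2]
  refine (isUnit_map_iff (Proj.stalkIso' (homogeneousSubmodule (Fin (N + 1)) k) x).symm _).trans ?_
  rw [← HomogeneousLocalization.isUnit_iff_isUnit_val]
  have h3 : f ^ n ∈ x.asHomogeneousIdeal.toIdeal.primeCompl := fun h => hx (x.isPrime.mem_of_pow_mem _ h)
  have h4 : (HomogeneousLocalization.mapId (homogeneousSubmodule (Fin (N + 1)) k)
      (Submonoid.powers_le.mpr hx : Submonoid.powers f ≤ x.asHomogeneousIdeal.toIdeal.primeCompl)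
      (HomogeneousLocalization.Away.mk _ hf n Q hQ)).val =
      IsLocalization.mk' (Localization.AtPrime x.asHomogeneousIdeal.toIdeal) Q ⟨f ^ n, h3⟩ := by
    rw [← Localization.mk_eq_mk']
    rfl
  rw [h4, IsLocalization.AtPrime.isUnit_mk'_iff]
  rfl

lemma isUnit_frac (hf : f ∈ homogeneousSubmodule (Fin (N + 1)) k d) {n : ℕ} {Q : MvPolynomial (Fin (N + 1)) k}
    (hQ : Q ∈ homogeneousSubmodule (Fin (N + 1)) k (n • d)) (h : Q ∣ f) : IsUnit (frac hf hQ) := by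
  refine (PSpace k N).toRingedSpace.isUnit_of_isUnit_germ _ _ fun x hx => ?_
  refine ((PSpace k N).mem_basicOpen _ x hx).mp ((mem_basicOpen_frac hf hQ hx).mpr fun h1 => hx ?_)
  exact Ideal.mem_of_dvd _ h h1

lemma frac_mul_frac (hf : f ∈ homogeneousSubmodule (Fin (N + 1)) k d) {n m r : ℕ} {Q Q' Q'' : MvPolynomial (Fin (N + 1)) k}
    (hQ : Q ∈ homogeneousSubmodule (Fin (N + 1)) k (n • d)) (hQ' : Q' ∈ homogeneousSubmodule (Fin (N + 1)) k (m • d))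
    (hQ'' : Q'' ∈ homogeneousSubmodule (Fin (N + 1)) k (r • d)) (h : f ^ r * (Q * Q') = f ^ (n + m) * Q'') :
    frac hf hQ * frac hf hQ' = frac hf hQ'' := by
  rw [frac, frac, frac, ← map_mul]
  congr 1
  ext
  rw [HomogeneousLocalization.val_mul, HomogeneousLocalization.Away.val_mk, HomogeneousLocalization.Away.val_mk,
    HomogeneousLocalization.Away.val_mk, Localization.mk_mul, Localization.mk_eq_mk_iff, Localization.r_iff_exists]
  exact ⟨1, by simpa [pow_add] using h⟩

/-- The homogeneous prime ideal generated by a linear form. -/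
def hyperplanePt {l : MvPolynomial (Fin (N + 1)) k} (hl : l.IsHomogeneous 1) (hl0 : l ≠ 0) {m : Fin (N + 1)} (hm : ¬ l ∣ X m) :
    PSpace k N where
  asHomogeneousIdeal := ⟨Ideal.span {l}, Ideal.homogeneous_span _ _ (by rintro _ rfl; exact ⟨1, hl⟩)⟩
  isPrime := (Ideal.span_singleton_prime hl0).mpr (hl.prime_of_linear hl0)
  not_irrelevant_le h := by
    have h1 : X m ∈ Ideal.span {l} := by
      apply h
      rw [HomogeneousIdeal.mem_irrelevant_iff]
      exact DirectSum.decompose_of_mem_ne (homogeneousSubmodule (Fin (N + 1)) k) (X_mem m) one_ne_zero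
    exact hm (Ideal.mem_span_singleton.mp h1)

lemma mem_hyperplane_ideal {l : MvPolynomial (Fin (N + 1)) k} (hf : f ∈ homogeneousSubmodule (Fin (N + 1)) k d) (hd : 0 < d)
    {n : ℕ} {Q : MvPolynomial (Fin (N + 1)) k} (hQ : Q ∈ homogeneousSubmodule (Fin (N + 1)) k (n • d)) :
    frac hf hQ ∈ (hyperplane l).ideal ⟨D f, isAffineOpen_D hf hd⟩ ↔ ∀ x ∈ D f, l ∈ x.asHomogeneousIdeal → Q ∈ x.asHomogeneousIdeal := by
  have hU := isAffineOpen_D hf hd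
  rw [hyperplane, Scheme.IdealSheafData.vanishingIdeal_ideal, PrimeSpectrum.mem_vanishingIdeal]
  constructor
  · intro h x hx hlx
    obtain ⟨y, rfl⟩ := hU.range_fromSpec.ge hx
    have h1 := h y (Set.singleton_subset_iff.mpr hlx)
    by_contra h2
    rw [← mem_basicOpen_frac hf hQ hx] at h2
    have h3 : y ∈ hU.fromSpec ⁻¹ᵁ (PSpace k N).basicOpen (frac hf hQ) := h2
    rw [hU.fromSpec_preimage_basicOpen] at h3
    exact h3 h1
  · intro h y hy
    have hx : hU.fromSpec y ∈ D f := hU.range_fromSpec.le ⟨y, rfl⟩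
    have h1 := h _ hx (Set.singleton_subset_iff.mp hy)
    by_contra h2
    have h3 : y ∈ hU.fromSpec ⁻¹ᵁ (PSpace k N).basicOpen (frac hf hQ) := by
      rw [hU.fromSpec_preimage_basicOpen]
      exact h2
    exact (mem_basicOpen_frac hf hQ hx).mp h3 h1

/-- The equations of a hyperplane. -/
theorem hyperplane_ideal {l : MvPolynomial (Fin (N + 1)) k} (hl : l ∈ homogeneousSubmodule (Fin (N + 1)) k (1 • 1)) (hl0 : l ≠ 0) (m : Fin (N + 1)) :
    (hyperplane l).ideal ⟨D (X m), isAffineOpen_D (X_mem m) one_pos⟩ =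
      Ideal.span {frac (X_mem m) hl} := by
  have hl1 : l.IsHomogeneous 1 := by simpa using hl
  apply le_antisymm
  · intro b hb
    obtain ⟨n, Q, hQ, rfl⟩ := exists_frac_eq (X_mem m) one_pos b
    rw [mem_hyperplane_ideal _ one_pos] at hb
    rw [Ideal.mem_span_singleton]
    -- If l divides x_m, the chart misses the hyperplane and l/x_m is a unit. Otherwise the prime
    -- (l) is a point of the chart and detects divisibility by l.
    by_cases hm : l ∣ X m
    · exact (isUnit_frac (X_mem m) hl hm).dvd
    · have h1 : Q ∈ Ideal.span {l} := hb (hyperplanePt hl1 hl0 hm) (fun h => hm (Ideal.mem_span_singleton.mp h))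
        (Ideal.mem_span_singleton_self l)
      obtain ⟨c, hc⟩ := Ideal.mem_span_singleton.mp h1
      -- The cofactor c is replaced by a homogeneous one by taking a graded component. The extra
      -- factor x_m avoids the degree n - 1, which is meaningless for n = 0.
      have h2 := DirectSum.coe_decompose_mul_add_of_left_mem (homogeneousSubmodule (Fin (N + 1)) k) (i := 1) (j := n) (b := X m * c) hl1
      have h3 : l * (X m * c) ∈ homogeneousSubmodule (Fin (N + 1)) k (1 + n) := by
        rw [mul_left_comm, ← hc]
        exact SetLike.mul_mem_graded (X_mem m) (by simpa using hQ)
      rw [DirectSum.decompose_of_mem_same _ h3] at h2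
      have h4 := (DirectSum.decompose (homogeneousSubmodule (Fin (N + 1)) k) (X m * c) n).2
      have h5 : ((DirectSum.decompose (homogeneousSubmodule (Fin (N + 1)) k) (X m * c) n : homogeneousSubmodule (Fin (N + 1)) k n) :
          MvPolynomial (Fin (N + 1)) k) ∈ homogeneousSubmodule (Fin (N + 1)) k (n • 1) := by
        rw [smul_eq_mul, mul_one]
        exact h4
      refine ⟨frac (X_mem m) h5, (frac_mul_frac _ _ _ _ ?_).symm⟩
      rw [← h2, hc]
      ring
  · rw [Ideal.span_singleton_le_iff_mem, mem_hyperplane_ideal _ one_pos]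
    exact fun x _ h => h

end PSpace

end

/-! ### Extension of sections of quasi-coherent sheaves. -/

section

open Scheme.Modules

lemma exists_map_eq_pow_smul {R : CommRingCat.{u}} (M : (Spec R).Modules) [M.IsQuasicoherent] (r : R)
    {V : (Spec R).Opens} (hV : V = PrimeSpectrum.basicOpen r) (s : Γ(M, V)) :
    ∃ (n : ℕ) (m : Γ(M, ⊤)), M.presheaf.map (homOfLE (le_top : V ≤ ⊤)).op m =
      ((Spec R).presheaf.map (homOfLE (le_top : V ≤ ⊤)).op ((Scheme.ΓSpecIso R).inv (r ^ n)) : Γ(Spec R, V)) • s := by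
  subst hV
  have h1 : IsIso M.fromTildeΓ := inferInstance
  rw [isIso_fromTildeΓ_iff_isLocalizing] at h1
  have h2 : IsLocalizedModule.Away r _ := h1 r
  obtain ⟨n, y, hy⟩ := h2.surj _ _ s
  exact ⟨n, y, hy.symm⟩

section
variable {k : Type u} [Field k] {X : Scheme.{u}} {j : FormalT k ⟶ X} {F : X.Modules} (ι : F ⟶ pushO j)

lemma IsAffineOpen.fromSpec_appIso_inv {U : X.Opens} (hU : IsAffineOpen U) (V : (Spec Γ(X, U)).Opens) (r : Γ(X, U))
    (h : hU.fromSpec ''ᵁ V ≤ U) :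
    (hU.fromSpec.appIso V).inv ((Spec Γ(X, U)).presheaf.map (homOfLE (le_top : V ≤ ⊤)).op ((Scheme.ΓSpecIso Γ(X, U)).inv r)) =
      X.presheaf.map (homOfLE h).op r := by
  have h1 : (hU.fromSpec.appIso V).hom (X.presheaf.map (homOfLE h).op r) =
      (Spec Γ(X, U)).presheaf.map (homOfLE (le_top : V ≤ ⊤)).op ((Scheme.ΓSpecIso Γ(X, U)).inv r) := by
    rw [Scheme.Hom.appIso_hom', ← CommRingCat.comp_apply, Scheme.Hom.map_appLE, Scheme.Hom.appLE, hU.fromSpec_app_self,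
      Category.assoc, ← Functor.map_comp]
    rfl
  rw [← h1, Iso.hom_inv_id_apply]

/-- Sections of a quasi-coherent sheaf over a basic open subset of an affine open set extend after
multiplication by a power of the function. -/
theorem exists_pow_mul_mem_FL [F.IsQuasicoherent] {U : X.Opens} (hU : IsAffineOpen U) (r : Γ(X, U))
    (h : genPt j ∈ X.basicOpen r) {z : FunT k} (hz : z ∈ FL ι h) :
    ∃ n : ℕ, pullL j (X.basicOpen_le r h) r ^ n * z ∈ FL ι (X.basicOpen_le r h) := by
  let M := F.restrict hU.fromSpec
  have e1 : hU.fromSpec ''ᵁ (PrimeSpectrum.basicOpen r) = X.basicOpen r := hU.fromSpec_image_basicOpen r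
  have e2 : hU.fromSpec ''ᵁ ⊤ = U := by simp
  have h1 : genPt j ∈ hU.fromSpec ''ᵁ (PrimeSpectrum.basicOpen r) := by rw [e1]; exact h
  have h2 : genPt j ∈ hU.fromSpec ''ᵁ ⊤ := by rw [e2]; exact X.basicOpen_le r h
  obtain ⟨s, rfl⟩ := FL_mono ι h1 e1.le hz
  obtain ⟨n, m, hm⟩ := exists_map_eq_pow_smul M r rfl s
  refine ⟨n, FL_mono ι (X.basicOpen_le r h) e2.ge ⟨m, ?_⟩⟩
  have h3 := congrArg (modL ι h1) hm
  refine Eq.trans ?_ (h3.trans ((modL_smul ι h1 ((hU.fromSpec.appIso _).inv _) _).trans ?_))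
  · exact (modL_map ι h1 (homOfLE (Scheme.Hom.image_mono _ le_top)) m).symm
  · rw [IsAffineOpen.fromSpec_appIso_inv hU _ _ (e1.le.trans (X.basicOpen_le r)), pullL_map, map_pow]

end

end

/-! ### Homogeneous coordinates of the generic point of T and charts of an embedding. -/

section

open MvPolynomial

section
variable {k : Type u} [Field k] {X Y : Scheme.{u}} (j : FormalT k ⟶ X) (i : X ⟶ Y)

lemma pullL_comp {V : Y.Opens} (h : genPt (j ≫ i) ∈ V) (h' : genPt j ∈ i ⁻¹ᵁ V) (b : Γ(Y, V)) :
    pullL (j ≫ i) h b = pullL j h' (i.app V b) := by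
  have h1 := congr($(Scheme.Hom.comp_app j i V) b)
  exact congrArg (germT (V := j ⁻¹ᵁ i ⁻¹ᵁ V) h) h1

lemma OL_comp [IsClosedImmersion i] {V : Y.Opens} (hV : IsAffineOpen V) (h : genPt (j ≫ i) ∈ V)
    (h' : genPt j ∈ i ⁻¹ᵁ V) : OL j h' = OL (j ≫ i) h := by
  ext z
  constructor
  · rintro ⟨b, rfl⟩
    obtain ⟨c, rfl⟩ := Scheme.Hom.app_surjective i V hV b
    exact ⟨c, pullL_comp j i h h' c⟩
  · rintro ⟨c, rfl⟩
    exact ⟨i.app V c, (pullL_comp j i h h' c).symm⟩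

end

namespace PSpace
variable {k : Type u} [Field k] {N : ℕ}

/-- `p` are homogeneous coordinates for the image of the generic point of `T`. -/
structure IsCoord (J : FormalT k ⟶ PSpace k N) (p : Fin (N + 1) → FunT k) : Prop where
  ne_zero : ∀ {f : MvPolynomial (Fin (N + 1)) k} {d : ℕ}, f ∈ homogeneousSubmodule (Fin (N + 1)) k d →
    genPt J ∈ D f → aeval p f ≠ 0
  pullL_frac : ∀ {f : MvPolynomial (Fin (N + 1)) k} {d : ℕ} (hf : f ∈ homogeneousSubmodule (Fin (N + 1)) k d)
    (h : genPt J ∈ D f) {n : ℕ} {Q : MvPolynomial (Fin (N + 1)) k}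
    (hQ : Q ∈ homogeneousSubmodule (Fin (N + 1)) k (n • d)),
    pullL J h (frac hf hQ) = aeval p Q / aeval p f ^ n

variable {J : FormalT k ⟶ PSpace k N} {p : Fin (N + 1) → FunT k}

lemma IsCoord.mul (hp : IsCoord J p) {c : FunT k} (hc : c ≠ 0) : IsCoord J (fun i => c * p i) where
  ne_zero {f d} hf h := by
    rw [aeval_mul_of_isHomogeneous c p hf]
    exact mul_ne_zero (pow_ne_zero _ hc) (hp.ne_zero hf h)
  pullL_frac {f d} hf h {n Q} hQ := by
    rw [hp.pullL_frac hf h hQ, aeval_mul_of_isHomogeneous c p hf, aeval_mul_of_isHomogeneous c p hQ, mul_pow,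
      ← pow_mul, smul_eq_mul, mul_comm d n]
    rw [mul_div_mul_left _ _ (pow_ne_zero _ hc)]

lemma isCoord_coord (hJ : J ≫ PSpace.toSpec k N = Spec.map (CommRingCat.ofHom (algebraMap k (PS2 k))))
    {l : MvPolynomial (Fin (N + 1)) k} (hl : l ∈ homogeneousSubmodule (Fin (N + 1)) k 1) (h : genPt J ∈ D l) :
    IsCoord J (coord J hl h) := by
  have h1 : aeval (coord J hl h) l = 1 := by
    have hl' : l ∈ homogeneousSubmodule (Fin (N + 1)) k (1 • 1) := by simpa using hl
    rw [← fracL_linear hJ hl h hl']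
    have : HomogeneousLocalization.Away.mk (homogeneousSubmodule (Fin (N + 1)) k) hl 1 l hl' = 1 := by
      ext
      rw [HomogeneousLocalization.Away.val_mk, HomogeneousLocalization.val_one, ← Localization.mk_one, Localization.mk_eq_mk_iff, Localization.r_iff_exists]
      exact ⟨1, by simp⟩
    rw [this, map_one]
  have h2 {f : MvPolynomial (Fin (N + 1)) k} {d : ℕ} (hf : f ∈ homogeneousSubmodule (Fin (N + 1)) k d)
      (h' : genPt J ∈ D f) : aeval (coord J hl h) f ≠ 0 := by
    intro h0
    have hld : l ^ d ∈ homogeneousSubmodule (Fin (N + 1)) k (1 • d) := by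
      simpa using SetLike.pow_mem_graded d hl
    have h3 := fracL_mk hJ hl h hf h' hld
    rw [h0, map_pow, h1] at h3
    simp at h3
  refine ⟨h2, fun {f d} hf h' {n Q} hQ => ?_⟩
  rw [eq_div_iff (pow_ne_zero _ (h2 hf h')), ← fracL_mk hJ hl h hf h' hQ]
  rfl

/-- Homogeneous coordinates may be rescaled, and the hypothesis says that l does not vanish at the
generic point of T. -/
lemma exists_isCoord (hJ : J ≫ PSpace.toSpec k N = Spec.map (CommRingCat.ofHom (algebraMap k (PS2 k))))
    {l : MvPolynomial (Fin (N + 1)) k} (hl : l ∈ homogeneousSubmodule (Fin (N + 1)) k (1 • 1)) {m : Fin (N + 1)}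
    (hm : genPt J ∈ D (X m : MvPolynomial (Fin (N + 1)) k)) (hne : pullL J hm (frac (X_mem m) hl) ≠ 0) :
    ∃ p, IsCoord J p ∧ aeval p l = 1 := by
  have h1 := isCoord_coord hJ (X_mem m) hm
  rw [h1.pullL_frac (X_mem m) hm hl] at hne
  have h2 : aeval (coord J (X_mem m) hm) l ≠ 0 := fun h => hne (by rw [h, zero_div])
  refine ⟨_, h1.mul (inv_ne_zero h2), ?_⟩
  rw [aeval_mul_of_isHomogeneous _ _ (by simpa using hl), pow_one, inv_mul_cancel₀ h2]

lemma IsCoord.mem_OL (hp : IsCoord J p) {f : MvPolynomial (Fin (N + 1)) k} {d : ℕ}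
    (hf : f ∈ homogeneousSubmodule (Fin (N + 1)) k d) (hd : 0 < d) (h : genPt J ∈ D f) {z : FunT k} :
    z ∈ OL J h ↔ ∃ (n : ℕ) (Q : MvPolynomial (Fin (N + 1)) k), Q ∈ homogeneousSubmodule (Fin (N + 1)) k (n • d) ∧
      z = aeval p Q / aeval p f ^ n := by
  constructor
  · rintro ⟨b, rfl⟩
    obtain ⟨n, Q, hQ, rfl⟩ := exists_frac_eq hf hd b
    exact ⟨n, Q, hQ, hp.pullL_frac hf h hQ⟩
  · rintro ⟨n, Q, hQ, rfl⟩
    exact ⟨_, hp.pullL_frac hf h hQ⟩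

lemma basicOpen_frac_X (m m' : Fin (N + 1)) (h : (X m : MvPolynomial (Fin (N + 1)) k) ∈ homogeneousSubmodule (Fin (N + 1)) k (1 • 1)) :
    (PSpace k N).basicOpen (frac (X_mem m') h) = D (X m) ⊓ D (X m') := by
  ext x
  constructor
  · intro hx
    have h1 := (PSpace k N).basicOpen_le _ hx
    exact ⟨(mem_basicOpen_frac (X_mem m') h h1).mp hx, h1⟩
  · rintro ⟨h1, h2⟩
    exact (mem_basicOpen_frac (X_mem m') h h2).mpr h1

end PSpace

/-- Affine charts of a projective embedding of `X`, where the divisor `E` is the intersection with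
the hyperplane `l = 0`: the coordinates `p` are normalized by `l(p) = 1`. -/
structure AffineCharts {k : Type u} [Field k] {X : Scheme.{u}} (j : FormalT k ⟶ X) (E : X.IdealSheafData) (N : ℕ) where
  /-- the linear form -/
  l : MvPolynomial (Fin (N + 1)) k
  /-- the charts -/
  U : Fin (N + 1) → X.affineOpens
  /-- the coordinates -/
  p : Fin (N + 1) → FunT k
  l_mem : l ∈ homogeneousSubmodule (Fin (N + 1)) k 1
  l_eq : aeval p l = 1
  exists_mem : ∀ x, ∃ m, x ∈ (U m).1
  ne_zero : ∀ m, genPt j ∈ (U m).1 → p m ≠ 0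
  exists_eq : ∀ m (h : genPt j ∈ (U m).1), ∃ f, E.ideal (U m) = Ideal.span {f} ∧ pullL j h f = (p m)⁻¹
  mem_OL : ∀ m (h : genPt j ∈ (U m).1) z, z ∈ OL j h ↔ ∃ (n : ℕ) (Q : MvPolynomial (Fin (N + 1)) k),
    Q ∈ homogeneousSubmodule (Fin (N + 1)) k n ∧ z = aeval p Q / p m ^ n
  inter : ∀ m m' (h' : genPt j ∈ (U m').1), ∃ r, pullL j h' r = p m / p m' ∧ X.basicOpen r = (U m).1 ⊓ (U m').1

/-- The charts are the preimages of the standard ones. The normalization l(p) = 1 turns the equation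
l/x_m of the hyperplane section into the inverse of p_m. The final clause says that only the zero
form vanishes at p when X is the whole projective space. -/
theorem exists_affineCharts {k : Type u} [Field k] {X : Scheme.{u}} [IsIntegral X] {j : FormalT k ⟶ X} [IsDominant j] {N : ℕ}
    (i : X ⟶ PSpace k N) [IsClosedImmersion i]
    (hJ : (j ≫ i) ≫ PSpace.toSpec k N = Spec.map (CommRingCat.ofHom (algebraMap k (PS2 k))))
    {l : MvPolynomial (Fin (N + 1)) k} (hl : l.IsHomogeneous 1) (hl0 : l ≠ 0) {E : X.IdealSheafData}
    (hE : E = (PSpace.hyperplane l).comap i)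
    (hne : ∀ (U : X.affineOpens) (_ : genPt j ∈ U.1) (f : Γ(X, U)), E.ideal U = Ideal.span {f} → f ≠ 0) :
    ∃ c : AffineCharts j E N, IsIso i → ∀ (n : ℕ), ∀ Q ∈ homogeneousSubmodule (Fin (N + 1)) k n, aeval c.p Q = 0 → Q = 0 := by
  have hl' : l ∈ homogeneousSubmodule (Fin (N + 1)) k (1 • 1) := by simpa using hl
  have hXa (m : Fin (N + 1)) := PSpace.isAffineOpen_D (PSpace.X_mem (k := k) m) one_pos
  let U (m : Fin (N + 1)) : X.affineOpens := ⟨i ⁻¹ᵁ PSpace.D (MvPolynomial.X m), (hXa m).preimage i⟩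
  have hideal (m) : E.ideal (U m) = Ideal.span {i.app _ (PSpace.frac (PSpace.X_mem m) hl')} := by
    subst hE
    have h1 := Scheme.IdealSheafData.ideal_comap (PSpace.hyperplane l) i ⟨PSpace.D (MvPolynomial.X m), hXa m⟩ (U m).2
    rw [PSpace.hyperplane_ideal hl' hl0 m, Ideal.map_span, Set.image_singleton] at h1
    exact h1
  obtain ⟨m₀, hm₀⟩ := PSpace.exists_mem_D (genPt (j ≫ i))
  have hm₀' : genPt j ∈ (U m₀).1 := hm₀
  obtain ⟨p, hp, hpl⟩ := PSpace.exists_isCoord hJ hl' hm₀ (by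
    rw [pullL_comp j i hm₀ hm₀', Ne, map_eq_zero_iff _ (pullL_injective _)]
    exact hne (U m₀) hm₀' _ (hideal m₀))
  have hX (m : Fin (N + 1)) : (MvPolynomial.X m : MvPolynomial (Fin (N + 1)) k) ∈ homogeneousSubmodule (Fin (N + 1)) k (1 • 1) := by
    simpa using PSpace.X_mem m
  refine ⟨⟨l, U, p, hl, hpl, fun x => PSpace.exists_mem_D (i x), fun m h => ?_, fun m h => ⟨_, hideal m, ?_⟩,
    fun m h z => ?_, fun m m' h' => ⟨i.app _ (PSpace.frac (PSpace.X_mem m') (hX m)), ?_, ?_⟩⟩, fun _ n Q hQ h0 => ?_⟩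
  · simpa using hp.ne_zero (PSpace.X_mem m) h
  · have h1 : genPt (j ≫ i) ∈ PSpace.D (MvPolynomial.X m) := h
    rw [← pullL_comp j i h1, hp.pullL_frac, hpl]
    simp
  · have h1 : genPt (j ≫ i) ∈ PSpace.D (MvPolynomial.X m) := h
    rw [OL_comp j i (hXa m) h1 h, hp.mem_OL (PSpace.X_mem m) one_pos]
    simp
  · have h1 : genPt (j ≫ i) ∈ PSpace.D (MvPolynomial.X m') := h'
    rw [← pullL_comp j i h1, hp.pullL_frac]
    simp
  · rw [← Scheme.preimage_basicOpen, PSpace.basicOpen_frac_X]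
    rfl
  · have hQ' : Q ∈ homogeneousSubmodule (Fin (N + 1)) k (n • 1) := by simpa using hQ
    have h1 := hp.pullL_frac (PSpace.X_mem m₀) hm₀ hQ'
    change aeval p Q = 0 at h0
    rw [h0, zero_div, pullL_comp j i hm₀ hm₀', map_eq_zero_iff _ (pullL_injective _)] at h1
    refine PSpace.frac_eq_zero (PSpace.X_mem m₀) one_pos (MvPolynomial.X_ne_zero m₀) hQ' ?_
    exact (ConcreteCategory.bijective_of_isIso (i.app (PSpace.D (MvPolynomial.X m₀)))).1 (h1.trans (map_zero _).symm)

end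

/-! ### A plane with a line has F = O_X. -/

section

section
variable {k : Type u} [Field k] {X : Scheme.{u}} {j : FormalT k ⟶ X} {F : X.Modules} (ι : F ⟶ pushO j)

lemma exists_eq_of_mem_FL {U : X.Opens} (hU : basePoint j ∈ U) {z : FunT k}
    (hz : z ∈ FL ι (genPt_mem_of_basePoint_mem j hU)) : ∃ a : PS2 k, algebraMap (PS2 k) (FunT k) a = z := by
  obtain ⟨m, rfl⟩ := hz
  exact ⟨_, algebraMap_resTop (preimage_eq_top j hU) _⟩

lemma exists_eq_of_mem_OL {U : X.Opens} (hU : basePoint j ∈ U) {z : FunT k}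
    (hz : z ∈ OL j (genPt_mem_of_basePoint_mem j hU)) : ∃ a : PS2 k, algebraMap (PS2 k) (FunT k) a = z := by
  obtain ⟨m, rfl⟩ := hz
  exact ⟨_, algebraMap_resTop (preimage_eq_top j hU) _⟩

lemma app_injective_of_mono [Mono ι] (U : X.Opens) : Function.Injective (Scheme.Modules.Hom.app ι U).hom := by
  have h1 : Mono ((Scheme.Modules.toPresheaf X).map ι) := inferInstance
  have h2 : Mono (Scheme.Modules.Hom.app ι U) :=
    (NatTrans.mono_iff_mono_app ((Scheme.Modules.toPresheaf X).map ι)).mp h1 (.op U)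
  exact (AddCommGrpCat.mono_iff_injective _).mp h2

lemma inv_pullL_mem_OL {U : X.Opens} (r : Γ(X, U)) (h : genPt j ∈ X.basicOpen r) :
    (pullL j (X.basicOpen_le r h) r)⁻¹ ∈ OL j h := by
  have h1 : IsUnit (X.presheaf.map (homOfLE (X.basicOpen_le r)).op r) :=
    X.toRingedSpace.isUnit_res_basicOpen r
  obtain ⟨s, hs⟩ := h1.exists_right_inv
  refine ⟨s, ?_⟩
  have h2 := congrArg (pullL j h) hs
  rw [map_mul, pullL_map, map_one] at h2
  exact (DivisionMonoid.inv_eq_of_mul _ _ h2).symm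

end

namespace GeometricDatum
variable {k : Type u} [Field k] {G : GeometricDatum k}

/-- Since e is multiplication by a, surjectivity on sections means that division by a leads from F
to O_X. -/
lemma isIso_of_div_mem_OL {e : OMod G.X ⟶ G.F} (hc : G.IsCanonicalEmbedding e)
    (H : ∀ (U : G.X.Opens) (h : genPt G.j ∈ U), ∀ z ∈ FL G.incl h, z / algebraMap _ _ (G.valueAtOne e) ∈ OL G.j h) :
    IsIso e := by
  rw [Scheme.Modules.Hom.isIso_iff_isIso_app]
  intro U
  have ha : algebraMap (PS2 k) (FunT k) (G.valueAtOne e) ≠ 0 := (hc.isUnit.map _).ne_zero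
  have h1 : Function.Bijective (Scheme.Modules.Hom.app e U).hom := by
    refine ⟨hc.app_injective U, fun m => ?_⟩
    by_cases h : genPt G.j ∈ U
    · obtain ⟨b, hb⟩ := H U h _ ⟨m, rfl⟩
      refine ⟨OMod.ofSection b, modL_injective G.incl h ?_⟩
      rw [modL_app, hb, div_mul_cancel₀ _ ha]
    · refine ⟨0, ?_⟩
      have h1 : G.j ⁻¹ᵁ U = ⊥ := by
        rw [eq_bot_iff]
        intro x hx
        exact absurd (genPt_mem G.j (show G.j x ∈ U from hx)) h
      have h2 : Subsingleton Γ(FormalT k, G.j ⁻¹ᵁ U) := by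
        rw [h1]; infer_instance
      exact app_injective_of_mono G.incl U (h2.elim _ _)
  exact (ConcreteCategory.isIso_iff_bijective (Scheme.Modules.Hom.app e U)).mpr h1

/-- Every open set is covered by basic open subsets of charts. A section of F there extends to the
chart after multiplication by a power of a function that is invertible on the smaller set. -/
lemma div_mem_OL_of_charts {E : G.X.IdealSheafData} {N : ℕ} (c : AffineCharts G.j E N) {a : FunT k}
    (H : ∀ m (h : genPt G.j ∈ (c.U m).1), ∀ z ∈ FL G.incl h, z / a ∈ OL G.j h)
    (V : G.X.Opens) (h : genPt G.j ∈ V) (z : FunT k) (hz : z ∈ FL G.incl h) : z / a ∈ OL G.j h := by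
  refine OL_of_local h fun x hx => ?_
  obtain ⟨m, hm⟩ := c.exists_mem x
  obtain ⟨r, hr, hxr⟩ := (c.U m).2.exists_basicOpen_le ⟨x, hx⟩ hm
  have hg : genPt G.j ∈ G.X.basicOpen r := genPt_mem G.j hxr
  refine ⟨_, hxr, hr, hg, ?_⟩
  obtain ⟨n, hn⟩ := exists_pow_mul_mem_FL G.incl (c.U m).2 r hg (FL_mono G.incl hg hr hz)
  have h1 := OL_mono hg (G.X.basicOpen_le r) (H m _ _ hn)
  have h2 := mul_mem (pow_mem (inv_pullL_mem_OL r hg) n) h1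
  have h3 : pullL G.j (G.X.basicOpen_le r hg) r ≠ 0 := by
    rw [Ne, map_eq_zero_iff _ (pullL_injective _)]
    rintro rfl
    rw [Scheme.basicOpen_zero] at hg
    exact hg
  convert h2 using 1
  rw [← mul_div_assoc, ← mul_assoc, ← mul_pow, inv_mul_cancel₀ h3, one_pow, one_mul]

/-- The charts are adapted to C, so equations of D are units times d-th powers of the inverses of
the p_m, up to restriction. -/
lemma mem_twistedSections_of_charts {D : G.X.IdealSheafData} (hD : IsEffectiveCartier D) {d : ℕ}
    (hcyc : HasCycle D (curveIdeal G.j) d) {N : ℕ} (c : AffineCharts G.j (curveIdeal G.j) N) {n M : ℕ} {a : PS2 k}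
    {b : FunT k} (hab : algebraMap _ _ a = b * tL k ^ M)
    (H : ∀ m (h : genPt G.j ∈ (c.U m).1), b / c.p m ^ (n * d) ∈ FL G.incl h) : a ∈ twistedSections G.incl D n M := by
  refine mem_twistedSections_of_local G.incl D n M a fun x => ?_
  obtain ⟨m, hm⟩ := c.exists_mem x
  obtain ⟨V, f, hxV, -, hf⟩ := hD x
  obtain ⟨W, hWa, hW, hWUV⟩ := exists_isAffineOpen_mem_and_subset (x := x) (U := (c.U m).1 ⊓ V.1) ⟨hm, hxV⟩
  have hWg : genPt G.j ∈ W := genPt_mem G.j hW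
  have hWU : W ≤ (c.U m).1 := hWUV.trans inf_le_left
  have hWV : W ≤ V.1 := hWUV.trans inf_le_right
  obtain ⟨g, hg, hgp⟩ := c.exists_eq m (hWU hWg)
  have hg' := ideal_eq_span_restrict _ (W := ⟨W, hWa⟩) hWU hg
  have hf' := ideal_eq_span_restrict _ (W := ⟨W, hWa⟩) hWV hf
  obtain ⟨v, -, hfv⟩ := G.exists_eq_unit_mul_pow hD hcyc hWg hf' hg'
  refine ⟨⟨W, hWa⟩, _, hWg, hW, hf', ?_⟩
  have h1 := congrArg (pullL G.j hWg) hfv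
  have h2 : pullL G.j hWg (G.X.presheaf.map (homOfLE hWU).op g) = _ := pullL_map G.j hWg (homOfLE hWU) g
  have h3 := FL_mul_mem G.incl (b := pullL G.j hWg v ^ n) (pow_mem (mem_OL.mpr ⟨v, rfl⟩) n) (FL_mono G.incl hWg hWU (H m (hWU hWg)))
  rw [map_mul, map_pow, h2, hgp] at h1
  rw [h1, hab]
  convert h3 using 1
  have := tL_ne_zero (k := k)
  have := c.ne_zero m (hWU hWg)
  rw [← mul_assoc, mul_div_assoc, div_self (pow_ne_zero _ tL_ne_zero), mul_one, mul_pow, ← pow_mul, inv_pow, mul_comm d n]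
  ring

lemma mul_mem_FL {e : OMod G.X ⟶ G.F} {U : G.X.Opens} {h : genPt G.j ∈ U} {z : FunT k} (hz : z ∈ OL G.j h) :
    algebraMap _ _ (G.valueAtOne e) * z ∈ FL G.incl h := by
  obtain ⟨b, rfl⟩ := hz
  exact ⟨_, (modL_app G e h b).trans (mul_comm _ _)⟩

open MvPolynomial in
/-- If `X` is the projective plane and `C` is a line, then `𝒪_X = F`. -/
theorem isIso_of_isPlaneWithLine {e : OMod G.X ⟶ G.F} (hc : G.IsCanonicalEmbedding e) (hr : G.rank = 1)
    (hplane : G.IsPlaneWithLine) : IsIso e := by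
  obtain ⟨φ, l, hφ, hl, hl0, hC⟩ := hplane
  obtain ⟨D, d, hd, hD, -, hcyc, hbij⟩ := G.sections_iso
  obtain ⟨c, hinj⟩ := exists_affineCharts (j := G.j) φ.hom (by rw [Category.assoc, hφ]; exact G.j_over) hl hl0
    (E := curveIdeal G.j) hC fun U hU f hf => G.ne_zero_of_curveIdeal_eq hU hf
  replace hinj := hinj inferInstance
  set a := G.valueAtOne e
  have ha : algebraMap (PS2 k) (FunT k) a ≠ 0 := (hc.isUnit.map _).ne_zero
  have ht := tL_ne_zero (k := k)
  obtain ⟨m₀, hm₀⟩ := c.exists_mem (basePoint G.j)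
  have hm₀' := genPt_mem_of_basePoint_mem G.j hm₀
  -- Near P the inverse of p_m₀ is an equation of C, so for r = 1 it is a unit times t; hence t p_m₀
  -- is a power series, and then so are all t p_i.
  obtain ⟨w, hw⟩ : ∃ w : PS2 k, algebraMap _ _ w = tL k * c.p m₀ := by
    obtain ⟨f, hf, hfp⟩ := c.exists_eq m₀ hm₀'
    obtain ⟨w, hw, hfw⟩ := G.exists_toPS2_eq hm₀ hf
    obtain ⟨w', hww'⟩ := hw.exists_right_inv
    refine ⟨w', ?_⟩
    rw [← algebraMap_toPS2 G.j hm₀, hfw, hr, pow_one, map_mul] at hfp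
    change _ * tL k = _ at hfp
    have h1 := congrArg (algebraMap (PS2 k) (FunT k)) hww'
    rw [map_mul, map_one] at h1
    have h2 := c.ne_zero m₀ hm₀'
    have h3 : algebraMap (PS2 k) (FunT k) w ≠ 0 := left_ne_zero_of_mul_eq_one h1
    apply mul_left_cancel₀ h3
    rw [h1, ← mul_assoc, hfp, inv_mul_cancel₀ h2]
  have hy (i : Fin 3) : ∃ y : PS2 k, algebraMap _ _ y = tL k * c.p i := by
    obtain ⟨y, hy⟩ := exists_eq_of_mem_OL hm₀ ((c.mem_OL m₀ hm₀' (c.p i / c.p m₀)).mpr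
      ⟨1, MvPolynomial.X i, isHomogeneous_X k i, by simp⟩)
    refine ⟨y * w, ?_⟩
    rw [map_mul, hy, hw]
    have h2 := c.ne_zero m₀ hm₀'
    field_simp
  choose y hy using hy
  have hQy {n : ℕ} {Q : MvPolynomial (Fin 3) k} (hQ : Q ∈ PS2.Forms k n) :
      algebraMap (PS2 k) (FunT k) (aeval y Q) = aeval c.p Q * tL k ^ n := by
    rw [← aeval_algebraMap_apply]
    refine (congrArg (fun z => aeval z Q) (funext hy)).trans ?_
    rw [aeval_mul_of_isHomogeneous _ _ hQ, mul_comm]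
  have hmem {n : ℕ} {Q : MvPolynomial (Fin 3) k} (hQ : Q ∈ PS2.Forms k (n * d * G.rank)) :
      a * aeval y Q ∈ twistedSections G.incl D n (n * d * G.rank) := by
    refine G.mem_twistedSections_of_charts hD hcyc c (b := algebraMap _ _ a * aeval c.p Q) ?_ fun m h => ?_
    · rw [map_mul, hQy hQ, ← mul_assoc]
    · rw [mul_div_assoc]
      refine mul_mem_FL ((c.mem_OL m h _).mpr ⟨n * d, Q, ?_, rfl⟩)
      rw [hr, mul_one] at hQ
      exact hQ
  -- The map from forms to jets of a times their value is injective by condition 3 and by algebraic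
  -- independence in the homogeneous sense. Equal dimensions make it surjective, so nothing else
  -- lies in the space of twisted sections.
  have hall (n : ℕ) {a' : PS2 k} (ha' : a' ∈ twistedSections G.incl D n (n * d * G.rank)) :
      ∃ Q ∈ PS2.Forms k (n * d * G.rank), a' = a * aeval y Q := by
    set M := n * d * G.rank
    let L : PS2.Forms k M →ₗ[k] (PS2.Idx M → k) :=
      PS2.jet M ∘ₗ LinearMap.mulLeft k a ∘ₗ (aeval y).toLinearMap ∘ₗ (PS2.Forms k M).subtype
    have hL (Q) : L Q = PS2.jet M (a * aeval y Q.1) := rfl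
    have heq {x x' : PS2 k} (hx : x ∈ twistedSections G.incl D n M) (hx' : x' ∈ twistedSections G.incl D n M)
        (h : PS2.jet M x = PS2.jet M x') : x = x' := by
      apply (hbij n).injOn hx hx'
      rw [Ideal.Quotient.mk_eq_mk_iff_sub_mem, ← PS2.jet_eq_zero_iff, map_sub, h, sub_self]
    have hLi : Function.Injective L := by
      rw [← LinearMap.ker_eq_bot, LinearMap.ker_eq_bot']
      intro Q hQ
      have h1 : a * aeval y Q.1 = a * aeval y 0 := heq (hmem Q.2) (hmem (Submodule.zero_mem _)) (by
        rw [← hL, hQ, map_zero, mul_zero, map_zero])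
      rw [map_zero, mul_zero, mul_eq_zero] at h1
      have h2 := h1.resolve_left hc.isUnit.ne_zero
      have h3 := hQy Q.2
      rw [h2, map_zero, eq_comm, mul_eq_zero] at h3
      exact Subtype.ext (hinj M Q.1 Q.2 (h3.resolve_right (pow_ne_zero _ ht)))
    have hLs : Function.Surjective L := by
      refine (LinearMap.injective_iff_surjective_of_finrank_eq_finrank ?_).mp hLi
      rw [PS2.finrank_forms, Module.finrank_fintype_fun_eq_card]
    obtain ⟨Q, hQ⟩ := hLs (PS2.jet M a')
    exact ⟨Q.1, Q.2, heq ha' (hmem Q.2) (by rw [← hL, hQ])⟩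
  refine isIso_of_div_mem_OL hc (div_mem_OL_of_charts c fun m h z hz => ?_)
  have hext (m') : ∃ n, ∀ h' : genPt G.j ∈ (c.U m').1, (c.p m / c.p m') ^ n * z ∈ FL G.incl h' := by
    by_cases h' : genPt G.j ∈ (c.U m').1
    · obtain ⟨r, hr, hrU⟩ := c.inter m m' h'
      have hg : genPt G.j ∈ G.X.basicOpen r := by rw [hrU]; exact ⟨h, h'⟩
      obtain ⟨n, hn⟩ := exists_pow_mul_mem_FL G.incl (c.U m').2 r hg (FL_mono G.incl hg (hrU.le.trans inf_le_left) hz)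
      exact ⟨n, fun _ => by rw [← hr]; exact hn⟩
    · exact ⟨0, fun h'' => absurd h'' h'⟩
  choose ν hν using hext
  -- The sum bounds every ν m', and n d is at least n since d > 0, so one twist clears the
  -- denominators on all charts.
  let n := ∑ m', ν m'
  have hle (m') : ν m' ≤ n * d :=
    (Finset.single_le_sum (fun _ _ => Nat.zero_le _) (Finset.mem_univ m')).trans (Nat.le_mul_of_pos_right _ hd)
  have hb (m') (h' : genPt G.j ∈ (c.U m').1) : (c.p m ^ (n * d) * z) / c.p m' ^ (n * d) ∈ FL G.incl h' := by
    have h1 : c.p m / c.p m' ∈ OL G.j h' := (c.mem_OL m' h' _).mpr ⟨1, MvPolynomial.X m, isHomogeneous_X k m, by simp⟩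
    have h2 := FL_mul_mem G.incl (pow_mem h1 (n * d - ν m')) (hν m' h')
    rw [← mul_assoc, ← pow_add, Nat.sub_add_cancel (hle m'), div_pow] at h2
    convert h2 using 1
    ring
  have hpm := c.ne_zero m h
  obtain ⟨x, hx⟩ := exists_eq_of_mem_FL G.incl hm₀ (hb m₀ hm₀')
  have hxw : algebraMap (PS2 k) (FunT k) (x * w ^ (n * d)) = (c.p m ^ (n * d) * z) * tL k ^ (n * d * G.rank) := by
    rw [map_mul, map_pow, hx, hw, hr, mul_one, mul_pow, mul_comm (tL k ^ _), ← mul_assoc,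
      div_mul_cancel₀ _ (pow_ne_zero _ (c.ne_zero m₀ hm₀'))]
  obtain ⟨Q, hQ, hxQ⟩ := hall n (G.mem_twistedSections_of_charts hD hcyc c hxw hb)
  rw [hxQ, map_mul, hQy hQ, ← mul_assoc] at hxw
  have h1 := mul_right_cancel₀ (pow_ne_zero _ ht) hxw
  rw [hr, mul_one] at hQ
  refine (c.mem_OL m h _).mpr ⟨n * d, Q, hQ, ?_⟩
  rw [div_eq_div_iff ha (pow_ne_zero _ hpm), mul_comm z, ← h1, mul_comm]

end GeometricDatum

end

/-! ### Gluing morphisms from inclusions of rings of rational functions. -/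

section

section
open CategoryTheory.Limits

variable {k : Type u} [Field k] {X Y : Scheme.{u}} (j : FormalT k ⟶ X)

/-- The morphism from the generic point of `T`. -/
def genericT (k : Type u) [Field k] : Spec (.of (FunT k)) ⟶ FormalT k :=
  (FormalT k).fromSpecStalk (genericPoint (FormalT k))

instance : IsDominant (genericT k) := by
  refine ⟨?_⟩
  have h1 : genericT k (IsLocalRing.closedPoint _) = genericPoint (FormalT k) := Scheme.fromSpecStalk_closedPoint
  have h2 : Dense {genericPoint (FormalT k)} := by
    rw [dense_iff_closure_eq]
    exact genericPoint_closure _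
  exact h2.mono (Set.singleton_subset_iff.mpr ⟨_, h1⟩)

lemma genericT_comp {U : X.Opens} (hU : IsAffineOpen U) (h : genPt j ∈ U) :
    genericT k ≫ j = Spec.map (CommRingCat.ofHom (pullL j h)) ≫ hU.fromSpec := by
  have h : j (genericPoint (FormalT k)) ∈ U := h
  rw [genericT, ← Scheme.SpecMap_stalkMap_fromSpecStalk, ← hU.fromSpecStalk_eq_fromSpecStalk h, IsAffineOpen.fromSpecStalk,
    ← Spec.map_comp_assoc, Scheme.Hom.germ_stalkMap]
  rfl

/-- A morphism to a separated scheme is determined by, and can be glued from, inclusions of rings of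
rational functions on `T`. -/
theorem exists_hom_of_OL_le [IsIntegral X] [Y.IsSeparated] [IsDominant j] (j' : FormalT k ⟶ Y) {ι : Type*} (U : ι → X.Opens)
    (V : ι → Y.Opens) (hU : ∀ m, IsAffineOpen (U m)) (hV : ∀ m, IsAffineOpen (V m)) (h : ∀ m, genPt j ∈ U m)
    (h' : ∀ m, genPt j' ∈ V m) (hcov : ∀ x, ∃ m, x ∈ U m) (hle : ∀ m, OL j' (h' m) ≤ OL j (h m)) :
    ∃ φ : X ⟶ Y, j ≫ φ = j' ∧ ∀ m, U m ≤ φ ⁻¹ᵁ V m := by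
  have hρ (m) : ∃ ρ : Γ(Y, V m) →+* Γ(X, U m), (pullL j (h m)).comp ρ = pullL j' (h' m) := by
    have hinj := pullL_injective (j := j) (h m)
    let e := RingEquiv.ofBijective (pullL j (h m)).rangeRestrict
      ⟨fun a b hab => hinj (congrArg Subtype.val hab), (pullL j (h m)).rangeRestrict_surjective⟩
    refine ⟨e.symm.toRingHom.comp ((pullL j' (h' m)).codRestrict (OL j (h m)) fun b => hle m ⟨b, rfl⟩), ?_⟩
    ext b
    exact congr($(e.apply_symm_apply ((pullL j' (h' m)).codRestrict (OL j (h m)) (fun b => hle m ⟨b, rfl⟩) b)).1)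
  choose ρ hρ using hρ
  let 𝒰 := X.openCoverOfIsOpenCover U (by
    rw [TopologicalSpace.IsOpenCover, eq_top_iff]
    intro x _
    exact TopologicalSpace.Opens.mem_iSup.mpr (hcov x))
  let φ (m : ι) : (U m).toScheme ⟶ Y := (hU m).isoSpec.hom ≫ Spec.map (CommRingCat.ofHom (ρ m)) ≫ (hV m).fromSpec
  let δ (m : ι) : Spec (.of (FunT k)) ⟶ (U m).toScheme := Spec.map (CommRingCat.ofHom (pullL j (h m))) ≫ (hU m).isoSpec.inv
  have hδφ (m) : δ m ≫ φ m = genericT k ≫ j' := by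
    simp only [δ, φ, Category.assoc, Iso.inv_hom_id_assoc]
    rw [← Spec.map_comp_assoc, ← CommRingCat.ofHom_comp, hρ, genericT_comp j' (hV m) (h' m)]
  have hδ (m) : δ m ≫ (U m).ι = genericT k ≫ j := (genericT_comp j (hU m) (h m)).symm
  have : IsDominant (genericT k ≫ j) := inferInstance
  -- Both morphisms agree on the generic point of T, which maps dominantly to the reduced overlap;
  -- separatedness of the target makes them equal.
  have hglue (x y : ι) : pullback.fst (U x).ι (U y).ι ≫ φ x = pullback.snd _ _ ≫ φ y := by
    let β : Spec (.of (FunT k)) ⟶ pullback (U x).ι (U y).ι := pullback.lift (δ x) (δ y) (by rw [hδ, hδ])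
    have hβ : β ≫ pullback.fst _ _ ≫ (U x).ι = genericT k ≫ j := by rw [pullback.lift_fst_assoc, hδ]
    have h1 : IsDominant (β ≫ pullback.fst _ _ ≫ (U x).ι) := by rw [hβ]; infer_instance
    have h2 : IsDominant β := IsDominant.of_comp_of_isOpenImmersion β (pullback.fst _ _ ≫ (U x).ι)
    have h3 : IsReduced (pullback (U x).ι (U y).ι) := isReduced_of_isOpenImmersion (pullback.fst _ _ ≫ (U x).ι)
    refine ext_of_isDominant β ?_
    rw [pullback.lift_fst_assoc, pullback.lift_snd_assoc, hδφ, hδφ]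
  let Φ := 𝒰.glueMorphisms φ hglue
  have hΦ (m : ι) : (U m).ι ≫ Φ = φ m := 𝒰.ι_glueMorphisms φ hglue m
  refine ⟨Φ, ?_, fun m x hx => ?_⟩
  · obtain ⟨m, -⟩ := hcov (genPt j)
    refine ext_of_isDominant (genericT k) ?_
    rw [← Category.assoc, ← hδ m, Category.assoc, hΦ, hδφ]
  · have h1 : Φ x = φ m ⟨x, hx⟩ := congr($(hΦ m) ⟨x, hx⟩)
    change Φ x ∈ V m
    rw [h1]
    exact (hV m).range_fromSpec.le ⟨_, rfl⟩

end

end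

/-! ### Morphisms from T to projective space given by coordinates. -/

section

section
variable {k : Type u} [Field k]

lemma genericT_eq : genericT k = Spec.map (CommRingCat.ofHom (algebraMap (PS2 k) (FunT k))) :=
  Spec.fromSpecStalk_eq (R := .of (PS2 k)) (genericPoint (FormalT k))

lemma pullL_of_fromSpec {X : Scheme.{u}} {U : X.Opens} (hU : IsAffineOpen U) (g : Γ(X, U) →+* PS2 k)
    (h : genPt (Spec.map (CommRingCat.ofHom g) ≫ hU.fromSpec) ∈ U) (b : Γ(X, U)) :
    pullL (Spec.map (CommRingCat.ofHom g) ≫ hU.fromSpec) h b = algebraMap _ _ (g b) := by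
  have h1 := genericT_comp _ hU h
  rw [genericT_eq, ← Spec.map_comp_assoc, cancel_mono, ← CommRingCat.ofHom_comp] at h1
  have h2 := Spec.map_injective h1
  exact congr($(h2.symm) b)

lemma genPt_mem_basicOpen_iff {X : Scheme.{u}} {j : FormalT k ⟶ X} {U : X.Opens} (h : genPt j ∈ U) (b : Γ(X, U)) :
    genPt j ∈ X.basicOpen b ↔ pullL j h b ≠ 0 := by
  have h1 : genPt j ∈ X.basicOpen b ↔ genericPoint (FormalT k) ∈ (FormalT k).basicOpen ((j.app U).hom b) := by
    have := Scheme.preimage_basicOpen j b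
    exact ⟨fun h => this.le h, fun h => this.ge h⟩
  rw [h1, ← isUnit_iff_ne_zero]
  exact (FormalT k).mem_basicOpen _ _ h

lemma AlgebraicGeometry.IsAffineOpen.mem_vanishingIdeal_iff {X : Scheme.{u}} (Z : TopologicalSpace.Closeds X) (U : X.affineOpens) (b : Γ(X, U)) :
    b ∈ (Scheme.IdealSheafData.vanishingIdeal Z).ideal U ↔ ∀ x ∈ U.1, x ∈ Z → x ∉ X.basicOpen b := by
  rw [Scheme.IdealSheafData.vanishingIdeal_ideal, PrimeSpectrum.mem_vanishingIdeal]
  have key (y : PrimeSpectrum Γ(X, U)) : b ∈ y.asIdeal ↔ U.2.fromSpec y ∉ X.basicOpen b := by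
    have h1 : U.2.fromSpec y ∈ X.basicOpen b ↔ y ∈ PrimeSpectrum.basicOpen b := by
      rw [← U.2.fromSpec_preimage_basicOpen]
      rfl
    rw [h1]
    exact not_not.symm
  constructor
  · intro h x hx hxZ
    obtain ⟨y, rfl⟩ := U.2.range_fromSpec.ge hx
    exact (key y).mp (h y hxZ)
  · intro h y hy
    exact (key y).mpr (h _ (U.2.range_fromSpec.le ⟨y, rfl⟩) hy)

/-- T₁ is integral, so a function vanishes on T₁ as soon as it vanishes at the image of its generic
point. -/
lemma curveIdeal_eq_vanishingIdeal_closure {X : Scheme.{u}} (j : FormalT k ⟶ X) [QuasiCompact j] :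
    curveIdeal j = Scheme.IdealSheafData.vanishingIdeal (TopologicalSpace.Closeds.closure {curvePt j}) := by
  refine Scheme.IdealSheafData.ext (funext fun U => ?_)
  ext b
  rw [mem_curveIdeal_iff_curvePt, IsAffineOpen.mem_vanishingIdeal_iff]
  constructor
  · intro h x hx hxZ hxb
    obtain ⟨y, hy, hy'⟩ := mem_closure_iff.mp (show x ∈ closure {curvePt j} from hxZ) _ (X.basicOpen b).2 hxb
    obtain rfl := Set.mem_singleton_iff.mp hy'
    exact h hy
  · intro h hη
    exact h _ (X.basicOpen_le _ hη) (subset_closure rfl) hη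

end

namespace PSpace
open MvPolynomial
variable {k : Type u} [Field k] {N : ℕ}

instance : IsReduced (PSpace k N) := by
  have (x : PSpace k N) : _root_.IsReduced ((PSpace k N).presheaf.stalk x) := by
    have hxp : x.asHomogeneousIdeal.toIdeal.IsPrime := x.isPrime
    have : _root_.IsReduced (Localization.AtPrime x.asHomogeneousIdeal.toIdeal) := inferInstance
    have h1 : _root_.IsReduced (HomogeneousLocalization.AtPrime (homogeneousSubmodule (Fin (N + 1)) k) x.asHomogeneousIdeal.toIdeal) :=
      isReduced_of_injective (algebraMap _ (Localization.AtPrime x.asHomogeneousIdeal.toIdeal))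
        (HomogeneousLocalization.val_injective _)
    exact isReduced_of_injective (Proj.stalkIso' (homogeneousSubmodule (Fin (N + 1)) k) x)
      (Proj.stalkIso' (homogeneousSubmodule (Fin (N + 1)) k) x).injective
  exact isReduced_of_isReduced_stalk _

/-- Irreducibility is inherited from T through its dense image. -/
lemma isIntegral_of_isDominant (J : FormalT k ⟶ PSpace k N) [IsDominant J] : IsIntegral (PSpace k N) := by
  have h1 : IsIrreducible (Set.range J) := by
    rw [← Set.image_univ]
    exact (IrreducibleSpace.isIrreducible_univ (FormalT k)).image _ J.continuous.continuousOn
  have h2 : IsIrreducible (Set.univ : Set (PSpace k N)) := by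
    rw [← J.denseRange.closure_range]
    exact h1.closure
  have : IrreducibleSpace (PSpace k N) := (irreducibleSpace_def _).mpr h2
  exact isIntegral_of_irreducibleSpace_of_isReduced _

/-- The evaluation of fractions of degree `0` with denominator `x_m` at a vector `c` such that `c_m` is a unit. -/
def evalAway (c : Fin (N + 1) → PS2 k) {m : Fin (N + 1)} (hm : IsUnit (c m)) :
    HomogeneousLocalization.Away (homogeneousSubmodule (Fin (N + 1)) k) (X m) →+* PS2 k :=
  (IsLocalization.Away.lift (S := Localization.Away (X m : MvPolynomial (Fin (N + 1)) k)) (X m)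
    (g := (aeval c : MvPolynomial (Fin (N + 1)) k →ₐ[k] PS2 k).toRingHom) (by simpa using hm)).comp
    (algebraMap (HomogeneousLocalization.Away (homogeneousSubmodule (Fin (N + 1)) k) (X m : MvPolynomial (Fin (N + 1)) k))
      (Localization.Away (X m : MvPolynomial (Fin (N + 1)) k)))

variable (c : Fin (N + 1) → PS2 k) {m : Fin (N + 1)} (hm : IsUnit (c m))

lemma evalAway_fromZero (a : k) : evalAway c hm (HomogeneousLocalization.fromZeroRingHom _ _
    (algebraMap k (homogeneousSubmodule (Fin (N + 1)) k 0) a)) = algebraMap k (PS2 k) a := by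
  have hm' : IsUnit ((aeval c : MvPolynomial (Fin (N + 1)) k →ₐ[k] PS2 k).toRingHom (X m)) := by simpa using hm
  refine Eq.trans (IsLocalization.Away.lift_eq (S := Localization.Away (X m : MvPolynomial (Fin (N + 1)) k)) (X m) hm' (C a)) ?_
  exact aeval_C c a

lemma evalAway_mk_mul {n : ℕ} {Q : MvPolynomial (Fin (N + 1)) k} (hQ : Q ∈ homogeneousSubmodule (Fin (N + 1)) k (n • 1)) :
    evalAway c hm (.mk _ (X_mem m) n Q hQ) * c m ^ n = aeval c Q := by
  have h1 : (HomogeneousLocalization.Away.mk (homogeneousSubmodule (Fin (N + 1)) k) (X_mem m) n Q hQ).val *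
      algebraMap (MvPolynomial (Fin (N + 1)) k) (Localization.Away (X m : MvPolynomial (Fin (N + 1)) k)) (X m ^ n) =
        algebraMap (MvPolynomial (Fin (N + 1)) k) (Localization.Away (X m : MvPolynomial (Fin (N + 1)) k)) Q := by
    rw [HomogeneousLocalization.Away.val_mk, Localization.mk_eq_mk']
    exact IsLocalization.mk'_spec _ Q _
  have hm' : IsUnit ((aeval c : MvPolynomial (Fin (N + 1)) k →ₐ[k] PS2 k).toRingHom (X m)) := by simpa using hm
  have h2 := congrArg (IsLocalization.Away.lift (S := Localization.Away (X m : MvPolynomial (Fin (N + 1)) k)) (X m) hm') h1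
  rw [map_mul, IsLocalization.Away.lift_eq, IsLocalization.Away.lift_eq] at h2
  have h3 : (aeval c : MvPolynomial (Fin (N + 1)) k →ₐ[k] PS2 k).toRingHom (X m ^ n) = c m ^ n := by simp
  rw [h3] at h2
  exact h2

/-- The morphism from `T` to projective space with homogeneous coordinates `c`. -/
def ofCoords : FormalT k ⟶ PSpace k N :=
  Spec.map (CommRingCat.ofHom (evalAway c hm)) ≫ Proj.awayι (homogeneousSubmodule (Fin (N + 1)) k) (X m) (X_mem m) one_pos

lemma ofCoords_toSpec : ofCoords c hm ≫ PSpace.toSpec k N = Spec.map (CommRingCat.ofHom (algebraMap k (PS2 k))) := by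
  rw [ofCoords, PSpace.toSpec, Category.assoc, Proj.awayι_toSpecZero_assoc, ← Spec.map_comp, ← Spec.map_comp,
    ← CommRingCat.ofHom_comp, ← CommRingCat.ofHom_comp]
  congr 2
  exact RingHom.ext (evalAway_fromZero c hm)

lemma basePoint_ofCoords_mem : basePoint (ofCoords c hm) ∈ D (X m : MvPolynomial (Fin (N + 1)) k) := by
  have h := Proj.opensRange_awayι (homogeneousSubmodule (Fin (N + 1)) k) (X m) (X_mem m) one_pos
  exact h.le ⟨_, rfl⟩

lemma awayι_eq : Proj.awayι (homogeneousSubmodule (Fin (N + 1)) k) (X m) (X_mem m) one_pos =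
    Spec.map (Proj.basicOpenIsoAway (homogeneousSubmodule (Fin (N + 1)) k) (X m) (X_mem m) one_pos).inv ≫
      (isAffineOpen_D (X_mem (k := k) m) one_pos).fromSpec := by
  rw [Proj.awayι, Iso.inv_comp_eq, Proj.basicOpenIsoSpec_hom, Proj.basicOpenToSpec, Category.assoc, ← Spec.map_comp_assoc,
    ← Proj.basicOpenIsoAway_hom _ _ (X_mem m) one_pos, Iso.inv_hom_id, Spec.map_id, Category.id_comp]
  exact ((isAffineOpen_D (X_mem (k := k) m) one_pos).isoSpec.hom_inv_id_assoc _).symm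

lemma fracL_ofCoords (h : genPt (ofCoords c hm) ∈ D (X m)) (z) : fracL (ofCoords c hm) h z = algebraMap _ _ (evalAway c hm z) := by
  have h1 : ofCoords c hm = Spec.map (CommRingCat.ofHom ((evalAway c hm).comp
      (Proj.basicOpenIsoAway (homogeneousSubmodule (Fin (N + 1)) k) (X m) (X_mem m) one_pos).inv.hom)) ≫
        (isAffineOpen_D (X_mem (k := k) m) one_pos).fromSpec := by
    rw [ofCoords, awayι_eq, ← Spec.map_comp_assoc]
    rfl
  have h2 (J : FormalT k ⟶ PSpace k N) (hJ : J = Spec.map (CommRingCat.ofHom ((evalAway c hm).comp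
      (Proj.basicOpenIsoAway (homogeneousSubmodule (Fin (N + 1)) k) (X m) (X_mem m) one_pos).inv.hom)) ≫
        (isAffineOpen_D (X_mem (k := k) m) one_pos).fromSpec) (h : genPt J ∈ D (X m)) :
        fracL J h z = algebraMap _ _ (evalAway c hm z) := by
    subst hJ
    refine (pullL_of_fromSpec (isAffineOpen_D (X_mem (k := k) m) one_pos) _ h _).trans ?_
    rw [RingHom.comp_apply]
    congr 2
    exact (Proj.basicOpenIsoAway (homogeneousSubmodule (Fin (N + 1)) k) (X m) (X_mem m) one_pos).hom_inv_id_apply z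
  exact h2 _ h1 h

lemma isCoord_ofCoords : IsCoord (ofCoords c hm) (fun i => algebraMap (PS2 k) (FunT k) (c i)) := by
  have h := genPt_mem_of_basePoint_mem _ (basePoint_ofCoords_mem c hm)
  have h0 : algebraMap (PS2 k) (FunT k) (c m) ≠ 0 := (hm.map _).ne_zero
  have h1 := (isCoord_coord (ofCoords_toSpec c hm) (X_mem m) h).mul h0
  convert h1 using 2 with i
  rw [coord, fracL_ofCoords, mul_comm, ← map_mul]
  congr 1
  have := evalAway_mk_mul c hm (n := 1) (Q := X i) (by simpa using X_mem i)
  rw [pow_one, aeval_X] at this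
  exact this.symm

lemma toPS2_frac_mul {n : ℕ} {Q : MvPolynomial (Fin (N + 1)) k} (hQ : Q ∈ homogeneousSubmodule (Fin (N + 1)) k (n • 1)) :
    toPS2 (ofCoords c hm) (basePoint_ofCoords_mem c hm) (frac (X_mem m) hQ) * c m ^ n = aeval c Q := by
  apply IsFractionRing.injective (PS2 k) (FunT k)
  have h := genPt_mem_of_basePoint_mem _ (basePoint_ofCoords_mem c hm)
  have h1 := (isCoord_ofCoords c hm).pullL_frac (X_mem m) h hQ
  have h0 : algebraMap (PS2 k) (FunT k) (c m) ≠ 0 := (hm.map _).ne_zero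
  rw [map_mul, algebraMap_toPS2, h1, aeval_X, map_pow, div_mul_cancel₀ _ (pow_ne_zero _ h0)]
  exact aeval_algebraMap_apply (FunT k) c Q

lemma mem_genPt_ofCoords {n : ℕ} {Q : MvPolynomial (Fin (N + 1)) k} (hQ : Q ∈ homogeneousSubmodule (Fin (N + 1)) k n) :
    Q ∈ (genPt (ofCoords c hm)).asHomogeneousIdeal ↔ aeval c Q = 0 := by
  have hQ' : Q ∈ homogeneousSubmodule (Fin (N + 1)) k (n • 1) := by simpa using hQ
  have hb := basePoint_ofCoords_mem c hm
  have h := genPt_mem_of_basePoint_mem _ hb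
  rw [← not_iff_not, ← mem_basicOpen_frac (X_mem m) hQ' h, genPt_mem_basicOpen_iff h, ← algebraMap_toPS2 _ hb,
    ← toPS2_frac_mul c hm hQ']
  simp [hm.ne_zero]

lemma mem_curvePt_ofCoords {n : ℕ} {Q : MvPolynomial (Fin (N + 1)) k} (hQ : Q ∈ homogeneousSubmodule (Fin (N + 1)) k n) :
    Q ∈ (curvePt (ofCoords c hm)).asHomogeneousIdeal ↔ PS2.t k ∣ aeval c Q := by
  have hQ' : Q ∈ homogeneousSubmodule (Fin (N + 1)) k (n • 1) := by simpa using hQ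
  have hb := basePoint_ofCoords_mem c hm
  have hU := isAffineOpen_D (X_mem (k := k) m) one_pos
  have h : curvePt (ofCoords c hm) ∈ D (X m : MvPolynomial (Fin (N + 1)) k) := by
    have h1 := mem_curveIdeal_iff (ofCoords c hm) (U := ⟨_, hU⟩) hb 1
    rw [mem_curveIdeal_iff_curvePt, map_one] at h1
    by_contra h2
    exact PS2.t_prime.not_isUnit (isUnit_of_dvd_one (h1.mp fun h3 => h2 ((PSpace k N).basicOpen_le _ h3)))
  have h1 := mem_curveIdeal_iff (ofCoords c hm) (U := ⟨_, hU⟩) hb (frac (X_mem m) hQ')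
  rw [mem_curveIdeal_iff_curvePt, mem_basicOpen_frac (X_mem m) hQ' h, not_not] at h1
  rw [h1, ← toPS2_frac_mul c hm hQ', (hm.pow n).dvd_mul_right]

lemma le_of_forall_homogeneous {x y : PSpace k N} (h : ∀ (n : ℕ), ∀ Q ∈ homogeneousSubmodule (Fin (N + 1)) k n,
    Q ∈ x.asHomogeneousIdeal → Q ∈ y.asHomogeneousIdeal) : y ∈ closure {x} := by
  refine (ProjectiveSpectrum.le_iff_mem_closure (homogeneousSubmodule (Fin (N + 1)) k) x y).mp fun Q hQ => ?_
  have h1 (n : ℕ) : ((DirectSum.decompose (homogeneousSubmodule (Fin (N + 1)) k) Q n : homogeneousSubmodule (Fin (N + 1)) k n) :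
      MvPolynomial (Fin (N + 1)) k) ∈ y.asHomogeneousIdeal.toIdeal :=
    h n _ (DirectSum.decompose (homogeneousSubmodule (Fin (N + 1)) k) Q n).2 (x.asHomogeneousIdeal.isHomogeneous n hQ)
  change Q ∈ y.asHomogeneousIdeal.toIdeal
  classical
  rw [← DirectSum.sum_support_decompose (homogeneousSubmodule (Fin (N + 1)) k) Q]
  exact Ideal.sum_mem _ fun n _ => h1 n

lemma isDominant_ofCoords (H : ∀ (n : ℕ), ∀ Q ∈ homogeneousSubmodule (Fin (N + 1)) k n, aeval c Q = 0 → Q = 0) :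
    IsDominant (ofCoords c hm) := by
  have h1 (y : PSpace k N) : y ∈ closure {genPt (ofCoords c hm)} := le_of_forall_homogeneous fun n Q hQ h => by
    rw [H n Q hQ ((mem_genPt_ofCoords c hm hQ).mp h)]
    exact y.asHomogeneousIdeal.toIdeal.zero_mem
  refine ⟨fun y => closure_mono ?_ (h1 y)⟩
  rintro _ rfl
  exact ⟨_, rfl⟩

/-- The forms in the homogeneous prime of the generic point of C are those whose value at c is
divisible by t. By hypothesis they are exactly the homogeneous multiples of l. -/
lemma curveIdeal_ofCoords {l : MvPolynomial (Fin (N + 1)) k} (hl : l ∈ homogeneousSubmodule (Fin (N + 1)) k 1) (hlt : aeval c l = PS2.t k)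
    (H : ∀ (n : ℕ), ∀ Q ∈ homogeneousSubmodule (Fin (N + 1)) k n, PS2.t k ∣ aeval c Q → l ∣ Q) :
    curveIdeal (ofCoords c hm) = hyperplane l := by
  rw [curveIdeal_eq_vanishingIdeal_closure, hyperplane]
  congr 1
  ext y
  constructor
  · intro hy
    have h1 := (ProjectiveSpectrum.le_iff_mem_closure (homogeneousSubmodule (Fin (N + 1)) k) (curvePt (ofCoords c hm)) y).mpr hy
    refine Set.singleton_subset_iff.mpr (h1 ((mem_curvePt_ofCoords c hm hl).mpr ?_))
    rw [hlt]
  · intro hy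
    refine le_of_forall_homogeneous fun n Q hQ h => ?_
    exact Ideal.mem_of_dvd _ (H n Q hQ ((mem_curvePt_ofCoords c hm hQ).mp h)) (Set.singleton_subset_iff.mp hy)

end PSpace

end

/-! ### The filtration by pole order along t = 0 when O_X = F. -/

section

section
open MvPolynomial
variable {k : Type u} [Field k]

/-- The quotient by t lies one step lower in the filtration, hence is the value of a form of degree
one less. Forms are determined by their values, so the divisibility lifts to forms. In degree zero a
constant divisible by t vanishes. -/
lemma PS2.FilteredSections.X_dvd_of_t_dvd {W : ℕ → Submodule k (PS2 k)} (hW : PS2.FilteredSections W) {x y : PS2 k}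
    (hx : x - PS2.u k ∈ PS2.maxIdeal k ^ 2) (hy : y - 1 ∈ PS2.maxIdeal k ^ 2)
    (H : ∀ N f, f ∈ W N ↔ ∃ Q ∈ PS2.Forms k N, PS2.evalAt x y Q = f) {N : ℕ} {Q : MvPolynomial (Fin 3) k}
    (hQ : Q ∈ PS2.Forms k N) (h : PS2.t k ∣ PS2.evalAt x y Q) : X 2 ∣ Q := by
  obtain ⟨f, hf⟩ := h
  cases N with
  | zero =>
    obtain ⟨c, rfl⟩ : ∃ c, Q = C c := ⟨_, totalDegree_eq_zero_iff_eq_C.mp (by simpa using IsHomogeneous.totalDegree_le hQ)⟩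
    have h1 : c = 0 := by
      have h2 : MvPowerSeries.constantCoeff (PS2.evalAt x y (C c)) = c := by
        rw [PS2.evalAt, aeval_C]
        exact MvPowerSeries.constantCoeff_C c
      rw [hf, map_mul, PS2.t, MvPowerSeries.constantCoeff_X, zero_mul] at h2
      exact h2.symm
    rw [h1, C_0]
    exact dvd_zero _
  | succ N =>
    obtain ⟨Q', hQ', rfl⟩ := (H N f).mp (hW.of_t_mul_mem ((H _ _).mpr ⟨Q, hQ, hf⟩))
    refine ⟨Q', ?_⟩
    rw [← sub_eq_zero]
    refine PS2.evalAt_injective hx hy (N := N + 1) (Submodule.sub_mem _ hQ ?_) ?_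
    · rw [add_comm N]
      exact (isHomogeneous_X k (2 : Fin 3)).mul hQ'
    · rw [map_sub, hf, map_mul]
      simp [PS2.evalAt]

namespace AffineCharts
variable {X : Scheme.{u}} {j : FormalT k ⟶ X} {E : X.IdealSheafData} {N : ℕ} (c : AffineCharts j E N)

/-- The sections of `𝒪_X(nE)`, as rational functions on `T`. -/
def sections (n : ℕ) : Submodule k (FunT k) where
  carrier := {b | ∀ m (h : genPt j ∈ (c.U m).1), b / c.p m ^ n ∈ OL j h}
  add_mem' ha hb m h := by
    rw [add_div]
    exact add_mem (ha m h) (hb m h)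
  zero_mem' m h := by
    rw [zero_div]
    exact zero_mem _
  smul_mem' a b hb m h := by
    have h1 : algebraMap k (FunT k) a ∈ OL j h := (c.mem_OL m h _).mpr ⟨0, C a, isHomogeneous_C _ _, by simp⟩
    rw [Algebra.smul_def, mul_div_assoc]
    exact mul_mem h1 (hb m h)

variable {c}

lemma mul_mem_sections {n m : ℕ} {a b : FunT k} (ha : a ∈ c.sections n) (hb : b ∈ c.sections m) : a * b ∈ c.sections (n + m) := by
  intro i h
  rw [pow_add, mul_div_mul_comm]
  exact mul_mem (ha i h) (hb i h)

lemma aeval_mem_sections {n : ℕ} {Q : MvPolynomial (Fin (N + 1)) k} (hQ : Q ∈ homogeneousSubmodule (Fin (N + 1)) k n) :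
    aeval c.p Q ∈ c.sections n :=
  fun m h => (c.mem_OL m h _).mpr ⟨n, Q, hQ, rfl⟩

lemma one_mem_sections (n : ℕ) : 1 ∈ c.sections n := by
  have h1 := aeval_mem_sections (c := c) (n := n) (Q := c.l ^ n) (by simpa using SetLike.pow_mem_graded n c.l_mem)
  rwa [map_pow, c.l_eq, one_pow] at h1

lemma p_mem_sections (m : Fin (N + 1)) : c.p m ∈ c.sections 1 := by
  simpa using aeval_mem_sections (c := c) (n := 1) (Q := MvPolynomial.X m) (isHomogeneous_X k m)

lemma sections_mono {n m : ℕ} (h : n ≤ m) : c.sections n ≤ c.sections m := by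
  intro b hb
  have := mul_mem_sections hb (one_mem_sections (c := c) (m - n))
  rwa [mul_one, Nat.add_sub_cancel' h] at this

lemma mem_OL_iff_exists_sections {m : Fin (N + 1)} (h : genPt j ∈ (c.U m).1) {z : FunT k} :
    z ∈ OL j h ↔ ∃ n, ∃ b ∈ c.sections n, z = b / c.p m ^ n := by
  constructor
  · intro hz
    obtain ⟨n, Q, hQ, rfl⟩ := (c.mem_OL m h z).mp hz
    exact ⟨n, _, aeval_mem_sections hQ, rfl⟩
  · rintro ⟨n, b, hb, rfl⟩
    exact hb m h

/-- The space of `f ∈ R` such that `f t⁻ᴹ` is a section of some `𝒪_X(nE)`. -/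
def filtration (c : AffineCharts j E N) (M : ℕ) : Submodule k (PS2 k) where
  carrier := {f | ∃ n, algebraMap (PS2 k) (FunT k) f / tL k ^ M ∈ c.sections n}
  add_mem' := by
    rintro a b ⟨n, hn⟩ ⟨m, hm⟩
    refine ⟨max n m, ?_⟩
    rw [map_add, add_div]
    exact add_mem (sections_mono (le_max_left _ _) hn) (sections_mono (le_max_right _ _) hm)
  zero_mem' := ⟨0, by rw [map_zero, zero_div]; exact zero_mem _⟩
  smul_mem' := by
    rintro a f ⟨n, hn⟩
    refine ⟨n, ?_⟩
    have h1 : algebraMap (PS2 k) (FunT k) (a • f) = a • algebraMap (PS2 k) (FunT k) f := by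
      rw [Algebra.smul_def, Algebra.smul_def, map_mul]
      rfl
    rw [h1, smul_div_assoc]
    exact Submodule.smul_mem _ _ hn

end AffineCharts
end

namespace GeometricDatum
open MvPolynomial
variable {k : Type u} [Field k] {G : GeometricDatum k} {e : OMod G.X ⟶ G.F} {D : G.X.IdealSheafData} {N : ℕ}
  (c : AffineCharts G.j D N)

lemma div_mem_OL_of_mem_FL [IsIso e] (hc : G.IsCanonicalEmbedding e) {U : G.X.Opens} (h : genPt G.j ∈ U) {z : FunT k} (hz : z ∈ FL G.incl h) :
    z / algebraMap _ _ (G.valueAtOne e) ∈ OL G.j h := by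
  obtain ⟨m, rfl⟩ := hz
  have h1 : IsIso (Scheme.Modules.Hom.app e U) := Scheme.Modules.Hom.isIso_iff_isIso_app.mp inferInstance U
  obtain ⟨b, hb⟩ := (ConcreteCategory.bijective_of_isIso (Scheme.Modules.Hom.app e U)).2 m
  have ha : algebraMap (PS2 k) (FunT k) (G.valueAtOne e) ≠ 0 := (hc.isUnit.map _).ne_zero
  refine ⟨b, (eq_div_iff ha).mpr ?_⟩
  exact (modL_app G e h b).symm.trans (congrArg (modL G.incl h) hb)

/-- On a chart D has the equation 1/p_m, and multiplication by a identifies O_X with F, so both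
sides express regularity of f t^(-M) p_m^(-n). -/
lemma mul_mem_twistedSections_iff [IsIso e] (hc : G.IsCanonicalEmbedding e) (n M : ℕ) (f : PS2 k) :
    G.valueAtOne e * f ∈ twistedSections G.incl D n M ↔ algebraMap (PS2 k) (FunT k) f / tL k ^ M ∈ c.sections n := by
  have ha : algebraMap (PS2 k) (FunT k) (G.valueAtOne e) ≠ 0 := (hc.isUnit.map _).ne_zero
  constructor
  · intro H m h
    obtain ⟨g, hg, hgp⟩ := c.exists_eq m h
    have h1 := div_mem_OL_of_mem_FL hc h ((mem_twistedSections_iff G.incl D n M _).mp H _ g h hg)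
    rw [hgp, map_mul, inv_pow] at h1
    have hp := c.ne_zero m h
    convert h1 using 1
    field_simp
  · intro H
    refine mem_twistedSections_of_local G.incl D n M _ fun x => ?_
    obtain ⟨m, hm⟩ := c.exists_mem x
    have h := genPt_mem G.j hm
    obtain ⟨g, hg, hgp⟩ := c.exists_eq m h
    refine ⟨c.U m, g, h, hm, hg, ?_⟩
    have h1 := mul_mem_FL (e := e) (H m h)
    have hp := c.ne_zero m h
    rw [hgp, map_mul, inv_pow]
    convert h1 using 1
    field_simp

/-- Near the point `P`, the coordinates have a pole of order `d` along `t = 0`. -/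
lemma exists_isUnit_eq_p (hD : IsEffectiveCartier D) {d : ℕ} (hcyc : HasCycle D (curveIdeal G.j) d) (hr : G.rank = 1)
    {m : Fin (N + 1)} (hm : basePoint G.j ∈ (c.U m).1) :
    ∃ w : PS2 k, IsUnit w ∧ algebraMap _ (FunT k) w * c.p m * tL k ^ d = 1 := by
  have hm' := genPt_mem_of_basePoint_mem G.j hm
  obtain ⟨f, hf, hfp⟩ := c.exists_eq m hm'
  obtain ⟨V, hV, g, -, hg, -⟩ := G.exists_generators
  obtain ⟨W, hWa, hW, hWUV⟩ := exists_isAffineOpen_mem_and_subset (x := basePoint G.j) (U := (c.U m).1 ⊓ V.1) ⟨hm, hV⟩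
  have hWU : W ≤ (c.U m).1 := hWUV.trans inf_le_left
  have hWV : W ≤ V.1 := hWUV.trans inf_le_right
  have hg' := ideal_eq_span_restrict _ (W := ⟨W, hWa⟩) hWV hg
  have hf' := ideal_eq_span_restrict _ (W := ⟨W, hWa⟩) hWU hf
  obtain ⟨v, hv, hfv⟩ := G.exists_eq_unit_mul_pow hD hcyc (genPt_mem_of_basePoint_mem G.j hW) hf' hg'
  obtain ⟨w, hw, hgw⟩ := G.exists_toPS2_eq (U := ⟨W, hWa⟩) hW hg'
  have h1 := congrArg (toPS2 G.j hW) hfv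
  have h2 : toPS2 G.j hW (G.X.presheaf.map (homOfLE hWU).op f) = _ := toPS2_map G.j hW hWU f
  rw [map_mul, map_pow, hgw, h2, hr, pow_one] at h1
  have h3 := hfp
  rw [← algebraMap_toPS2 G.j hm, h1, mul_pow, ← mul_assoc, map_mul, map_pow] at h3
  refine ⟨_, (hv.map (toPS2 G.j hW)).mul (hw.pow d), ?_⟩
  have h4 := c.ne_zero m hm'
  have h5 : algebraMap (PS2 k) (FunT k) (PS2.t k) = tL k := rfl
  rw [h5] at h3
  rw [mul_right_comm, h3, inv_mul_cancel₀ h4]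

/-- At P the quotient of b by p_m^n is a power series, and p_m is a unit times t^(-d). -/
lemma exists_eq_mul_of_mem_sections (hD : IsEffectiveCartier D) {d : ℕ} (hcyc : HasCycle D (curveIdeal G.j) d) (hr : G.rank = 1)
    {n : ℕ} {b : FunT k} (hb : b ∈ c.sections n) : ∃ f : PS2 k, algebraMap _ (FunT k) f / tL k ^ (n * d) = b := by
  obtain ⟨m, hm⟩ := c.exists_mem (basePoint G.j)
  have hm' := genPt_mem_of_basePoint_mem G.j hm
  obtain ⟨w, hw, hwp⟩ := exists_isUnit_eq_p c hD hcyc hr hm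
  obtain ⟨f, hf⟩ := exists_eq_of_mem_OL hm (hb m hm')
  obtain ⟨w', hww'⟩ := hw.exists_right_inv
  refine ⟨f * w' ^ n, ?_⟩
  have h1 := congrArg (algebraMap (PS2 k) (FunT k)) hww'
  rw [map_mul, map_one] at h1
  have h2 := c.ne_zero m hm'
  have h3 : algebraMap (PS2 k) (FunT k) w ≠ 0 := left_ne_zero_of_mul_eq_one h1
  have h4 : algebraMap (PS2 k) (FunT k) w' = c.p m * tL k ^ d := by
    apply mul_left_cancel₀ h3
    rw [h1, ← mul_assoc, hwp]
  have ht := tL_ne_zero (k := k)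
  rw [map_mul, map_pow, hf, h4, mul_pow, ← pow_mul, mul_comm d n]
  field_simp

variable (hc : G.IsCanonicalEmbedding e) {d : ℕ} (hd : 0 < d)
  (hbij : ∀ n : ℕ, Set.BijOn (Ideal.Quotient.mk (PS2.maxIdeal k ^ (n * d + 1)))
      (twistedSections G.incl D n (n * d)) Set.univ)

include hc hd hbij

/-- Everything except `eq_zero` is formal; that property is the injectivity in condition 3. -/
lemma filteredSections [IsIso e] : PS2.FilteredSections c.filtration where
  one_mem := ⟨0, by simpa using AffineCharts.one_mem_sections 0⟩
  mul_mem := by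
    rintro N M f g ⟨n, hn⟩ ⟨m, hm⟩
    refine ⟨n + m, ?_⟩
    rw [map_mul, pow_add, mul_div_mul_comm]
    exact AffineCharts.mul_mem_sections hn hm
  t_mem := ⟨0, by
    have h1 : algebraMap (PS2 k) (FunT k) (PS2.t k) / tL k ^ 1 = 1 := by
      rw [pow_one]
      exact div_self tL_ne_zero
    rw [h1]
    exact AffineCharts.one_mem_sections 0⟩
  of_t_mul_mem := by
    rintro M f ⟨n, hn⟩
    refine ⟨n, ?_⟩
    have h1 : algebraMap (PS2 k) (FunT k) (PS2.t k) = tL k := rfl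
    rwa [map_mul, h1, pow_succ', mul_div_mul_left _ _ tL_ne_zero] at hn
  eq_zero := by
    rintro M f ⟨n, hn⟩ hf
    have ht := tL_ne_zero (k := k)
    -- Multiplication by t^(sd - M) raises the degree M and the order of vanishing equally, reducing
    -- to a degree s d in which condition 3 applies with n = s.
    let s := max n M
    have hsd : M ≤ s * d := (le_max_right n M).trans (Nat.le_mul_of_pos_right _ hd)
    have h1 : algebraMap (PS2 k) (FunT k) (f * PS2.t k ^ (s * d - M)) / tL k ^ (s * d) ∈ c.sections s := by
      have h2 : algebraMap (PS2 k) (FunT k) (PS2.t k) = tL k := rfl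
      convert AffineCharts.sections_mono (le_max_left n M) hn using 1
      rw [map_mul, map_pow, h2, div_eq_div_iff (pow_ne_zero _ ht) (pow_ne_zero _ ht), mul_assoc, ← pow_add, Nat.sub_add_cancel hsd]
    have h2 : f * PS2.t k ^ (s * d - M) ∈ PS2.maxIdeal k ^ (s * d + 1) := by
      have h3 := Ideal.mul_mem_mul hf (Ideal.pow_mem_pow (show PS2.t k ∈ PS2.maxIdeal k from Ideal.subset_span (by simp)) (s * d - M))
      rwa [← pow_add, show M + 1 + (s * d - M) = s * d + 1 by omega] at h3
    have hz : algebraMap (PS2 k) (FunT k) 0 / tL k ^ (s * d) ∈ c.sections s := by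
      rw [map_zero, zero_div]
      exact zero_mem _
    have h3 := (hbij s).injOn ((mul_mem_twistedSections_iff c hc s _ _).mpr h1) ((mul_mem_twistedSections_iff c hc s _ _).mpr hz) (by
      rw [Ideal.Quotient.mk_eq_mk_iff_sub_mem, mul_zero, sub_zero]
      exact Ideal.mul_mem_left _ _ h2)
    have h4 := mul_left_cancel₀ hc.isUnit.ne_zero h3
    exact (mul_eq_zero.mp h4).resolve_right (pow_ne_zero _ PS2.t_ne_zero)

omit hd in
lemma exists_sections_sub_mem [IsIso e] (n : ℕ) (a : PS2 k) :
    ∃ f : PS2 k, algebraMap _ (FunT k) f / tL k ^ (n * d) ∈ c.sections n ∧ f - a ∈ PS2.maxIdeal k ^ (n * d + 1) := by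
  obtain ⟨b, hb, hba⟩ := (hbij n).surjOn (Set.mem_univ (Ideal.Quotient.mk _ (G.valueAtOne e * a)))
  obtain ⟨f, rfl⟩ := hc.isUnit.dvd (a := b)
  refine ⟨f, (mul_mem_twistedSections_iff c hc n _ _).mp hb, ?_⟩
  rw [Ideal.Quotient.mk_eq_mk_iff_sub_mem, ← mul_sub] at hba
  exact (Ideal.unit_mul_mem_iff_mem _ hc.isUnit).mp hba

/-- A priori an element of the filtration belongs only to some larger twist. Condition 3 supplies an
element of twist n with the same jet, and `eq_zero` identifies the two. -/
lemma mem_filtration_iff [IsIso e] {n : ℕ} {f : PS2 k} :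
    f ∈ c.filtration (n * d) ↔ algebraMap _ (FunT k) f / tL k ^ (n * d) ∈ c.sections n := by
  refine ⟨fun hf => ?_, fun hf => ⟨n, hf⟩⟩
  obtain ⟨f', hf', hff'⟩ := exists_sections_sub_mem c hc hbij n f
  have h1 := (filteredSections c hc hd hbij).eq_zero (Submodule.sub_mem _ ⟨n, hf'⟩ hf) hff'
  rwa [← sub_eq_zero.mp h1]

/-- If `𝒪_X = F`, the filtration is the one of a polynomial ring in two variables. -/
theorem exists_coordinates [IsIso e] (hr : G.rank = 1) (hD : IsEffectiveCartier D) (hcyc : HasCycle D (curveIdeal G.j) d) :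
    ∃ x y : PS2 k, x - PS2.u k ∈ PS2.maxIdeal k ^ 2 ∧ y - 1 ∈ PS2.maxIdeal k ^ 2 ∧
      ∀ M f, f ∈ c.filtration M ↔ ∃ Q ∈ PS2.Forms k M, PS2.evalAt x y Q = f := by
  have hex {n : ℕ} {b : FunT k} (hb : b ∈ c.sections n) := exists_eq_mul_of_mem_sections c hD hcyc hr hb
  obtain ⟨V, hV, g, -, hg, -⟩ := G.exists_generators
  obtain ⟨w, hw, hgw⟩ := G.exists_toPS2_eq hV hg
  rw [hr, pow_one] at hgw
  obtain ⟨m, hm⟩ := c.exists_mem (basePoint G.j)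
  have hm' := genPt_mem_of_basePoint_mem G.j hm
  have hp := c.ne_zero m hm'
  have ht := tL_ne_zero (k := k)
  -- The equation g of C at P, which pulls back to w t, is written as a quotient of sections over a
  -- chart containing P, and these in turn as sections of twists divided by powers of p_m.
  obtain ⟨a, s, hs, has⟩ := exists_germ_mul_eq (c.U m).2 hm (G.X.presheaf.germ V.1 _ hV g)
  have hs0 : pullL G.j hm' s ≠ 0 := (genPt_mem_basicOpen_iff hm' s).mp (genPt_mem G.j hs)
  have has' : pullL G.j (genPt_mem_of_basePoint_mem G.j hV) g * pullL G.j hm' s = pullL G.j hm' a := by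
    have h1 := congrArg (fun z => algebraMap (PS2 k) (FunT k) (stalkR G.j z)) has
    simp only [map_mul, stalkR_germ, algebraMap_toPS2] at h1
    exact h1
  obtain ⟨n₁, b₁, hb₁, h₁⟩ := (AffineCharts.mem_OL_iff_exists_sections hm').mp ⟨a, rfl⟩
  obtain ⟨n₂, b₂, hb₂, h₂⟩ := (AffineCharts.mem_OL_iff_exists_sections hm').mp ⟨s, rfl⟩
  have hpow (n : ℕ) : c.p m ^ n ∈ c.sections n := by
    simpa using AffineCharts.aeval_mem_sections (c := c) (n := n) (Q := MvPolynomial.X m ^ n) (isHomogeneous_X_pow m n)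
  -- Numerator and denominator are brought to one twist n; the summand 1 makes n d positive, so that
  -- n d - 1 makes sense.
  let n := n₁ + n₂ + 1
  have hb₁' : b₁ * c.p m ^ (n₂ + 1) ∈ c.sections n := by
    have := AffineCharts.mul_mem_sections hb₁ (hpow (n₂ + 1))
    exact this
  have hb₂' : b₂ * c.p m ^ (n₁ + 1) ∈ c.sections n := by
    have := AffineCharts.mul_mem_sections hb₂ (hpow (n₁ + 1))
    rwa [show n₂ + (n₁ + 1) = n by omega] at this
  obtain ⟨f₀, hf₀⟩ := hex hb₂'
  obtain ⟨q, hnd⟩ : ∃ q, q + 1 = n * d := ⟨_, Nat.sub_add_cancel (Nat.mul_pos (Nat.succ_pos _) hd)⟩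
  have hb0 : b₂ ≠ 0 := fun h0 => hs0 (by rw [h₂, h0, zero_div])
  have hf0 : f₀ ≠ 0 := by
    rintro rfl
    rw [map_zero, zero_div, eq_comm] at hf₀
    exact mul_ne_zero hb0 (pow_ne_zero _ hp) hf₀
  -- The denominator gives f₀ in degree n d. As w t times the denominator is the numerator, of the
  -- same twist, w f₀ has degree n d - 1.
  refine (filteredSections c hc hd hbij).exists_coordinates hd (fun n a => ?_) (q := q) (f₀ := f₀) hw hf0 ?_ ?_
  · obtain ⟨f, hf, hfa⟩ := exists_sections_sub_mem c hc hbij n a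
    exact ⟨f, ⟨n, hf⟩, hfa⟩
  · rw [hnd]
    exact ⟨n, by rwa [hf₀]⟩
  · refine ⟨n, ?_⟩
    convert hb₁' using 1
    rw [← algebraMap_toPS2 G.j hV, hgw, h₁, h₂, map_mul] at has'
    have h3 : algebraMap (PS2 k) (FunT k) (PS2.t k) = tL k := rfl
    rw [h3] at has'
    rw [div_eq_iff (pow_ne_zero _ ht)] at hf₀
    rw [map_mul, hf₀, ← hnd]
    field_simp at has' ⊢
    linear_combination tL k ^ q * c.p m * has'

end GeometricDatum

end

/-! ### The isomorphism of X with the projective plane. -/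

section

section
open MvPolynomial
variable {k : Type u} [Field k]

instance (N : ℕ) : IsProper (PSpace.toSpec k N) := by
  have : IsProper (Spec.map (CommRingCat.ofHom
      (algebraMap k (MvPolynomial.homogeneousSubmodule (Fin (N + 1)) k 0)))) := by
    have : IsClosedImmersion (Spec.map (CommRingCat.ofHom
      (algebraMap k (MvPolynomial.homogeneousSubmodule (Fin (N + 1)) k 0)))) := by
      refine IsClosedImmersion.spec_of_surjective _ ?_
      rintro ⟨f, hf⟩
      rw [homogeneousSubmodule_zero] at hf
      obtain ⟨c, hc⟩ := Submodule.mem_one.mp hf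
      exact ⟨c, Subtype.ext hc⟩
    infer_instance
  rw [PSpace.toSpec]
  infer_instance

lemma curveIdeal_eq_comap {X Y : Scheme.{u}} (j : FormalT k ⟶ X) [QuasiCompact j] (φ : X ≅ Y) :
    curveIdeal j = (curveIdeal (j ≫ φ.hom)).comap φ.hom := by
  have h1 : curveIdeal (j ≫ φ.hom) = (curveIdeal j).map φ.hom := by
    rw [curveIdeal, ← Category.assoc, Scheme.Hom.ker_comp]
    rfl
  have h2 (I : X.IdealSheafData) : (I.comap φ.inv).comap φ.hom = I := by
    rw [← Scheme.IdealSheafData.comap_comp, Iso.hom_inv_id, Scheme.IdealSheafData.comap_id]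
  rw [h1]
  apply le_antisymm
  · have h3 : (curveIdeal j).comap φ.inv ≤ (curveIdeal j).map φ.hom :=
      Scheme.IdealSheafData.le_map_iff_comap_le.mpr (h2 _).le
    have h4 := Scheme.IdealSheafData.comap_mono φ.hom h3
    exact (h2 _).symm.le.trans h4
  · exact Scheme.IdealSheafData.comap_map_le _ _

/-- Two schemes under `T` with the same affine charts are isomorphic, if one of them is proper. -/
theorem exists_iso_of_OL_eq {X Y S : Scheme.{u}} [IsIntegral X] [IsIntegral Y] [X.IsSeparated] [Y.IsSeparated] [S.IsSeparated]
    (j : FormalT k ⟶ X) (j' : FormalT k ⟶ Y) [IsDominant j] [IsDominant j'] {ι : Type*} (U : ι → X.Opens)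
    (V : ι → Y.Opens) (hU : ∀ m, IsAffineOpen (U m)) (hV : ∀ m, IsAffineOpen (V m)) (h : ∀ m, genPt j ∈ U m)
    (h' : ∀ m, genPt j' ∈ V m) (hcov : ∀ x, ∃ m, x ∈ U m) (hOL : ∀ m, OL j' (h' m) = OL j (h m))
    (p : X ⟶ S) (q : Y ⟶ S) [IsProper p] [IsSeparated q] (hpq : j ≫ p = j' ≫ q) :
    ∃ Φ : X ≅ Y, j ≫ Φ.hom = j' ∧ Φ.hom ≫ q = p := by
  obtain ⟨φ, hφ, hφU⟩ := exists_hom_of_OL_le j j' U V hU hV h h' hcov fun m => (hOL m).le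
  have hφs : φ ≫ q = p := ext_of_isDominant j (by rw [reassoc_of% hφ, hpq])
  have hφd : IsDominant φ := by
    have : IsDominant (j ≫ φ) := by rwa [hφ]
    exact IsDominant.of_comp j φ
  have hφp : IsProper φ := by
    have : IsProper (φ ≫ q) := by rwa [hφs]
    exact IsProper.of_comp φ q
  -- A proper dominant morphism is surjective, so the open sets V cover Y and the inverse can be
  -- glued in the same way.
  have hφsurj : Surjective φ := surjective_of_isDominant_of_isClosed_range φ φ.isClosedMap.isClosed_range
  obtain ⟨ψ, hψ, -⟩ := exists_hom_of_OL_le j' j V U hV hU h' h (fun z => by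
      obtain ⟨x, rfl⟩ := φ.surjective z
      obtain ⟨m, hm⟩ := hcov x
      exact ⟨m, hφU m hm⟩) fun m => (hOL m).ge
  exact ⟨⟨φ, ψ, ext_of_isDominant j (by rw [reassoc_of% hφ, hψ, Category.comp_id]),
    ext_of_isDominant j' (by rw [reassoc_of% hψ, hφ, Category.comp_id])⟩, hφ, hφs⟩

end

namespace GeometricDatum
open MvPolynomial
variable {k : Type u} [Field k] {G : GeometricDatum k}

instance : IsProper G.str := by
  obtain ⟨N, i, hi, hs⟩ := G.projective
  rw [← hs]
  infer_instance

/-- If `𝒪_X = F`, then `X` is the projective plane and `C` is a line. -/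
theorem isPlaneWithLine_of_isIso {e : OMod G.X ⟶ G.F} (hc : G.IsCanonicalEmbedding e) [IsIso e] : G.IsPlaneWithLine := by
  have hr := rank_eq_one_of_isIso hc
  obtain ⟨D, d, hd, hD, ⟨N, i, l, hi, his, hl, hl0, hDl⟩, hcyc, hbij⟩ := G.sections_iso
  replace hbij (n : ℕ) : Set.BijOn (Ideal.Quotient.mk (PS2.maxIdeal k ^ (n * d + 1)))
      (twistedSections G.incl D n (n * d)) Set.univ := by
    have := hbij n
    rw [hr, mul_one] at this
    exact this
  obtain ⟨c, -⟩ := exists_affineCharts (j := G.j) i (by rw [Category.assoc, his]; exact G.j_over) hl hl0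
    hDl fun U hU f hf => G.ne_zero_of_isEffectiveCartier hD hU hf
  have hW := filteredSections c hc hd hbij
  obtain ⟨x, y, hx, hy, H⟩ := exists_coordinates c hc hd hbij hr hD hcyc
  have ht := tL_ne_zero (k := k)
  let v : Fin 3 → PS2 k := ![x, y, PS2.t k]
  have hv (Q : MvPolynomial (Fin 3) k) : aeval v Q = PS2.evalAt x y Q := rfl
  have hyu : IsUnit (v 1) := by
    have h1 : y - 1 ∈ PS2.maxIdeal k := Ideal.pow_le_self two_ne_zero hy
    rw [PS2.mem_maxIdeal_iff, map_sub, map_one, sub_eq_zero] at h1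
    rw [MvPowerSeries.isUnit_iff_constantCoeff]
    change IsUnit (MvPowerSeries.constantCoeff y)
    rw [h1]
    exact isUnit_one
  let J := PSpace.ofCoords v hyu
  have hJ : IsDominant J := PSpace.isDominant_ofCoords v hyu fun n Q hQ h0 => PS2.evalAt_injective hx hy hQ h0
  have hJi : IsIntegral (PSpace k 2) := PSpace.isIntegral_of_isDominant J
  have hJs : J ≫ PSpace.toSpec k 2 = _ := PSpace.ofCoords_toSpec v hyu
  have hJC : curveIdeal J = PSpace.hyperplane (MvPolynomial.X 2) :=
    PSpace.curveIdeal_ofCoords v hyu (PSpace.X_mem 2) (aeval_X v 2) fun n Q hQ h => hW.X_dvd_of_t_dvd hx hy H hQ h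
  have hform {n : ℕ} {b : FunT k} (hb : b ∈ c.sections n) : ∃ Q ∈ PS2.Forms k (n * d),
      algebraMap _ (FunT k) (aeval v Q) / tL k ^ (n * d) = b := by
    obtain ⟨f, hf⟩ := exists_eq_mul_of_mem_sections c hD hcyc hr hb
    obtain ⟨Q, hQ, rfl⟩ := (H (n * d) f).mp ⟨n, by rwa [hf]⟩
    exact ⟨Q, hQ, hf⟩
  -- The coordinates of X are forms of degree d in x, y, t divided by t^d, so the chart of X where
  -- p_m is invertible corresponds to the complement of the plane curve Q_m = 0.
  have hpform (m) : ∃ Q ∈ PS2.Forms k d, algebraMap _ (FunT k) (aeval v Q) / tL k ^ d = c.p m := by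
    simpa using hform (AffineCharts.p_mem_sections m)
  choose Q hQ hQp using hpform
  have hQ' (m) : Q m ∈ homogeneousSubmodule (Fin (2 + 1)) k d := hQ m
  have hcoord := PSpace.isCoord_ofCoords v hyu
  -- Only nonempty charts are kept, since p_m, and with it Q_m, may vanish for the others.
  let S := {m // genPt G.j ∈ (c.U m).1}
  have hmem (m : S) : genPt J ∈ PSpace.D (Q m.1) := by
    intro h0
    have h1 := (PSpace.mem_genPt_ofCoords v hyu (hQ' m.1)).mp h0
    have h2 := hQp m.1
    rw [h1, map_zero, zero_div] at h2
    exact c.ne_zero m.1 m.2 h2.symm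
  have haff (m : S) : IsAffineOpen (PSpace.D (Q m.1)) := PSpace.isAffineOpen_D (hQ' m.1) hd
  -- Both rings consist of forms of degree n d in x, y, t over n-th powers of Q_m, because the
  -- sections of twist n are exactly the filtration in degree n d.
  have hOL (m : S) : OL J (hmem m) = OL G.j m.2 := by
    have hev (P : MvPolynomial (Fin 3) k) : aeval (fun i => algebraMap (PS2 k) (FunT k) (v i)) P = algebraMap _ _ (aeval v P) :=
      aeval_algebraMap_apply (FunT k) v P
    ext z
    rw [hcoord.mem_OL (hQ' m.1) hd, AffineCharts.mem_OL_iff_exists_sections]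
    have hdiv (n : ℕ) (P : MvPolynomial (Fin 3) k) : aeval (fun i => algebraMap (PS2 k) (FunT k) (v i)) P /
        aeval (fun i => algebraMap (PS2 k) (FunT k) (v i)) (Q m.1) ^ n =
          algebraMap _ (FunT k) (aeval v P) / tL k ^ (n * d) / c.p m.1 ^ n := by
      have h2 := c.ne_zero m.1 m.2
      have h1 : algebraMap (PS2 k) (FunT k) (aeval v (Q m.1)) = c.p m.1 * tL k ^ d := (div_eq_iff (pow_ne_zero _ ht)).mp (hQp m.1)
      rw [hev, hev, h1, mul_pow, ← pow_mul, mul_comm d n, div_div, mul_comm (tL k ^ _)]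
    constructor
    · rintro ⟨n, P, hP, rfl⟩
      exact ⟨n, _, (mem_filtration_iff c hc hd hbij).mp ((H (n * d) _).mpr ⟨P, hP, rfl⟩), hdiv n P⟩
    · rintro ⟨n, b, hb, rfl⟩
      obtain ⟨P, hP, rfl⟩ := hform hb
      exact ⟨n, P, hP, (hdiv n P).symm⟩
  have hcov (x : G.X) : ∃ m : S, x ∈ (c.U m.1).1 := by
    obtain ⟨m, hm⟩ := c.exists_mem x
    exact ⟨⟨m, genPt_mem G.j hm⟩, hm⟩
  obtain ⟨Φ, hΦ, hΦs⟩ := exists_iso_of_OL_eq G.j J (fun m : S => (c.U m.1).1) (fun m => PSpace.D (Q m.1)) (fun m => (c.U m.1).2)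
    haff (fun m => m.2) hmem hcov hOL G.str (PSpace.toSpec k 2) (by rw [hJs, G.j_over])
  refine ⟨Φ, MvPolynomial.X 2, hΦs, isHomogeneous_X k 2, X_ne_zero 2, ?_⟩
  have h1 := curveIdeal_eq_comap G.j Φ
  rw [hΦ, hJC] at h1
  exact h1

end GeometricDatum

end

end

theorem proposition2p1 {k : Type u} [Field k] [CharZero k] (G : GeometricDatum k) :
    (∃! e : OMod G.X ⟶ G.F, G.IsCanonicalEmbedding e) ∧
    ∀ e : OMod G.X ⟶ G.F, G.IsCanonicalEmbedding e →
      Mono e ∧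
      (IsIso (G.stalkMap e) → G.rank = 1) ∧
      (IsIso e ↔ G.rank = 1 ∧ G.IsPlaneWithLine) := by
  refine ⟨G.existsUnique_canonicalEmbedding, fun e hc => ⟨hc.mono, GeometricDatum.rank_eq_one hc, fun h => ?_, fun h => ?_⟩⟩
  · exact ⟨GeometricDatum.rank_eq_one_of_isIso hc, GeometricDatum.isPlaneWithLine_of_isIso hc⟩
  · exact GeometricDatum.isIso_of_isPlaneWithLine hc h.1 h.2
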